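/- A \emph{feedback vertex set} (fvs) of a finite simple undirected graph $G$ is a set $S\subseteq V(G)$ such that $G-S$ is a forest, and an fvs $S$ is \emph{minimal} if no proper subset of $S$ is an fvs of $G$. The problem \textsc{Max Min FVS} is: given a finite simple undirected graph $G$ and an integer $k\in\mathbb{N}$, decide whether $G$ has a minimal feedback vertex set of size at least $k$. \textbf{Theorem.} \textsc{Max Min FVS} can be solved in time $10^k\cdot n^{O(1)}$, where $n=|V(G)|$. That is, there are a deterministic algorithm and constants $C,c\in\mathbb{N}$ such that, for every graph $G$ on $n$ vertices and every $k\in\mathbb{N}$, the algorithm halts on input $(G,k)$ after at most $C\cdot 10^k\cdot (n+1)^{c}$ steps and correctly decides whether $G$ has a minimal feedback vertex set of size at least $k$. -/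

import Mathlib

/-!
Part 1: feedback vertex sets and the decision problem.
Part 2: the computation model, the first-order fragment of pure LISP: recursively defined
functions on binary trees of cons cells, with a step-counting evaluation semantics.
Part 3: the encoding of instances, and what it means to decide a problem within a time bound.
-/

namespace MaxMinFVS

/-! ### Feedback vertex sets -/

/-- `S` is a feedback vertex set of `G`: deleting `S` leaves a forest. -/
def IsFVS {V : Type*} (G : SimpleGraph V) (S : Finset V) : Prop :=
  (G.induce {v | v ∉ S}).IsAcyclic

/-- `S` is a minimal feedback vertex set: no proper subset of it is a feedback vertex set. -/
def IsMinimalFVS {V : Type*} (G : SimpleGraph V) (S : Finset V) : Prop :=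
  IsFVS G S ∧ ∀ T : Finset V, T ⊂ S → ¬ IsFVS G T

/-- An instance of Max Min FVS: a finite simple undirected graph and a natural number. -/
structure Instance where
  /-- the number of vertices -/
  n : ℕ
  /-- the graph -/
  graph : SimpleGraph (Fin n)
  /-- the parameter -/
  k : ℕ

/-- The question of Max Min FVS: is there a minimal feedback vertex set of size at least `k`? -/
def Instance.IsYes (I : Instance) : Prop :=
  ∃ S : Finset (Fin I.n), IsMinimalFVS I.graph S ∧ I.k ≤ S.card

/-! ### The computation model -/

/-- The data of the model: binary trees, built from the atom `nil` by cons cells. -/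
inductive Data : Type
  | nil : Data
  | cons : Data → Data → Data

/-- The first component of a cons cell (`nil` for the atom). -/
def Data.hd : Data → Data
  | .nil => .nil
  | .cons a _ => a

/-- The second component of a cons cell (`nil` for the atom). -/
def Data.tl : Data → Data
  | .nil => .nil
  | .cons _ b => b

/-- Expressions. Variables are de Bruijn indices into the local environment. -/
inductive Expr : Type
  | var : ℕ → Expr
  | nil : Expr
  | cons : Expr → Expr → Expr
  | hd : Expr → Expr
  | tl : Expr → Expr
  /-- `ite c e₁ e₂`: if the value of `c` is a cons cell then `e₁`, else `e₂` -/
  | ite : Expr → Expr → Expr → Expr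
  /-- `letE e b`: evaluate `e`, bind its value to variable `0`, and evaluate `b` -/
  | letE : Expr → Expr → Expr
  /-- `call f e`: call function number `f` of the program on the value of `e` -/
  | call : ℕ → Expr → Expr

/-- A program is a finite list of bodies of (mutually recursive) functions of one argument;
in each body the argument is variable `0`. -/
abbrev Program := List Expr

/-- `Eval P env e v t`: in the environment `env`, the expression `e` of the program `P` evaluates
(call by value) to `v` in exactly `t` steps. Every evaluation of a syntactic node is one step.
A step follows or allocates a bounded number of pointers (trees are never copied or compared), and
the length of `env` is bounded in terms of `P`, so a step is a bounded number of operations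
of a random access machine on memory addresses. -/
inductive Eval (P : Program) : List Data → Expr → Data → ℕ → Prop
  | var (env : List Data) (i : ℕ) (v : Data) (h : env[i]? = some v) :
      Eval P env (.var i) v 1
  | nil (env : List Data) :
      Eval P env .nil .nil 1
  | cons (env : List Data) (e₁ e₂ : Expr) (v₁ v₂ : Data) (t₁ t₂ : ℕ)
      (h₁ : Eval P env e₁ v₁ t₁) (h₂ : Eval P env e₂ v₂ t₂) :
      Eval P env (.cons e₁ e₂) (.cons v₁ v₂) (t₁ + t₂ + 1)
  | hd (env : List Data) (e : Expr) (v : Data) (t : ℕ) (h : Eval P env e v t) :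
      Eval P env (.hd e) v.hd (t + 1)
  | tl (env : List Data) (e : Expr) (v : Data) (t : ℕ) (h : Eval P env e v t) :
      Eval P env (.tl e) v.tl (t + 1)
  | ite_cons (env : List Data) (c e₁ e₂ : Expr) (a b v : Data) (t₁ t₂ : ℕ)
      (hc : Eval P env c (.cons a b) t₁) (h : Eval P env e₁ v t₂) :
      Eval P env (.ite c e₁ e₂) v (t₁ + t₂ + 1)
  | ite_nil (env : List Data) (c e₁ e₂ : Expr) (v : Data) (t₁ t₂ : ℕ)
      (hc : Eval P env c .nil t₁) (h : Eval P env e₂ v t₂) :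
      Eval P env (.ite c e₁ e₂) v (t₁ + t₂ + 1)
  | letE (env : List Data) (e b : Expr) (u v : Data) (t₁ t₂ : ℕ)
      (he : Eval P env e u t₁) (hb : Eval P (u :: env) b v t₂) :
      Eval P env (.letE e b) v (t₁ + t₂ + 1)
  | call (env : List Data) (f : ℕ) (e body : Expr) (u v : Data) (t₁ t₂ : ℕ)
      (hf : P[f]? = some body) (he : Eval P env e u t₁) (hb : Eval P [u] body v t₂) :
      Eval P env (.call f e) v (t₁ + t₂ + 1)

/-- On input `x`, the program `P` halts with output `y` after exactly `t` steps. A run of `P` is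
a call of its function number `0`. -/
def Program.Outputs (P : Program) (x y : Data) (t : ℕ) : Prop :=
  Eval P [x] (.call 0 (.var 0)) y t

/-! ### Encodings and time-bounded decision -/

/-- Truth values as data. -/
def Data.ofBool : Bool → Data
  | false => .nil
  | true => .cons .nil .nil

/-- Lists as data: the usual `nil`-terminated chains of cons cells. -/
def Data.ofList : List Data → Data
  | [] => .nil
  | a :: l => .cons a (Data.ofList l)

/-- Natural numbers in unary. -/
def Data.ofNat (m : ℕ) : Data := Data.ofList (List.replicate m .nil)

open Classical in
/-- A graph is given by the list of the rows of its adjacency matrix. -/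
noncomputable def encodeGraph {n : ℕ} (G : SimpleGraph (Fin n)) : Data :=
  Data.ofList (List.ofFn fun i : Fin n =>
    Data.ofList (List.ofFn fun j : Fin n => Data.ofBool (decide (G.Adj i j))))

/-- An instance is given by its graph and its parameter. -/
noncomputable def Instance.encode (I : Instance) : Data :=
  .cons (encodeGraph I.graph) (Data.ofNat I.k)

/-- `P` decides the problem `IsYes` on the inputs `encode a`, and its running time
on `encode a` is at most `bound a`. -/
def Program.DecidesInTime {α : Type*} (P : Program) (encode : α → Data) (IsYes : α → Prop)
    (bound : α → ℕ) : Prop :=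
  ∀ a : α, ∃ (b : Bool) (t : ℕ),
    P.Outputs (encode a) (Data.ofBool b) t ∧ t ≤ bound a ∧ (b = true ↔ IsYes a)

end MaxMinFVS

/-! The complements of the minimal feedback vertex sets are the maximal induced forests
(`isMinimalFVS_iff`), so a maximal induced forest with at least `k` vertices outside is sought. A
greedy maximal forest gives an initial set `S`, its complement. If `S` has at least `k` vertices,
the answer is yes. Otherwise a search tree decides vertex by vertex what to keep (`F`) and what to
delete. Every state extends `F` greedily to a maximal forest and accepts if at least `k` vertices
are outside, so soundness is immediate. Completeness (`State.exists_acc_init`) follows a maximal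
forest `H` with `k + e` vertices outside, where `e` is as small as possible.

Once `S` is decided, the undecided set `U` is a forest. As long as a component of `U` sends three or
more edges to `F`, there is a valid vertex to branch on (`exists_validAt`). Either decision on it
pays with ears, disjoint connected sets that send two edges to `F`. A forest has fewer edges than
vertices, so it contains few disjoint ears, and an ear outside the forest contains a deleted vertex
(`ears_card`). If `d` valid vertices are deleted, `f` are kept, `ν` vertices are deleted in the last
phase and `s = #(S ∩ H)`, then `d + f ≤ s + k` and `f ≤ s + ν` (`EarInv.add_le`, `EarInv.kept_le`).

In the last phase every component of `U` sends at most two edges to `F` (`Thin`). The maximal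
forests between `F` and `F ∪ U` then satisfy an exchange property and have equal size
(`Thin.exchange`, `Thin.card_eq`), so all of them have `k + e` vertices outside, and the only danger
is that a deleted vertex can be added again. A deleted valid vertex has at most one neighbour in a
component with more than one edge to `F`, hence the vertices to be kept for its sake are determined
(`Thin.mem_of_forced`, `Thin.exists_forced_insert`). Let `N` be the set of vertices kept by
branching because every solution contains them. Exchanging such a vertex gives a forest that is not
maximal; by the choice of `e` a maximal extension gains at least `e + 1` vertices of `S \ H`, while
each vertex of `S \ H` is gained for at most two members of `N`. Thus `#N * (e + 1) ≤ 2 * #(S \ H)`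
(`Thin.card_mul_le`).

If `#N ≤ 1`, budgets that grow with `S ∩ H` give at most `5 ^ #S * 2 ^ k * (n + 1)` leaves.
Otherwise `#(S \ H) = e + j` with `#N ≤ 2 * j`, and a scheme with `e` free deletions gives `(17 / 6)
^ #S * 3 ^ k` leaves. Since `#S ≤ k`, both are at most `10 ^ k * (n + 1)`. The unknown parameters
are enumerated by the list of initial states.

For the machine model, a step of the search is written in a language whose only loops run over a
fixed list of length `n`. Its terms take polynomial time by construction (`Tm.eval_compile`), and
they are compiled together with a stack-driven search (`exists_search_program`). -/

namespace MaxMinFVS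

/-! ### A loop language and its compilation -/

/-- Expressions with a bounded loop over a fixed list, the clock. -/
inductive Tm : Type
  | var : ℕ → Tm
  | nil : Tm
  | cons : Tm → Tm → Tm
  | hd : Tm → Tm
  | tl : Tm → Tm
  | ite : Tm → Tm → Tm → Tm
  /-- `loop init body` folds `body` over the clock; in `body`, variable `0` is the current item
  of the clock and variable `1` is the accumulator -/
  | loop : Tm → Tm → Tm

/-- Case distinction on data. -/
def Data.cond {α : Type*} : Data → α → α → α
  | .nil, _, y => y
  | .cons _ _, x, _ => x

/-- The value of a term. -/
def Tm.eval (clk : List Data) : Tm → List Data → Data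
  | .var i, env => env.getD i .nil
  | .nil, _ => .nil
  | .cons s t, env => .cons (s.eval clk env) (t.eval clk env)
  | .hd t, env => (t.eval clk env).hd
  | .tl t, env => (t.eval clk env).tl
  | .ite c s t, env => (c.eval clk env).cond (s.eval clk env) (t.eval clk env)
  | .loop i b, env => clk.foldl (fun acc x => b.eval clk (x :: acc :: env)) (i.eval clk env)

/-- The clock and the environment of a term, as one datum. -/
def pack (clk env : List Data) : Data := .cons (Data.ofList clk) (Data.ofList env)

/-- The expression that takes `i` tails. -/
def tlN (e : Expr) : ℕ → Expr
  | 0 => e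
  | i + 1 => .tl (tlN e i)

/-- The recursive function that runs a loop whose compiled body is `b`; its argument
is `(remaining clock . (accumulator . packed environment))`. -/
def loopFn (f : ℕ) (b : Expr) : Expr :=
  .ite (.hd (.var 0))
    (.call f (.cons (.tl (.hd (.var 0))) (.cons
      (.letE (.cons (.hd (.tl (.tl (.var 0)))) (.cons (.hd (.hd (.var 0)))
        (.cons (.hd (.tl (.var 0))) (.tl (.tl (.tl (.var 0))))))) b)
      (.tl (.tl (.var 0))))))
    (.hd (.tl (.var 0)))

/-- Compilation: an expression, and the functions it needs, to be placed from number `m` on. -/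
def Tm.compile : Tm → ℕ → Expr × List Expr
  | .var i, _ => (.hd (tlN (.tl (.var 0)) i), [])
  | .nil, _ => (.nil, [])
  | .cons s t, m =>
      let p := s.compile m
      let q := t.compile (m + p.2.length)
      (.cons p.1 q.1, p.2 ++ q.2)
  | .hd t, m => (.hd (t.compile m).1, (t.compile m).2)
  | .tl t, m => (.tl (t.compile m).1, (t.compile m).2)
  | .ite c s t, m =>
      let p := c.compile m
      let q := s.compile (m + p.2.length)
      let r := t.compile (m + (p.2 ++ q.2).length)
      (.ite p.1 q.1 r.1, (p.2 ++ q.2) ++ r.2)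
  | .loop i b, m =>
      let p := i.compile m
      let q := b.compile (m + p.2.length)
      let f := m + (p.2 ++ q.2).length
      (.call f (.cons (.hd (.var 0)) (.cons p.1 (.var 0))), (p.2 ++ q.2) ++ [loopFn f q.1])

/-- The functions `fs` occur in the program `P` from number `m` on. -/
def Located (P : Program) (m : ℕ) (fs : List Expr) : Prop :=
  ∀ j b, fs[j]? = some b → P[m + j]? = some b

lemma Located.left {P : Program} {m : ℕ} {fs gs : List Expr} (h : Located P m (fs ++ gs)) :
    Located P m fs := by
  intro j b hj
  refine h j b ?_
  rw [List.getElem?_append_left]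
  · exact hj
  · exact (List.getElem?_eq_some_iff.1 hj).1

lemma Located.right {P : Program} {m : ℕ} {fs gs : List Expr} (h : Located P m (fs ++ gs)) :
    Located P (m + fs.length) gs := by
  intro j b hj
  have := h (fs.length + j) b (by rw [List.getElem?_append_right (by omega)]; simpa using hj)
  rwa [← Nat.add_assoc] at this

lemma Data.hd_iterate_tl_ofList (env : List Data) (i : ℕ) :
    (Data.tl^[i] (Data.ofList env)).hd = env.getD i .nil := by
  induction env generalizing i with
  | nil =>
    have : ∀ i, Data.tl^[i] Data.nil = Data.nil := fun i => by
      induction i with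
      | zero => rfl
      | succ i ih => rw [Function.iterate_succ_apply, Data.tl, ih]
    simp [Data.ofList, this, Data.hd]
  | cons a l ih =>
    cases i with
    | zero => rfl
    | succ i => rw [Function.iterate_succ_apply]; simpa [Data.ofList, Data.tl] using ih i

lemma eval_tlN {P : Program} {env : List Data} {e : Expr} {v : Data} {t : ℕ}
    (h : Eval P env e v t) (i : ℕ) : Eval P env (tlN e i) (Data.tl^[i] v) (t + i) := by
  induction i with
  | zero => exact h
  | succ i ih => rw [Function.iterate_succ_apply']; exact .tl _ _ _ _ ih

lemma Eval.ite_cond {P : Program} {env : List Data} {c e₁ e₂ : Expr} {u v₁ v₂ : Data}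
    {t₀ t₁ t₂ : ℕ} (hc : Eval P env c u t₀) (h₁ : Eval P env e₁ v₁ t₁)
    (h₂ : Eval P env e₂ v₂ t₂) :
    ∃ t ≤ t₀ + t₁ + t₂ + 1, Eval P env (.ite c e₁ e₂) (u.cond v₁ v₂) t := by
  cases u with
  | nil => exact ⟨_, by omega, .ite_nil _ _ _ _ _ _ _ hc h₂⟩
  | cons a b => exact ⟨_, by omega, .ite_cons _ _ _ _ _ _ _ _ _ hc h₁⟩

open Polynomial in
/-- A compiled term computes the value of the term in polynomially many steps. -/
theorem Tm.eval_compile (P : Program) (t : Tm) : ∀ m : ℕ, Located P m (t.compile m).2 →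
    ∃ p : ℕ[X], ∀ clk env rest : List Data, ∃ T ≤ p.eval clk.length,
      Eval P (pack clk env :: rest) (t.compile m).1 (t.eval clk env) T := by
  induction t with
  | var i =>
    refine fun m _ => ⟨C (3 + i), fun clk env rest => ⟨3 + i, by simp, ?_⟩⟩
    have h := Eval.hd _ _ _ _ (eval_tlN
      (Eval.tl _ _ _ _ (Eval.var (P := P) (pack clk env :: rest) 0 _ rfl)) i)
    simp only [Tm.compile, Tm.eval]
    rw [show (pack clk env).tl = Data.ofList env from rfl, Data.hd_iterate_tl_ofList] at h
    convert h using 1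
    omega
  | nil => exact fun m _ => ⟨C 1, fun clk env rest => ⟨1, by simp, .nil _⟩⟩
  | cons s t hs ht =>
    intro m hl
    obtain ⟨p, hp⟩ := hs _ hl.left
    obtain ⟨q, hq⟩ := ht _ hl.right
    refine ⟨p + q + C 1, fun clk env rest => ?_⟩
    obtain ⟨T₁, h₁, e₁⟩ := hp clk env rest
    obtain ⟨T₂, h₂, e₂⟩ := hq clk env rest
    exact ⟨_, by simp only [eval_add, eval_C]; omega, .cons _ _ _ _ _ _ _ e₁ e₂⟩
  | hd t ht =>
    intro m hl
    obtain ⟨p, hp⟩ := ht _ hl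
    refine ⟨p + C 1, fun clk env rest => ?_⟩
    obtain ⟨T₁, h₁, e₁⟩ := hp clk env rest
    exact ⟨_, by simp only [eval_add, eval_C]; omega, .hd _ _ _ _ e₁⟩
  | tl t ht =>
    intro m hl
    obtain ⟨p, hp⟩ := ht _ hl
    refine ⟨p + C 1, fun clk env rest => ?_⟩
    obtain ⟨T₁, h₁, e₁⟩ := hp clk env rest
    exact ⟨_, by simp only [eval_add, eval_C]; omega, .tl _ _ _ _ e₁⟩
  | ite c s t hc hs ht =>
    intro m hl
    obtain ⟨r, hr⟩ := hc _ hl.left.left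
    obtain ⟨p, hp⟩ := hs _ hl.left.right
    obtain ⟨q, hq⟩ := ht _ hl.right
    refine ⟨r + p + q + C 1, fun clk env rest => ?_⟩
    obtain ⟨T₀, h₀, e₀⟩ := hr clk env rest
    obtain ⟨T₁, h₁, e₁⟩ := hp clk env rest
    obtain ⟨T₂, h₂, e₂⟩ := hq clk env rest
    obtain ⟨T, hT, e⟩ := e₀.ite_cond e₁ e₂
    exact ⟨T, by simp only [eval_add, eval_C]; omega, e⟩
  | loop i b hi hb =>
    intro m hl
    obtain ⟨p, hp⟩ := hi _ hl.left.left
    obtain ⟨q, hq⟩ := hb _ hl.left.right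
    have hf := hl.right 0 _ rfl
    rw [Nat.add_zero] at hf
    -- `X` stands for the length of the clock, that is, the number of rounds. A round costs one run
    -- of the body, at most `q`, and a constant overhead for which 60 is generous.
    refine ⟨p + C 20 + X * (q + C 60), fun clk env rest => ?_⟩
    set f := m + ((i.compile m).2 ++ (b.compile (m + (i.compile m).2.length)).2).length with hfdef
    set b' := (b.compile (m + (i.compile m).2.length)).1 with hb'
    have key : ∀ (l : List Data) (acc : Data), ∃ T ≤ l.length * (q.eval clk.length + 60) + 10,
        Eval P [.cons (Data.ofList l) (.cons acc (pack clk env))] (loopFn f b')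
          (l.foldl (fun acc x => b.eval clk (x :: acc :: env)) acc) T := by
      intro l
      induction l with
      | nil =>
        intro acc
        have v0 := Eval.var (P := P) [.cons (Data.ofList []) (.cons acc (pack clk env))] 0 _ rfl
        have e := Eval.ite_nil _ _ (.call f (.cons (.tl (.hd (.var 0))) (.cons
          (.letE (.cons (.hd (.tl (.tl (.var 0)))) (.cons (.hd (.hd (.var 0)))
            (.cons (.hd (.tl (.var 0))) (.tl (.tl (.tl (.var 0))))))) b')
          (.tl (.tl (.var 0)))))) _ _ _ _ (.hd _ _ _ _ v0) (.hd _ _ _ _ (.tl _ _ _ _ v0))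
        exact ⟨_, by omega, e⟩
      | cons x l ih =>
        intro acc
        obtain ⟨T₁, h₁, e₁⟩ := ih (b.eval clk (x :: acc :: env))
        obtain ⟨T₂, h₂, e₂⟩ := hq clk (x :: acc :: env)
          [.cons (Data.ofList (x :: l)) (.cons acc (pack clk env))]
        have v0 := Eval.var (P := P)
          [.cons (Data.ofList (x :: l)) (.cons acc (pack clk env))] 0 _ rfl
        have ePack := Eval.cons _ _ _ _ _ _ _ (.hd _ _ _ _ (.tl _ _ _ _ (.tl _ _ _ _ v0)))
          (.cons _ _ _ _ _ _ _ (.hd _ _ _ _ (.hd _ _ _ _ v0))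
            (.cons _ _ _ _ _ _ _ (.hd _ _ _ _ (.tl _ _ _ _ v0))
              (.tl _ _ _ _ (.tl _ _ _ _ (.tl _ _ _ _ v0)))))
        have e := Eval.ite_cons _ _ _ (.hd (.tl (.var 0))) _ _ _ _ _ (.hd _ _ _ _ v0)
          (.call _ _ _ _ _ _ _ _ hf (.cons _ _ _ _ _ _ _ (.tl _ _ _ _ (.hd _ _ _ _ v0))
            (.cons _ _ _ _ _ _ _ (.letE _ _ _ _ _ _ _ ePack e₂)
              (.tl _ _ _ _ (.tl _ _ _ _ v0)))) e₁)
        refine ⟨_, ?_, e⟩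
        rw [List.length_cons, Nat.succ_mul]
        omega
    obtain ⟨T₁, h₁, e₁⟩ := hp clk env rest
    obtain ⟨T₂, h₂, e₂⟩ := key clk (i.eval clk env)
    have v0 := Eval.var (P := P) (pack clk env :: rest) 0 _ rfl
    refine ⟨_, ?_, .call _ _ _ _ _ _ _ _ hf (.cons _ _ _ _ _ _ _ (.hd _ _ _ _ v0)
      (.cons _ _ _ _ _ _ _ e₁ v0)) e₂⟩
    simp only [eval_add, eval_mul, eval_C, eval_X]
    omega

open Polynomial in
lemma Polynomial_eval_le_mul_pow (p : ℕ[X]) :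
    ∃ K d : ℕ, ∀ n : ℕ, p.eval n ≤ K * (n + 1) ^ d := by
  refine ⟨∑ i ∈ Finset.range (p.natDegree + 1), p.coeff i, p.natDegree, fun n => ?_⟩
  rw [eval_eq_sum_range, Finset.sum_mul]
  refine Finset.sum_le_sum fun i hi => Nat.mul_le_mul_left _ ?_
  exact (Nat.pow_le_pow_left (by omega) i).trans
    (Nat.pow_le_pow_right (by omega) (by simpa [Nat.lt_succ_iff] using hi))

/-! ### Weakening -/

/-- Renaming of variables that makes room for a new variable `c`. -/
def Tm.lift : Tm → ℕ → Tm
  | .var i, c => .var (if i < c then i else i + 1)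
  | .nil, _ => .nil
  | .cons s t, c => .cons (s.lift c) (t.lift c)
  | .hd t, c => .hd (t.lift c)
  | .tl t, c => .tl (t.lift c)
  | .ite r s t, c => .ite (r.lift c) (s.lift c) (t.lift c)
  | .loop i b, c => .loop (i.lift c) (b.lift (c + 2))

/-- Makes a term available inside loops, where new variables are pushed. The prefix `xs` is
arbitrary because the induction passes under the two binders of a loop. -/
lemma Tm.eval_lift (clk : List Data) (t : Tm) : ∀ (xs ys : List Data) (y : Data),
    (t.lift xs.length).eval clk (xs ++ y :: ys) = t.eval clk (xs ++ ys) := by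
  induction t with
  | var i =>
    intro xs ys y
    simp only [Tm.lift, Tm.eval, List.getD_eq_getElem?_getD]
    split_ifs with h
    · rw [List.getElem?_append_left h, List.getElem?_append_left h]
    · rw [List.getElem?_append_right (by omega), List.getElem?_append_right (by omega),
        Nat.sub_add_comm (by omega), List.getElem?_cons_succ]
  | nil => intros; rfl
  | cons s t hs ht => intros; simp only [Tm.lift, Tm.eval, hs, ht]
  | hd t ht => intros; simp only [Tm.lift, Tm.eval, ht]
  | tl t ht => intros; simp only [Tm.lift, Tm.eval, ht]
  | ite r s t hr hs ht => intros; simp only [Tm.lift, Tm.eval, hr, hs, ht]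
  | loop i b hi hb =>
    intro xs ys y
    simp only [Tm.lift, Tm.eval, hi]
    congr 1
    funext acc x
    exact hb (x :: acc :: xs) ys y

/-! ### Depth-first search with an explicit stack -/

/-- The clock for graphs on `n` vertices: the vertices, in unary. -/
def clock (n : ℕ) : List Data := (List.finRange n).map fun i : Fin n => Data.ofNat i

/-- A run of the search: `step` tells whether a state is accepting (`none`) or else lists its
children; `Run step l b N` says that the search of the stack `l` answers `b` after visiting
`N` states. -/
inductive Run {σ : Type*} (step : σ → Option (List σ)) : List σ → Bool → ℕ → Prop
  | nil : Run step [] false 0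
  | accept (s : σ) (l : List σ) (h : step s = none) : Run step (s :: l) true 1
  | expand (s : σ) (l ch : List σ) (b : Bool) (N : ℕ) (h : step s = some ch)
      (hr : Run step (ch ++ l) b N) : Run step (s :: l) b (N + 1)

/-- The encoding of the result of a step. -/
def encStep {σ : Type*} (enc : σ → Data) : Option (List σ) → Data
  | none => .cons (.cons .nil .nil) .nil
  | some ch => .cons .nil (Data.ofList (ch.map enc))

/-- The function that makes the clock; its argument is `(list . next item)`. -/
def clockFn : Expr :=
  .ite (.hd (.var 0))
    (.cons (.tl (.var 0)) (.call 2 (.cons (.tl (.hd (.var 0))) (.cons .nil (.tl (.var 0))))))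
    .nil

/-- The new stack, from the result of a step in variable `0` and the argument of `searchFn` in
variable `1`. -/
def pushExpr : Expr :=
  .ite (.tl (.var 0))
    (.cons (.hd (.tl (.var 0))) (.ite (.tl (.tl (.var 0)))
      (.cons (.hd (.tl (.tl (.var 0)))) (.tl (.hd (.var 1)))) (.tl (.hd (.var 1)))))
    (.tl (.hd (.var 1)))

/-- The search; its argument is `(stack . packed environment)`. -/
def searchFn (step : Expr) : Expr :=
  .ite (.hd (.var 0))
    (.letE (.letE (.cons (.hd (.tl (.var 0))) (.cons (.hd (.hd (.var 0))) (.tl (.tl (.var 0))))) step)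
      (.ite (.hd (.var 0)) (.cons .nil .nil) (.call 1 (.cons pushExpr (.tl (.var 1))))))
    .nil

/-- The main function; its argument is `(list of rows . parameter)`. -/
def mainFn (init : Expr) : Expr :=
  .letE (.cons (.call 2 (.cons (.hd (.var 0)) .nil))
      (.cons (.hd (.var 0)) (.cons (.tl (.var 0)) .nil)))
    (.letE init (.call 1 (.cons (.var 0) (.var 1))))

lemma eval_clockFn (P : Program) (hP : P[2]? = some clockFn) (l : List Data) : ∀ m : ℕ,
    ∃ T ≤ 20 * l.length + 10, Eval P [.cons (Data.ofList l) (Data.ofNat m)] clockFn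
      (Data.ofList ((List.range' m l.length).map Data.ofNat)) T := by
  induction l with
  | nil =>
    intro m
    have v0 := Eval.var (P := P) [.cons (Data.ofList []) (Data.ofNat m)] 0 _ rfl
    have e := Eval.ite_nil _ _ (.cons (.tl (.var 0))
      (.call 2 (.cons (.tl (.hd (.var 0))) (.cons .nil (.tl (.var 0)))))) _ _ _ _
      (.hd _ _ _ _ v0) (.nil _)
    exact ⟨_, by simp, e⟩
  | cons x l ih =>
    intro m
    obtain ⟨T, hT, e⟩ := ih (m + 1)
    have v0 := Eval.var (P := P) [.cons (Data.ofList (x :: l)) (Data.ofNat m)] 0 _ rfl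
    have e := Eval.ite_cons _ _ _ .nil _ _ _ _ _ (.hd _ _ _ _ v0)
      (.cons _ _ _ _ _ _ _ (.tl _ _ _ _ v0) (.call _ _ _ _ _ _ _ _ hP
        (.cons _ _ _ _ _ _ _ (.tl _ _ _ _ (.hd _ _ _ _ v0))
          (.cons _ _ _ _ _ _ _ (.nil _) (.tl _ _ _ _ v0))) e))
    refine ⟨_, ?_, e⟩
    simp only [List.length_cons]
    omega

lemma clock_eq (n : ℕ) : clock n = (List.range' 0 n).map Data.ofNat := by
  rw [clock, ← List.range_eq_range']
  refine List.ext_getElem (by simp) fun i h₁ h₂ => ?_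
  rw [List.getElem_map, List.getElem_map, List.getElem_finRange, List.getElem_range]
  rfl

/-- With at most two children, two case distinctions replace a recursive append, so that pushing
costs a constant. -/
lemma eval_pushExpr {σ : Type*} (P : Program) (enc : σ → Data) (s : σ) (l ch : List σ)
    (hch : ch.length ≤ 2) (E : Data) : ∃ T ≤ 40,
    Eval P [encStep enc (some ch), .cons (Data.ofList ((s :: l).map enc)) E] pushExpr
      (Data.ofList ((ch ++ l).map enc)) T := by
  have v0 := Eval.var (P := P)
    [encStep enc (some ch), .cons (Data.ofList ((s :: l).map enc)) E] 0 _ rfl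
  have v1 := Eval.var (P := P)
    [encStep enc (some ch), .cons (Data.ofList ((s :: l).map enc)) E] 1 _ rfl
  have r := Eval.tl _ _ _ _ (Eval.hd _ _ _ _ v1)
  have i := (Eval.tl _ _ _ _ (Eval.tl _ _ _ _ v0)).ite_cond
    (.cons _ _ _ _ _ _ _ (.hd _ _ _ _ (.tl _ _ _ _ (.tl _ _ _ _ v0))) r) r
  obtain ⟨t, ht, i⟩ := i
  obtain ⟨T, hT, e⟩ := (Eval.tl _ _ _ _ v0).ite_cond
    (.cons _ _ _ _ _ _ _ (.hd _ _ _ _ (.tl _ _ _ _ v0)) i) r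
  refine ⟨T, by omega, ?_⟩
  match ch, hch with
  | [], _ => exact e
  | [a], _ => exact e
  | [a, b], _ => exact e

lemma eval_searchFn {σ : Type*} (P : Program) (stepE : Expr) (hP : P[1]? = some (searchFn stepE))
    (clk env : List Data) (enc : σ → Data) (step : σ → Option (List σ)) (B : ℕ)
    (hstep : ∀ s rest, ∃ T ≤ B, Eval P (pack clk (enc s :: env) :: rest) stepE
      (encStep enc (step s)) T)
    (hch : ∀ s ch, step s = some ch → ch.length ≤ 2) (l : List σ) (b : Bool) (N : ℕ)
    (hr : Run step l b N) :
    ∃ T ≤ (B + 100) * (N + 1),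
      Eval P [.cons (Data.ofList (l.map enc)) (pack clk env)] (searchFn stepE) (Data.ofBool b) T := by
  induction hr with
  | nil =>
    have v0 := Eval.var (P := P) [.cons (Data.ofList (([] : List σ).map enc)) (pack clk env)]
      0 _ rfl
    have e := Eval.ite_nil _ _ (.letE (.letE (.cons (.hd (.tl (.var 0)))
      (.cons (.hd (.hd (.var 0))) (.tl (.tl (.var 0))))) stepE)
      (.ite (.hd (.var 0)) (.cons .nil .nil) (.call 1 (.cons pushExpr (.tl (.var 1)))))) _ _ _ _
      (.hd _ _ _ _ v0) (.nil _)
    exact ⟨_, by omega, e⟩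
  | accept s l h =>
    set E := [Data.cons (Data.ofList ((s :: l).map enc)) (pack clk env)] with hE
    have v0 := Eval.var (P := P) E 0 _ rfl
    obtain ⟨T, hT, e⟩ := hstep s E
    rw [h] at e
    have w0 := Eval.var (P := P) (encStep enc (none : Option (List σ)) :: E) 0 _ rfl
    have e := Eval.ite_cons _ _ _ .nil _ _ _ _ _ (.hd _ _ _ _ v0)
      (.letE _ _ _ _ _ _ _ (.letE _ _ _ _ _ _ _ (.cons _ _ _ _ _ _ _
        (.hd _ _ _ _ (.tl _ _ _ _ v0)) (.cons _ _ _ _ _ _ _ (.hd _ _ _ _ (.hd _ _ _ _ v0))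
          (.tl _ _ _ _ (.tl _ _ _ _ v0)))) e)
        (.ite_cons _ _ _ (.call 1 (.cons pushExpr (.tl (.var 1)))) _ _ _ _ _ (.hd _ _ _ _ w0)
          (.cons _ _ _ _ _ _ _ (.nil _) (.nil _))))
    exact ⟨_, by omega, e⟩
  | expand s l ch b N h hr ih =>
    obtain ⟨T', hT', ih⟩ := ih
    set E := [Data.cons (Data.ofList ((s :: l).map enc)) (pack clk env)] with hE
    have v0 := Eval.var (P := P) E 0 _ rfl
    obtain ⟨T, hT, e⟩ := hstep s E
    rw [h] at e
    have w0 := Eval.var (P := P) (encStep enc (some ch) :: E) 0 _ rfl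
    have w1 := Eval.var (P := P) (encStep enc (some ch) :: E) 1 _ rfl
    obtain ⟨T₂, hT₂, e₂⟩ := eval_pushExpr P enc s l ch (hch s ch h) (pack clk env)
    have e := Eval.ite_cons _ _ _ .nil _ _ _ _ _ (.hd _ _ _ _ v0)
      (.letE _ _ _ _ _ _ _ (.letE _ _ _ _ _ _ _ (.cons _ _ _ _ _ _ _
        (.hd _ _ _ _ (.tl _ _ _ _ v0)) (.cons _ _ _ _ _ _ _ (.hd _ _ _ _ (.hd _ _ _ _ v0))
          (.tl _ _ _ _ (.tl _ _ _ _ v0)))) e)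
        (.ite_nil _ _ (.cons .nil .nil) _ _ _ _ (.hd _ _ _ _ w0)
          (.call _ _ _ _ _ _ _ _ hP (.cons _ _ _ _ _ _ _ e₂ (.tl _ _ _ _ w1)) ih)))
    refine ⟨_, ?_, e⟩
    rw [Nat.mul_succ (B + 100) (N + 1)]
    omega

open Polynomial in
/-- The search whose initial stack and whose steps are given by terms, as a program. -/
theorem exists_search_program (initT stepT : Tm) : ∃ (P : Program) (p : ℕ[X]),
    ∀ (σ : Type) (rows : List Data) (kd : Data) (enc : σ → Data) (init : List σ)
      (step : σ → Option (List σ)),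
      initT.eval (clock rows.length) [Data.ofList rows, kd] = Data.ofList (init.map enc) →
      (∀ s, stepT.eval (clock rows.length) [enc s, Data.ofList rows, kd] = encStep enc (step s)) →
      (∀ s ch, step s = some ch → ch.length ≤ 2) →
      ∀ b N, Run step init b N → ∃ t ≤ p.eval rows.length * (N + 1),
        P.Outputs (.cons (Data.ofList rows) kd) (Data.ofBool b) t := by
  -- Numbers 0, 1 and 2 belong to `mainFn`, `searchFn` and `clockFn`, so the functions of the terms
  -- start at 3.
  set fi := initT.compile 3 with hfi
  set fs := stepT.compile (3 + fi.2.length) with hfs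
  set P : Program := [mainFn fi.1, searchFn fs.1, clockFn] ++ (fi.2 ++ fs.2) with hP
  have hloc : Located P 3 (fi.2 ++ fs.2) := by
    intro j b hj
    rw [hP, Nat.add_comm]
    exact hj
  obtain ⟨p, hp⟩ := Tm.eval_compile P initT 3 hloc.left
  obtain ⟨q, hq⟩ := Tm.eval_compile P stepT (3 + fi.2.length) hloc.right
  refine ⟨P, p + q + 20 * X + C 200, fun σ rows kd enc init step hinit hstep hch b N hr => ?_⟩
  have hlen : (clock rows.length).length = rows.length := by simp [clock]
  obtain ⟨T₁, h₁, e₁⟩ := eval_searchFn P fs.1 rfl (clock rows.length) [Data.ofList rows, kd] enc step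
    (q.eval rows.length) (fun s rest => by
      obtain ⟨T, hT, e⟩ := hq (clock rows.length) (enc s :: [Data.ofList rows, kd]) rest
      rw [hstep, hlen] at *
      exact ⟨T, hT, e⟩) hch init b N hr
  obtain ⟨T₂, h₂, e₂⟩ := hp (clock rows.length) [Data.ofList rows, kd] [.cons (Data.ofList rows) kd]
  obtain ⟨T₃, h₃, e₃⟩ := eval_clockFn P rfl rows 0
  rw [← clock_eq] at e₃
  rw [hinit] at e₂
  rw [hlen] at h₂
  have v0 := Eval.var (P := P) [.cons (Data.ofList rows) kd] 0 _ rfl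
  set E := [pack (clock rows.length) [Data.ofList rows, kd], .cons (Data.ofList rows) kd] with hE
  have w0 := Eval.var (P := P) (Data.ofList (init.map enc) :: E) 0 _ rfl
  have w1 := Eval.var (P := P) (Data.ofList (init.map enc) :: E) 1 _ rfl
  have hmain : P[0]? = some (mainFn fi.1) := rfl
  have hsearch : P[1]? = some (searchFn fs.1) := rfl
  have hclock : P[2]? = some clockFn := rfl
  have e := Eval.call _ _ _ _ _ _ _ _ hmain v0
    (.letE _ _ _ _ _ _ _ (.cons _ _ _ _ _ _ _ (.call _ _ _ _ _ _ _ _ hclock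
      (.cons _ _ _ _ _ _ _ (.hd _ _ _ _ v0) (.nil _)) e₃)
      (.cons _ _ _ _ _ _ _ (.hd _ _ _ _ v0) (.cons _ _ _ _ _ _ _ (.tl _ _ _ _ v0) (.nil _))))
      (.letE _ _ _ _ _ _ _ e₂ (.call _ _ _ _ _ _ _ _ hsearch (.cons _ _ _ _ _ _ _ w0 w1) e₁)))
  refine ⟨_, ?_, e⟩
  simp only [eval_add, eval_mul, eval_C, eval_X, eval_ofNat]
  nlinarith [Nat.zero_le (N * (p.eval rows.length)), Nat.zero_le (N * rows.length)]

/-! ### Functions computed by terms -/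

open Classical in
/-- Truth values of propositions as data. -/
noncomputable def Data.ofProp (p : Prop) : Data := Data.ofBool (decide p)

lemma Data.ofProp_true {p : Prop} (h : p) : Data.ofProp p = .cons .nil .nil := by
  simp [Data.ofProp, h, Data.ofBool]

lemma Data.ofProp_false {p : Prop} (h : ¬p) : Data.ofProp p = .nil := by
  simp [Data.ofProp, h, Data.ofBool]

lemma Data.tl_ofNat (m : ℕ) : (Data.ofNat m).tl = Data.ofNat (m - 1) := by
  cases m <;> rfl

/-- Sets of vertices as data: characteristic lists. -/
noncomputable def Data.ofSet {n : ℕ} (s : Finset (Fin n)) : Data :=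
  Data.ofList (List.ofFn fun i => Data.ofProp (i ∈ s))

/-- `f a` is computed, from the environment `env a` and with the clock of `n a`, by a term that
does not depend on `a`. -/
def Comp {α : Type} (n : α → ℕ) (env : α → List Data) (f : α → Data) : Prop :=
  ∃ t : Tm, ∀ a, t.eval (clock (n a)) (env a) = f a

/-- The predicate `p` is computed by a term. -/
abbrev CompP {α : Type} (n : α → ℕ) (env : α → List Data) (p : α → Prop) : Prop :=
  Comp n env fun a => Data.ofProp (p a)

/-- The set-valued function `s` is computed by a term. -/
abbrev CompS {α : Type} (n : α → ℕ) (env : α → List Data) (s : ∀ a, Finset (Fin (n a))) : Prop :=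
  Comp n env fun a => Data.ofSet (s a)

/-- The number-valued function `m` is computed by a term. -/
abbrev CompN {α : Type} (n : α → ℕ) (env : α → List Data) (m : α → ℕ) : Prop :=
  Comp n env fun a => Data.ofNat (m a)

/-- The vertex-valued function `v` is computed by a term. -/
abbrev CompV {α : Type} (n : α → ℕ) (env : α → List Data) (v : ∀ a, Fin (n a)) : Prop :=
  Comp n env fun a => Data.ofNat (v a)

section
variable {α : Type} {n : α → ℕ} {env : α → List Data}

lemma Comp.congr {f g : α → Data} (h : Comp n env f) (e : ∀ a, f a = g a) : Comp n env g :=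
  (funext e : f = g) ▸ h

lemma CompP.congr {p q : α → Prop} (h : CompP n env p) (e : ∀ a, p a ↔ q a) : CompP n env q :=
  (funext fun a => propext (e a) : p = q) ▸ h

lemma CompS.congr {s t : ∀ a, Finset (Fin (n a))} (h : CompS n env s) (e : ∀ a, s a = t a) :
    CompS n env t :=
  (funext e : s = t) ▸ h

lemma Comp.var {f : α → Data} (i : ℕ) (h : ∀ a, (env a).getD i .nil = f a) : Comp n env f :=
  ⟨.var i, h⟩

lemma Comp.nil : Comp n env fun _ => .nil := ⟨.nil, fun _ => rfl⟩

lemma Comp.cons {f g : α → Data} : Comp n env f → Comp n env g →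
    Comp n env fun a => .cons (f a) (g a) := by
  rintro ⟨s, hs⟩ ⟨t, ht⟩
  exact ⟨.cons s t, fun a => by rw [Tm.eval, hs, ht]⟩

lemma Comp.hd {f : α → Data} : Comp n env f → Comp n env fun a => (f a).hd := by
  rintro ⟨s, hs⟩
  exact ⟨.hd s, fun a => by rw [Tm.eval, hs]⟩

lemma Comp.tl {f : α → Data} : Comp n env f → Comp n env fun a => (f a).tl := by
  rintro ⟨s, hs⟩
  exact ⟨.tl s, fun a => by rw [Tm.eval, hs]⟩

lemma Comp.cond {c f g : α → Data} : Comp n env c → Comp n env f → Comp n env g →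
    Comp n env fun a => (c a).cond (f a) (g a) := by
  rintro ⟨r, hr⟩ ⟨s, hs⟩ ⟨t, ht⟩
  exact ⟨.ite r s t, fun a => by rw [Tm.eval, hr, hs, ht]⟩

open Classical in
lemma Comp.ite {p : α → Prop} {f g : α → Data} (hp : CompP n env p) (hf : Comp n env f)
    (hg : Comp n env g) : Comp n env fun a => if p a then f a else g a :=
  (hp.cond hf hg).congr fun a => by
    by_cases h : p a
    · rw [Data.ofProp_true h, if_pos h]; rfl
    · rw [Data.ofProp_false h, if_neg h]; rfl

lemma Comp.wk {f : α → Data} (x : α → Data) :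
    Comp n env f → Comp n (fun a => x a :: env a) f := by
  rintro ⟨t, ht⟩
  exact ⟨t.lift 0, fun a => by rw [← ht]; exact Tm.eval_lift _ t [] (env a) (x a)⟩

lemma Comp.wkOne {f x : α → Data} (y : α → Data) :
    Comp n (fun a => x a :: env a) f → Comp n (fun a => x a :: y a :: env a) f := by
  rintro ⟨t, ht⟩
  exact ⟨t.lift 1, fun a => by rw [← ht]; exact Tm.eval_lift _ t [x a] (env a) (y a)⟩

lemma Comp.comap {γ : Type} (φ : γ → α) {f : α → Data} :
    Comp n env f → Comp (fun c => n (φ c)) (fun c => env (φ c)) fun c => f (φ c) := by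
  rintro ⟨t, ht⟩
  exact ⟨t, fun c => ht _⟩

/-- Weakening by a vertex. -/
lemma Comp.wkV {f : α → Data} (h : Comp n env f) :
    Comp (α := Σ a, Fin (n a)) (fun x => n x.1) (fun x => Data.ofNat x.2 :: env x.1)
      fun x => f x.1 :=
  (h.comap Sigma.fst).wk _

lemma CompV.zero : CompV (α := Σ a, Fin (n a)) (fun x => n x.1)
    (fun x => Data.ofNat x.2 :: env x.1) fun x => x.2 :=
  Comp.var 0 fun _ => rfl

/-- The loop principle behind all later ones. The accumulator lives in a type `β a` with an
encoding, and the body has to be right on encodings only. -/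
lemma Comp.fold {β : α → Type} (enc : ∀ a, β a → Data) {init : ∀ a, β a}
    {F : ∀ a, Fin (n a) → β a → β a} (hi : Comp n env fun a => enc a (init a))
    (hF : Comp (α := Σ a, Fin (n a) × β a) (fun x => n x.1)
      (fun x => Data.ofNat x.2.1 :: enc x.1 x.2.2 :: env x.1)
      fun x => enc x.1 (F x.1 x.2.1 x.2.2)) :
    Comp n env fun a => enc a ((List.finRange (n a)).foldl (fun b i => F a i b) (init a)) := by
  obtain ⟨s, hs⟩ := hi
  obtain ⟨t, ht⟩ := hF
  refine ⟨.loop s t, fun a => ?_⟩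
  rw [Tm.eval, hs]
  have key : ∀ (l : List (Fin (n a))) (b : β a),
      (l.map fun i : Fin (n a) => Data.ofNat i).foldl
        (fun acc x => t.eval (clock (n a)) (x :: acc :: env a)) (enc a b) =
      enc a (l.foldl (fun b i => F a i b) b) := by
    intro l
    induction l with
    | nil => intro b; rfl
    | cons i l ih =>
      intro b
      rw [List.map_cons, List.foldl_cons, List.foldl_cons, ← ih]
      congr 1
      exact ht ⟨a, i, b⟩
  exact key _ _

lemma foldl_eq_iterate {β γ : Type*} (F : β → β) (l : List γ) : ∀ b : β,
    l.foldl (fun b _ => F b) b = F^[l.length] b := by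
  induction l with
  | nil => intro b; rfl
  | cons i l ih => intro b; exact ih _

lemma Comp.iterate {β : α → Type} (enc : ∀ a, β a → Data) {init : ∀ a, β a}
    {F : ∀ a, β a → β a} (hi : Comp n env fun a => enc a (init a))
    (hF : Comp (α := Σ a, β a) (fun x => n x.1) (fun x => enc x.1 x.2 :: env x.1)
      fun x => enc x.1 (F x.1 x.2)) :
    Comp n env fun a => enc a ((F a)^[n a] (init a)) := by
  refine (Comp.fold enc (F := fun a _ b => F a b) hi ?_).congr fun a => ?_
  · exact (hF.comap fun x : Σ a, Fin (n a) × β a => ⟨x.1, x.2.2⟩).wk _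
  · rw [foldl_eq_iterate, List.length_finRange]

/-! #### Propositional combinators -/

lemma CompP.and {p q : α → Prop} (hp : CompP n env p) (hq : CompP n env q) :
    CompP n env fun a => p a ∧ q a :=
  (Comp.ite hp hq Comp.nil).congr fun a => by
    by_cases h : p a
    · simp only [h, if_true, true_and]
    · simp only [h, if_false, false_and]; rw [Data.ofProp_false not_false]

lemma CompP.not {p : α → Prop} (hp : CompP n env p) : CompP n env fun a => ¬p a :=
  (Comp.ite hp Comp.nil (Comp.nil.cons Comp.nil)).congr fun a => by
    by_cases h : p a
    · rw [if_pos h, Data.ofProp_false (not_not.2 h)]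
    · rw [if_neg h, Data.ofProp_true h]

lemma CompP.or {p q : α → Prop} (hp : CompP n env p) (hq : CompP n env q) :
    CompP n env fun a => p a ∨ q a :=
  (hp.not.and hq.not).not.congr fun a => by tauto

lemma CompP.imp {p q : α → Prop} (hp : CompP n env p) (hq : CompP n env q) :
    CompP n env fun a => p a → q a :=
  (hp.and hq.not).not.congr fun a => by tauto

/-- A quantifier over vertices is a loop over the clock; hence every first-order condition on
vertices, sets and edges is computable. -/
lemma CompP.exists {P : ∀ a, Fin (n a) → Prop}
    (h : CompP (α := Σ a, Fin (n a)) (fun x => n x.1) (fun x => Data.ofNat x.2 :: env x.1)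
      fun x => P x.1 x.2) :
    CompP n env fun a => ∃ i, P a i := by
  have := Comp.fold (n := n) (env := env) (β := fun _ => Prop) (fun _ p => Data.ofProp p)
    (init := fun _ => False) (F := fun a i b => P a i ∨ b)
    (Comp.nil.congr fun a => (Data.ofProp_false not_false).symm)
    (CompP.or ((h.comap fun x : Σ a, Fin (n a) × Prop => ⟨x.1, x.2.1⟩).wkOne _)
      (Comp.var 1 fun _ => rfl))
  refine this.congr fun a => congrArg _ (propext ?_)
  have key : ∀ (l : List (Fin (n a))) (b : Prop),
      l.foldl (fun b i => P a i ∨ b) b ↔ (∃ i ∈ l, P a i) ∨ b := by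
    intro l
    induction l with
    | nil => simp
    | cons i l ih => intro b; rw [List.foldl_cons, ih]; simp only [List.mem_cons]; grind
  rw [key]
  simp

lemma CompP.forall {P : ∀ a, Fin (n a) → Prop}
    (h : CompP (α := Σ a, Fin (n a)) (fun x => n x.1) (fun x => Data.ofNat x.2 :: env x.1)
      fun x => P x.1 x.2) :
    CompP n env fun a => ∀ i, P a i :=
  (CompP.exists (P := fun a i => ¬P a i) h.not).not.congr fun _ => not_exists_not

/-! #### Numbers -/

/-- All loops make exactly `n a` rounds. A loop of `m a ≤ n a` rounds is simulated by a unary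
counter that idles once it is empty. Subtraction, comparison and indexing rest on this. -/
lemma Comp.iterate_tl {m : α → ℕ} {d : α → Data} (hm : CompN n env m) (hmn : ∀ a, m a ≤ n a)
    (hd : Comp n env d) : Comp n env fun a => Data.tl^[m a] (d a) := by
  have h := Comp.iterate (n := n) (env := env) (β := fun _ => Data × Data)
    (fun _ p => .cons p.1 p.2) (init := fun a => (Data.ofNat (m a), d a))
    (F := fun _ p => (p.1.tl, p.1.cond p.2.tl p.2)) (hm.cons hd) (by
      have v : Comp (α := Σ _ : α, Data × Data) (fun x => n x.1)
          (fun x => Data.cons x.2.1 x.2.2 :: env x.1) fun x => .cons x.2.1 x.2.2 :=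
        Comp.var 0 fun _ => rfl
      exact v.hd.tl.cons (v.hd.cond v.tl.tl v.tl))
  refine h.tl.congr fun a => ?_
  have key : ∀ (N m : ℕ) (d : Data), m ≤ N →
      ((fun p : Data × Data => (p.1.tl, p.1.cond p.2.tl p.2))^[N] (Data.ofNat m, d)).2 =
        Data.tl^[m] d := by
    intro N
    induction N with
    | zero => intro m d h; obtain rfl : m = 0 := by omega
              rfl
    | succ N ih =>
      intro m d h
      rw [Function.iterate_succ_apply]
      cases m with
      | zero => exact ih 0 d (by omega)
      | succ m => exact ih m d.tl (by omega)
  exact key _ _ _ (hmn a)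

lemma iterate_tl_ofNat (m k : ℕ) : Data.tl^[m] (Data.ofNat k) = Data.ofNat (k - m) := by
  induction m with
  | zero => rfl
  | succ m ih => rw [Function.iterate_succ_apply', ih, Data.tl_ofNat]; rfl

lemma CompN.sub {k m : α → ℕ} (hk : CompN n env k) (hm : CompN n env m) (hmn : ∀ a, m a ≤ n a) :
    CompN n env fun a => k a - m a :=
  (hm.iterate_tl hmn hk).congr fun _ => iterate_tl_ofNat _ _

lemma CompN.pred {k : α → ℕ} (hk : CompN n env k) : CompN n env fun a => k a - 1 :=
  hk.tl.congr fun _ => Data.tl_ofNat _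

lemma CompN.succ {k : α → ℕ} (hk : CompN n env k) : CompN n env fun a => k a + 1 :=
  Comp.nil.cons hk

lemma CompN.pos {k : α → ℕ} (hk : CompN n env k) : CompP n env fun a => 0 < k a :=
  (hk.cond (Comp.nil.cons Comp.nil) Comp.nil).congr fun a => by
    rcases Nat.eq_zero_or_pos (k a) with h | h
    · rw [Data.ofProp_false (by omega), h]; rfl
    · rw [Data.ofProp_true h, ← Nat.succ_pred_eq_of_pos h]; rfl

lemma CompN.le {k m : α → ℕ} (hk : CompN n env k) (hm : CompN n env m) (hmn : ∀ a, m a ≤ n a) :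
    CompP n env fun a => k a ≤ m a :=
  (hk.sub hm hmn).pos.not.congr fun a => by omega

lemma CompV.le {v w : ∀ a, Fin (n a)} (hv : CompV n env v) (hw : CompV n env w) :
    CompP n env fun a => v a ≤ w a :=
  CompN.le hv hw fun a => (w a).2.le

lemma CompV.eq {v w : ∀ a, Fin (n a)} (hv : CompV n env v) (hw : CompV n env w) :
    CompP n env fun a => v a = w a :=
  ((hv.le hw).and (hw.le hv)).congr fun _ => le_antisymm_iff.symm

/-! #### Lists, sets and graphs -/

lemma Comp.getD {L : α → List Data} {v : ∀ a, Fin (n a)} (hL : Comp n env fun a => Data.ofList (L a))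
    (hv : CompV n env v) : Comp n env fun a => (L a).getD (v a) .nil :=
  (Comp.iterate_tl hv (fun a => (v a).2.le) hL).hd.congr fun _ => Data.hd_iterate_tl_ofList _ _

lemma CompP.mem {s : ∀ a, Finset (Fin (n a))} {v : ∀ a, Fin (n a)} (hv : CompV n env v)
    (hs : CompS n env s) : CompP n env fun a => v a ∈ s a :=
  (Comp.getD hs hv).congr fun a => by simp

lemma encodeGraph_eq {m : ℕ} (G : SimpleGraph (Fin m)) : encodeGraph G =
    Data.ofList (List.ofFn fun i => Data.ofList (List.ofFn fun j => Data.ofProp (G.Adj i j))) := by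
  simp only [encodeGraph, Data.ofProp]

lemma CompP.adj {G : ∀ a, SimpleGraph (Fin (n a))} {v w : ∀ a, Fin (n a)}
    (hG : Comp n env fun a => encodeGraph (G a)) (hv : CompV n env v) (hw : CompV n env w) :
    CompP n env fun a => (G a).Adj (v a) (w a) := by
  simp only [encodeGraph_eq] at hG
  refine (Comp.getD (L := fun a => List.ofFn fun j => Data.ofProp ((G a).Adj (v a) j)) ?_ hw).congr
    fun a => by simp
  exact (Comp.getD hG hv).congr fun a => by simp

/-- Needed because a fold that collects a characteristic list produces it backwards. -/
lemma Comp.reverse {L : α → List Data} (hL : Comp n env fun a => Data.ofList (L a))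
    (hlen : ∀ a, (L a).length = n a) : Comp n env fun a => Data.ofList (L a).reverse := by
  have h := Comp.iterate (n := n) (env := env) (β := fun _ => List Data × List Data)
    (fun _ p => .cons (Data.ofList p.1) (Data.ofList p.2)) (init := fun a => (L a, []))
    (F := fun _ p => (p.1.tail, p.1.headD .nil :: p.2)) (hL.cons Comp.nil) (by
      have v : Comp (α := Σ _ : α, List Data × List Data) (fun x => n x.1)
          (fun x => Data.cons (Data.ofList x.2.1) (Data.ofList x.2.2) :: env x.1)
          fun x => .cons (Data.ofList x.2.1) (Data.ofList x.2.2) :=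
        Comp.var 0 fun _ => rfl
      refine (v.hd.tl.cons (v.hd.hd.cons v.tl)).congr fun x => ?_
      rcases x with ⟨a, l, l'⟩
      cases l <;> rfl)
  refine h.tl.congr fun a => ?_
  have key : ∀ l l' : List Data,
      ((fun p : List Data × List Data => (p.1.tail, p.1.headD .nil :: p.2))^[l.length] (l, l')).2 =
        l.reverse ++ l' := by
    intro l
    induction l with
    | nil => intro l'; rfl
    | cons x l ih =>
      intro l'
      rw [List.length_cons, Function.iterate_succ_apply]
      exact (ih (x :: l')).trans (by simp)
  have := key (L a) []
  rw [List.append_nil, hlen] at this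
  exact congrArg Data.ofList this

open Classical in
lemma CompS.filter {P : ∀ a, Fin (n a) → Prop}
    (h : CompP (α := Σ a, Fin (n a)) (fun x => n x.1) (fun x => Data.ofNat x.2 :: env x.1)
      fun x => P x.1 x.2) :
    CompS n env fun a => Finset.univ.filter (P a) := by
  have h1 := Comp.fold (n := n) (env := env) (β := fun _ => List Data) (fun _ l => Data.ofList l)
    (init := fun _ => []) (F := fun a i l => Data.ofProp (P a i) :: l) Comp.nil
    (((h.comap fun x : Σ a, Fin (n a) × List Data => ⟨x.1, x.2.1⟩).wkOne _).cons
      (Comp.var 1 fun _ => rfl))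
  have key : ∀ a (l : List (Fin (n a))) (l' : List Data),
      l.foldl (fun l i => Data.ofProp (P a i) :: l) l' =
        (l.map fun i => Data.ofProp (P a i)).reverse ++ l' := by
    intro a l
    induction l with
    | nil => intro b; rfl
    | cons i l ih => intro b; rw [List.foldl_cons, ih]; simp
  refine (Comp.reverse h1 fun a => ?_).congr fun a => ?_
  · rw [key]; simp
  · rw [key, Data.ofSet, List.ofFn_eq_map]; simp

open Classical in
lemma CompN.card {s : ∀ a, Finset (Fin (n a))} (hs : CompS n env s) :
    CompN n env fun a => (s a).card := by
  have v : CompN (α := Σ a, Fin (n a) × ℕ) (fun x => n x.1)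
      (fun x => Data.ofNat x.2.1 :: Data.ofNat x.2.2 :: env x.1) fun x => x.2.2 :=
    Comp.var 1 fun _ => rfl
  have h1 := Comp.fold (n := n) (env := env) (β := fun _ => ℕ) (fun _ m => Data.ofNat m)
    (init := fun _ => 0) (F := fun a i m => if i ∈ s a then m + 1 else m) Comp.nil
    ((Comp.ite (CompP.mem (v := fun x : Σ a, Fin (n a) × ℕ => x.2.1) (Comp.var 0 fun _ => rfl)
      (((hs.comap (Sigma.fst (β := fun a => Fin (n a) × ℕ))).wk _).wk _)) v.succ v).congr
      fun x => by split_ifs <;> rfl)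
  refine h1.congr fun a => congrArg _ ?_
  have key : ∀ (l : List (Fin (n a))) (m : ℕ),
      l.foldl (fun m i => if i ∈ s a then m + 1 else m) m = (l.filter (· ∈ s a)).length + m := by
    intro l
    induction l with
    | nil => simp
    | cons i l ih =>
      intro m
      rw [List.foldl_cons, ih, List.filter_cons]
      by_cases h : i ∈ s a
      · simp only [h, decide_true, if_true, List.length_cons]; omega
      · simp [h]
  rw [key, Nat.add_zero, ← List.toFinset_card_of_nodup]
  · congr 1; ext i; simp
  · exact (List.nodup_finRange _).filter _

/-- Weakening by a set. -/
lemma Comp.wkS {f : α → Data} (h : Comp n env f) :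
    Comp (α := Σ a, Finset (Fin (n a))) (fun x => n x.1) (fun x => Data.ofSet x.2 :: env x.1)
      fun x => f x.1 :=
  (h.comap Sigma.fst).wk _

lemma CompS.zero : CompS (α := Σ a, Finset (Fin (n a))) (fun x => n x.1)
    (fun x => Data.ofSet x.2 :: env x.1) fun x => x.2 :=
  Comp.var 0 fun _ => rfl

/-- Weakening by a vertex and a set. -/
lemma Comp.wkVS {f : α → Data} (h : Comp n env f) :
    Comp (α := Σ a, Fin (n a) × Finset (Fin (n a))) (fun x => n x.1)
      (fun x => Data.ofNat x.2.1 :: Data.ofSet x.2.2 :: env x.1) fun x => f x.1 :=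
  ((h.comap Sigma.fst).wk _).wk _

end

/-! ### Reachability and acyclicity -/

lemma reachable_induction {V : Type*} {K : SimpleGraph V} {a b : V} (h : K.Reachable a b)
    {P : V → Prop} (ha : P a) (hs : ∀ x y, P x → K.Adj x y → P y) : P b := by
  obtain ⟨w⟩ := h
  induction w with
  | nil => exact ha
  | cons e _ ih => exact ih (hs _ _ ha e)

/-- A walk that meets `v` is cut before its first and after its last visit to `v`. -/
lemma reachable_delete_vertex {V : Type*} {K K' : SimpleGraph V} {a b v : V}
    (hK : ∀ x y, K.Adj x y → x ≠ v → y ≠ v → K'.Adj x y) (h : K.Reachable a b) (ha : a ≠ v)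
    (hb : b ≠ v) : K'.Reachable a b ∨
      ∃ g h, K.Adj g v ∧ K.Adj v h ∧ K'.Reachable a g ∧ K'.Reachable h b := by
  have := reachable_induction h (P := fun x => (x ≠ v ∧ (K'.Reachable a x ∨
      ∃ g h, K.Adj g v ∧ K.Adj v h ∧ K'.Reachable a g ∧ K'.Reachable h x)) ∨
      (x = v ∧ ∃ g, K.Adj g v ∧ K'.Reachable a g)) (Or.inl ⟨ha, Or.inl .rfl⟩) ?_
  · rcases this with h | h
    · exact h.2
    · exact absurd h.1 hb
  · rintro x y (⟨hx, h⟩ | ⟨rfl, g, hg, hr⟩) e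
    · by_cases hy : y = v
      · subst hy
        rcases h with h | ⟨g, h, hg, hh, h1, h2⟩
        · exact Or.inr ⟨rfl, x, e, h⟩
        · exact Or.inr ⟨rfl, g, hg, h1⟩
      · rcases h with h | ⟨g, h, hg, hh, h1, h2⟩
        · exact Or.inl ⟨hy, Or.inl (h.trans (hK _ _ e hx hy).reachable)⟩
        · exact Or.inl ⟨hy, Or.inr ⟨g, h, hg, hh, h1, h2.trans (hK _ _ e hx hy).reachable⟩⟩
    · exact Or.inl ⟨e.ne', Or.inr ⟨g, y, hg, e, hr, .rfl⟩⟩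

/-- The graph on all vertices with the edges of `G` inside `W`. -/
def gr {V : Type*} (G : SimpleGraph V) (W : Finset V) : SimpleGraph V where
  Adj a b := G.Adj a b ∧ a ∈ W ∧ b ∈ W
  symm := ⟨fun _ _ h => ⟨h.1.symm, h.2.2, h.2.1⟩⟩
  loopless := ⟨fun _ h => h.1.ne rfl⟩

/-- `W` induces a forest. -/
def Forest {V : Type*} (G : SimpleGraph V) (W : Finset V) : Prop := (gr G W).IsAcyclic

/-- `a` and `b` are connected inside `W`. -/
def Conn {V : Type*} (G : SimpleGraph V) (W : Finset V) (a b : V) : Prop :=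
  a ∈ W ∧ (gr G W).Reachable a b

section
variable {V : Type*} {G : SimpleGraph V} {W W' : Finset V} {a b c v : V}

lemma gr_mono (h : W ⊆ W') : gr G W ≤ gr G W' := fun _ _ e => ⟨e.1, h e.2.1, h e.2.2⟩

lemma Forest.anti (h : W ⊆ W') (hW : Forest G W') : Forest G W :=
  SimpleGraph.IsAcyclic.anti (gr_mono h) hW

lemma Conn.refl (h : a ∈ W) : Conn G W a a := ⟨h, .rfl⟩

lemma Conn.mem (h : Conn G W a b) : a ∈ W ∧ b ∈ W :=
  ⟨h.1, reachable_induction h.2 h.1 fun _ _ _ e => e.2.2⟩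

lemma Conn.symm (h : Conn G W a b) : Conn G W b a := ⟨h.mem.2, h.2.symm⟩

lemma Conn.trans (h : Conn G W a b) (h' : Conn G W b c) : Conn G W a c := ⟨h.1, h.2.trans h'.2⟩

lemma Conn.mono (hW : W ⊆ W') (h : Conn G W a b) : Conn G W' a b :=
  ⟨hW h.1, h.2.mono (gr_mono hW)⟩

lemma Conn.adj (e : G.Adj a b) (ha : a ∈ W) (hb : b ∈ W) : Conn G W a b :=
  ⟨ha, SimpleGraph.Adj.reachable (G := gr G W) ⟨e, ha, hb⟩⟩

lemma Conn.induction (h : Conn G W a b) {P : V → Prop} (ha : P a)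
    (hs : ∀ x y, P x → x ∈ W → y ∈ W → G.Adj x y → P y) : P b :=
  reachable_induction h.2 ha fun x y hx e => hs x y hx e.2.1 e.2.2 e.1

/-- A connection whose vertices stay in `X` is a connection in `X`. -/
lemma Conn.of_closed {X : Finset V} (h : Conn G W a b) (ha : a ∈ X)
    (hs : ∀ x y, x ∈ X → x ∈ W → y ∈ W → G.Adj x y → y ∈ X) : Conn G X a b :=
  h.induction (P := fun x => Conn G X a x) (.refl ha) fun x y hx hxW hyW e =>
    hx.trans (.adj e hx.mem.2 (hs x y hx.mem.2 hxW hyW e))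

lemma forest_empty : Forest G ∅ := by
  have : gr G ∅ = ⊥ := by ext a b; simp [gr]
  rw [Forest, this]
  exact SimpleGraph.isAcyclic_bot

variable [DecidableEq V]

lemma Conn.insert_cases (h : Conn G (insert v W) a b) (ha : a ∈ W) (hb : b ∈ W) (hv : v ∉ W) :
    Conn G W a b ∨ ∃ g h, G.Adj v g ∧ G.Adj v h ∧ Conn G W a g ∧ Conn G W h b := by
  have hn : ∀ {x}, x ∈ W → x ≠ v := fun hx e => hv (e ▸ hx)
  rcases reachable_delete_vertex (K := gr G (insert v W)) (K' := gr G W) (v := v)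
    (fun x y e hx hy => ⟨e.1, (Finset.mem_insert.1 e.2.1).resolve_left hx, (Finset.mem_insert.1 e.2.2).resolve_left hy⟩)
    h.2 (hn ha) (hn hb) with h | ⟨g, h, eg, eh, h1, h2⟩
  · exact Or.inl ⟨ha, h⟩
  · have h3 : Conn G W b h := ⟨hb, h2.symm⟩
    exact Or.inr ⟨g, h, eg.1.symm, eh.1, ⟨ha, h1⟩, h3.symm⟩

lemma Conn.exists_adj (h : Conn G (insert v W) v b) (hb : b ∈ W) (hv : v ∉ W) :
    ∃ g, G.Adj v g ∧ Conn G W g b := by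
  have hn : b ≠ v := fun e => hv (e ▸ hb)
  obtain ⟨w⟩ := h.2
  cases w with
  | nil => exact absurd rfl hn
  | @cons _ x _ e w =>
    have hx : x ∈ W := (Finset.mem_insert.1 e.2.2).resolve_left e.1.ne'
    have hc : Conn G (insert v W) x b := ⟨e.2.2, ⟨w⟩⟩
    rcases hc.insert_cases hx hb hv with h | ⟨g, h, h1, h2, h3, h4⟩
    · exact ⟨x, e.1, h⟩
    · exact ⟨h, h2, h4⟩

/-- A cycle through `v` leaves it by two neighbours that are connected without `v`. Acyclicity is
used in the form that every edge is a bridge. -/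
theorem forest_insert_iff (hv : v ∉ W) : Forest G (insert v W) ↔ Forest G W ∧
    ∀ g h, G.Adj v g → G.Adj v h → g ≠ h → ¬Conn G W g h := by
  constructor
  · refine fun H => ⟨H.anti (Finset.subset_insert _ _), fun g h eg eh hne hc => ?_⟩
    have hadj : (gr G (insert v W)).Adj v g :=
      ⟨eg, Finset.mem_insert_self _ _, Finset.mem_insert_of_mem hc.1⟩
    have hbr := SimpleGraph.isAcyclic_iff_forall_isBridge.1 H ((gr G (insert v W)).mem_edgeSet.2 hadj)
    rw [SimpleGraph.isBridge_iff] at hbr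
    apply hbr
    have h1 : ((gr G (insert v W)).deleteEdges {s(v, g)}).Adj v h := by
      rw [SimpleGraph.deleteEdges_adj]
      refine ⟨⟨eh, Finset.mem_insert_self _ _, Finset.mem_insert_of_mem hc.mem.2⟩, ?_⟩
      simp only [Set.mem_singleton_iff, Sym2.eq_iff, not_or, not_and]
      exact ⟨fun _ => hne.symm, fun e => absurd e eg.ne⟩
    refine h1.reachable.trans (hc.symm.2.mono fun x y e => ?_)
    rw [SimpleGraph.deleteEdges_adj]
    refine ⟨gr_mono (Finset.subset_insert _ _) e, ?_⟩
    have hx : x ≠ v := fun h => hv (h ▸ e.2.1)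
    have hy : y ≠ v := fun h => hv (h ▸ e.2.2)
    simp only [Set.mem_singleton_iff, Sym2.eq_iff]
    tauto
  · rintro ⟨hF, hn⟩
    refine SimpleGraph.isAcyclic_iff_forall_isBridge.2 fun e => ?_
    induction e with | _ a b => ?_
    intro hab
    rw [SimpleGraph.mem_edgeSet] at hab
    rw [SimpleGraph.isBridge_iff]
    intro hr
    have hvW : ∀ {x}, x ∈ W → x ≠ v := fun hx e => hv (e ▸ hx)
    have main : ∀ b, (gr G (insert v W)).Adj v b →
        ¬((gr G (insert v W)).deleteEdges {s(v, b)}).Reachable v b := by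
      rintro b hvb ⟨w⟩
      cases w with
      | nil => exact hvb.1.ne rfl
      | @cons _ x _ e w =>
        rw [SimpleGraph.deleteEdges_adj] at e
        have hxb : x ≠ b := fun h => e.2 (by rw [h]; rfl)
        have hxW : x ∈ W := (Finset.mem_insert.1 e.1.2.2).resolve_left e.1.1.ne'
        have hbW : b ∈ W := (Finset.mem_insert.1 hvb.2.2).resolve_left hvb.1.ne'
        rcases reachable_delete_vertex (K := (gr G (insert v W)).deleteEdges {s(v, b)})
          (K' := gr G W) (v := v) (fun x y e hx hy =>
          ⟨e.1.1, (Finset.mem_insert.1 e.1.2.1).resolve_left hx,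
            (Finset.mem_insert.1 e.1.2.2).resolve_left hy⟩) ⟨w⟩ (hvW hxW) (hvW hbW) with
          h | ⟨g, h, eg, eh, h1, h2⟩
        · exact hn x b e.1.1 hvb.1 hxb ⟨hxW, h⟩
        · rw [SimpleGraph.deleteEdges_adj] at eh
          have hhb : h ≠ b := fun h' => eh.2 (by rw [h']; rfl)
          have hhW : h ∈ W := (Finset.mem_insert.1 eh.1.2.2).resolve_left eh.1.1.ne'
          exact hn h b eh.1.1 hvb.1 hhb ⟨hhW, h2⟩
    by_cases ha : a = v
    · subst ha; exact main b hab hr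
    by_cases hb : b = v
    · subst hb
      rw [Sym2.eq_swap] at hr
      exact main a hab.symm hr.symm
    have haW : a ∈ W := (Finset.mem_insert.1 hab.2.1).resolve_left ha
    have hbW : b ∈ W := (Finset.mem_insert.1 hab.2.2).resolve_left hb
    have hbr := SimpleGraph.isAcyclic_iff_forall_isBridge.1 hF
      ((gr G W).mem_edgeSet.2 (show (gr G W).Adj a b from ⟨hab.1, haW, hbW⟩))
    rw [SimpleGraph.isBridge_iff] at hbr
    have hle : (gr G W).deleteEdges {s(a, b)} ≤ gr G W := SimpleGraph.deleteEdges_le _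
    rcases reachable_delete_vertex (K' := (gr G W).deleteEdges {s(a, b)}) (v := v)
      (fun x y e hx hy => by
        rw [SimpleGraph.deleteEdges_adj] at e ⊢
        exact ⟨⟨e.1.1, (Finset.mem_insert.1 e.1.2.1).resolve_left hx,
            (Finset.mem_insert.1 e.1.2.2).resolve_left hy⟩, e.2⟩) hr ha hb with
      h | ⟨g, h, eg, eh, h1, h2⟩
    · exact hbr h
    · rw [SimpleGraph.deleteEdges_adj] at eg eh
      by_cases hgh : g = h
      · exact hbr (h1.trans (hgh ▸ h2))
      -- The edge `ab` is bypassed through `v`, entered from `g` and left to `h`. Then `g` and `h`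
      -- are connected in `W` by way of `ab`.
      · have hgW : g ∈ W := (Finset.mem_insert.1 eg.1.2.1).resolve_left eg.1.1.ne
        refine hn g h eg.1.1.symm eh.1.1 hgh ⟨hgW, ?_⟩
        exact (h1.mono hle).symm.trans ((SimpleGraph.Adj.reachable
          (G := gr G W) ⟨hab.1, haW, hbW⟩).trans (h2.mono hle).symm)

/-- Trades the induced graph on a subtype for a graph on all of `V`, so that the vertex set can vary
without change of type. -/
lemma isFVS_iff [Fintype V] {S : Finset V} : IsFVS G S ↔ Forest G Sᶜ := by
  constructor
  · intro h
    refine SimpleGraph.isAcyclic_iff_forall_isBridge.2 fun e => ?_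
    induction e with | _ a b => ?_
    intro hab
    rw [SimpleGraph.mem_edgeSet] at hab
    rw [SimpleGraph.isBridge_iff]
    intro hr
    have hm : ∀ {x}, x ∈ Sᶜ → x ∈ {v | v ∉ S} := fun hx => by simpa using hx
    have hadj : (G.induce {v | v ∉ S}).Adj ⟨a, hm hab.2.1⟩ ⟨b, hm hab.2.2⟩ := hab.1
    have hbr := SimpleGraph.isAcyclic_iff_forall_isBridge.1 h
      ((G.induce {v | v ∉ S}).mem_edgeSet.2 hadj)
    rw [SimpleGraph.isBridge_iff] at hbr
    have := reachable_induction hr (P := fun x => ∃ hx : x ∈ {v | v ∉ S},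
      ((G.induce {v | v ∉ S}).deleteEdges {s(⟨a, hm hab.2.1⟩, ⟨b, hm hab.2.2⟩)}).Reachable
        ⟨a, hm hab.2.1⟩ ⟨x, hx⟩) ⟨hm hab.2.1, .rfl⟩ (by
        rintro x y ⟨hx, h⟩ e
        rw [SimpleGraph.deleteEdges_adj] at e
        refine ⟨hm e.1.2.2, h.trans (SimpleGraph.Adj.reachable ?_)⟩
        rw [SimpleGraph.deleteEdges_adj]
        refine ⟨e.1.1, fun h' => e.2 ?_⟩
        simpa [Sym2.eq_iff] using h')
    exact hbr this.2
  · intro h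
    refine SimpleGraph.IsAcyclic.comap (G' := gr G Sᶜ) ⟨Subtype.val, ?_⟩ Subtype.val_injective h
    intro a b e
    exact ⟨e, Finset.mem_compl.2 a.2, Finset.mem_compl.2 b.2⟩

/-- `H` is a maximal induced forest. -/
def MaxForest [Fintype V] (G : SimpleGraph V) (H : Finset V) : Prop :=
  Forest G H ∧ ∀ v ∉ H, ¬Forest G (insert v H)

lemma isMinimalFVS_iff [Fintype V] {S : Finset V} : IsMinimalFVS G S ↔ MaxForest G Sᶜ := by
  rw [IsMinimalFVS, MaxForest, isFVS_iff]
  refine and_congr_right fun _ => ⟨fun h v hv hF => ?_, fun h T hT hF => ?_⟩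
  · have hv : v ∈ S := by simpa using hv
    refine h (S.erase v) (Finset.erase_ssubset hv) ?_
    rwa [isFVS_iff, Finset.compl_erase]
  · obtain ⟨v, hv, hvT⟩ := Finset.exists_of_ssubset hT
    refine h v (by simpa using hv) (Forest.anti ?_ (isFVS_iff.1 hF))
    intro x hx
    rcases Finset.mem_insert.1 hx with rfl | hx
    · simpa using hvT
    · simp only [Finset.mem_compl] at hx ⊢
      exact fun h => hx (hT.1 h)

/-! ### Greedy extension -/

open Classical in
/-- Extension of `F` by the vertices of `X`, taken in the order of `l`, as long as the result is a
forest. -/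
noncomputable def greedy (G : SimpleGraph V) (l : List V) (F X : Finset V) : Finset V :=
  l.foldl (fun H v => if v ∈ X ∧ Forest G (insert v H) then insert v H else H) F

lemma subset_greedy (l : List V) (X : Finset V) : ∀ F : Finset V, F ⊆ greedy G l F X := by
  induction l with
  | nil => exact fun F => subset_rfl
  | cons v l ih =>
    intro F
    refine subset_trans ?_ (ih _)
    dsimp only
    split_ifs
    · exact Finset.subset_insert _ _
    · exact subset_rfl

lemma greedy_subset (l : List V) (X : Finset V) : ∀ F : Finset V, greedy G l F X ⊆ F ∪ X := by
  induction l with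
  | nil => exact fun F => Finset.subset_union_left
  | cons v l ih =>
    intro F
    refine (ih _).trans ?_
    dsimp only
    split_ifs with h
    · intro x; simp only [Finset.mem_union, Finset.mem_insert]; rintro ((rfl | h') | h') <;> tauto
    · exact subset_rfl

lemma forest_greedy (l : List V) (X : Finset V) : ∀ F : Finset V, Forest G F →
    Forest G (greedy G l F X) := by
  induction l with
  | nil => exact fun F h => h
  | cons v l ih =>
    intro F hF
    refine ih _ ?_
    dsimp only
    split_ifs with h
    · exact h.2
    · exact hF

open Classical in
-- A vertex rejected once stays rejected, since a superset of a set that is not a forest is not a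
-- forest.
lemma greedy_maximal (l : List V) (X : Finset V) : ∀ (F : Finset V) (v : V), v ∈ l → v ∈ X →
    v ∉ greedy G l F X → ¬Forest G (insert v (greedy G l F X)) := by
  induction l with
  | nil => simp
  | cons u l ih =>
    intro F v hv hX hn
    rcases List.mem_cons.1 hv with rfl | hv
    · have hsub := subset_greedy (G := G) l X
        (if v ∈ X ∧ Forest G (insert v F) then insert v F else F)
      change v ∉ greedy G l (if v ∈ X ∧ Forest G (insert v F) then insert v F else F) X at hn
      change ¬Forest G (insert v (greedy G l (if v ∈ X ∧ Forest G (insert v F) then insert v F else F) X))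
      split_ifs at hn hsub ⊢ with h
      · exact absurd (hsub (Finset.mem_insert_self _ _)) hn
      · exact fun hF => h ⟨hX, hF.anti (Finset.insert_subset_insert _ hsub)⟩
    · exact ih _ v hv hX hn

end

open Finset
set_option linter.unusedSectionVars false

/-! ### Counting edges -/

section
variable {V : Type*} {G : SimpleGraph V}

open Classical in
/-- The number of pairs of adjacent vertices `x ∈ X`, `y ∈ Y`. -/
noncomputable def eC (G : SimpleGraph V) (X Y : Finset V) : ℕ :=
  ∑ x ∈ X, ∑ y ∈ Y, if G.Adj x y then 1 else 0

open Classical in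
lemma eC_comm (X Y : Finset V) : eC G X Y = eC G Y X := by
  rw [eC, sum_comm]
  exact sum_congr rfl fun _ _ => sum_congr rfl fun _ _ => if_congr (G.adj_comm _ _) rfl rfl

lemma eC_mono {X X' Y Y' : Finset V} (hX : X ⊆ X') (hY : Y ⊆ Y') : eC G X Y ≤ eC G X' Y' :=
  (sum_le_sum fun _ _ => sum_le_sum_of_subset hY).trans (sum_le_sum_of_subset hX)

open Classical in
lemma eC_eq_card (X Y : Finset V) :
    eC G X Y = #{z ∈ X ×ˢ Y | G.Adj z.1 z.2} := by
  rw [card_filter, sum_product]; rfl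

lemma eC_pos {X Y : Finset V} : 0 < eC G X Y ↔ ∃ x ∈ X, ∃ y ∈ Y, G.Adj x y := by
  rw [eC_eq_card, card_pos]
  simp only [Finset.Nonempty, mem_filter, mem_product, Prod.exists]
  grind

lemma eC_ge_two {X Y : Finset V} : 2 ≤ eC G X Y ↔ ∃ x y x' y', (x ∈ X ∧ y ∈ Y ∧ G.Adj x y) ∧
    (x' ∈ X ∧ y' ∈ Y ∧ G.Adj x' y') ∧ ¬(x = x' ∧ y = y') := by
  rw [eC_eq_card, show ∀ m, 2 ≤ m ↔ 1 < m from fun _ => Iff.rfl, one_lt_card]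
  simp only [mem_filter, mem_product, Prod.exists, ne_eq, Prod.mk.injEq]
  grind

lemma eC_ge_three {X Y : Finset V} : 3 ≤ eC G X Y ↔ ∃ x y x' y' x'' y'',
    (x ∈ X ∧ y ∈ Y ∧ G.Adj x y) ∧ (x' ∈ X ∧ y' ∈ Y ∧ G.Adj x' y') ∧
    (x'' ∈ X ∧ y'' ∈ Y ∧ G.Adj x'' y'') ∧ ¬(x = x' ∧ y = y') ∧ ¬(x = x'' ∧ y = y'') ∧
    ¬(x' = x'' ∧ y' = y'') := by
  rw [eC_eq_card, show ∀ m, 3 ≤ m ↔ 2 < m from fun _ => Iff.rfl, two_lt_card]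
  simp only [mem_filter, mem_product, Prod.exists, ne_eq, Prod.mk.injEq]
  grind

variable [DecidableEq V]

lemma eC_union_left {X X' : Finset V} (h : Disjoint X X') (Y : Finset V) :
    eC G (X ∪ X') Y = eC G X Y + eC G X' Y := sum_union h

lemma eC_union_right {Y Y' : Finset V} (X : Finset V) (h : Disjoint Y Y') :
    eC G X (Y ∪ Y') = eC G X Y + eC G X Y' := by
  rw [eC_comm, eC_union_left h, eC_comm, eC_comm Y']

lemma eC_union_self {X Y : Finset V} (h : Disjoint X Y) :
    eC G (X ∪ Y) (X ∪ Y) = eC G X X + eC G Y Y + 2 * eC G X Y := by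
  rw [eC_union_left h, eC_union_right _ h, eC_union_right _ h, eC_comm Y X]
  ring

lemma eC_biUnion_left {ι : Type*} {s : Finset ι} {f : ι → Finset V}
    (h : (s : Set ι).PairwiseDisjoint f) (Y : Finset V) :
    eC G (s.biUnion f) Y = ∑ i ∈ s, eC G (f i) Y := sum_biUnion h

open Classical in
lemma eC_singleton_left (v : V) (Y : Finset V) : eC G {v} Y = #{y ∈ Y | G.Adj v y} := by
  rw [eC, sum_singleton, card_filter]

lemma eC_self_singleton (v : V) : eC G {v} {v} = 0 := by simp [eC]

lemma eC_self_eq (W : Finset V) [Fintype (G.induce (W : Set V)).edgeSet] :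
    eC G W W = 2 * #(G.induce (W : Set V)).edgeFinset := by
  classical
  have := SimpleGraph.sum_degrees_eq_twice_card_edges (G.induce (W : Set V))
  rw [show 2 * #(G.induce (W : Set V)).edgeFinset = _ by convert this.symm, eC, ← Finset.sum_coe_sort W]
  refine Finset.sum_congr rfl fun v _ => ?_
  rw [← SimpleGraph.card_neighborFinset_eq_degree, SimpleGraph.neighborFinset_eq_filter,
    card_filter, ← Finset.sum_coe_sort W]
  rfl

lemma induce_isAcyclic {W : Finset V} (h : Forest G W) : (G.induce (W : Set V)).IsAcyclic :=
  SimpleGraph.IsAcyclic.comap (G' := gr G W) ⟨Subtype.val, fun {a b} e => ⟨e, a.2, b.2⟩⟩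
    Subtype.val_injective h

/-- Extend the forest to a spanning tree of the complete graph on `W`. As `eC G W W` counts ordered
pairs, hence each edge twice, the constants are doubled here and in the later counts. -/
lemma Forest.eC_add_two_le {W : Finset V} (h : Forest G W) (hW : W.Nonempty) :
    eC G W W + 2 ≤ 2 * #W := by
  classical
  have : Nonempty (W : Set V) := hW.to_subtype
  obtain ⟨T, hT, -, hle⟩ := (SimpleGraph.connected_top (V := (W : Set V))).exists_isTree_le_of_le_of_isAcyclic
    le_top (induce_isAcyclic h)
  have h1 := hle.card_edgeFinset
  have h2 : #(G.induce (W : Set V)).edgeFinset ≤ #T.edgeFinset :=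
    card_le_card (SimpleGraph.edgeFinset_mono hT)
  have h3 := eC_self_eq (G := G) W
  have h4 : Fintype.card (W : Set V) = #W := by simp
  omega

lemma Forest.eC_le {W : Finset V} (h : Forest G W) : eC G W W ≤ 2 * #W := by
  rcases W.eq_empty_or_nonempty with rfl | hW
  · simp [eC]
  · exact Nat.le_of_add_right_le (h.eC_add_two_le hW)

/-- `X` is nonempty and connected. -/
def ConnSet (G : SimpleGraph V) (X : Finset V) : Prop :=
  X.Nonempty ∧ ∀ x ∈ X, ∀ y ∈ X, Conn G X x y

lemma ConnSet.le_eC {X : Finset V} (h : ConnSet G X) : 2 * #X ≤ eC G X X + 2 := by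
  classical
  have : Nonempty (X : Set V) := h.1.to_subtype
  have hc : (G.induce (X : Set V)).Connected := by
    refine ⟨fun x y => ?_⟩
    have := (h.2 x x.2 y y.2).induction (P := fun z => ∃ hz : z ∈ (X : Set V),
      (G.induce (X : Set V)).Reachable x ⟨z, hz⟩) ⟨x.2, .rfl⟩ (by
        rintro a b ⟨ha, hr⟩ _ hb e
        exact ⟨hb, hr.trans (SimpleGraph.Adj.reachable (by exact e))⟩)
    exact this.2
  have h1 := hc.card_vert_le_card_edgeSet_add_one
  rw [Nat.card_eq_fintype_card, Nat.card_eq_fintype_card, ← SimpleGraph.edgeFinset_card] at h1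
  have h3 := eC_self_eq (G := G) X
  have h4 : Fintype.card (X : Set V) = #X := by simp
  omega

lemma Forest.exists_leaf {W : Finset V} (h : Forest G W) (hW : W.Nonempty) :
    ∃ v ∈ W, eC G {v} W ≤ 1 := by
  by_contra! hc
  have h1 := h.eC_add_two_le hW
  have : ∑ v ∈ W, 2 ≤ eC G W W :=
    sum_le_sum fun v hv => by simpa [eC] using Nat.succ_le_of_lt (hc v hv)
  rw [sum_const, smul_eq_mul] at this
  omega

/-! ### Testing acyclicity by peeling -/

open Classical in
/-- Removal of the vertices of degree at most one. -/
noncomputable def peel (G : SimpleGraph V) (W : Finset V) : Finset V :=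
  {v ∈ W | 2 ≤ eC G {v} W}

lemma peel_subset (W : Finset V) : peel G W ⊆ W := filter_subset _ _

/-- A removed vertex has at most one neighbour in `W`, so the removed vertices can be put back one
at a time without closing a cycle. -/
lemma Forest.of_peel {W : Finset V} (h : Forest G (peel G W)) : Forest G W := by
  classical
  have key : ∀ X ⊆ W \ peel G W, Forest G (peel G W ∪ X) := by
    intro X
    induction X using Finset.induction_on with
    | empty => simpa using h
    | insert v X hv ih =>
      intro hX
      have hvW := hX (mem_insert_self _ _)
      rw [mem_sdiff] at hvW
      have hX' := (subset_insert v X).trans hX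
      rw [union_insert, forest_insert_iff (by simp [hvW.2, hv])]
      refine ⟨ih hX', fun g g' hg hg' hne hc => hvW.2 ?_⟩
      have hsub : peel G W ∪ X ⊆ W := union_subset (peel_subset _) (hX'.trans sdiff_subset)
      rw [peel, mem_filter, eC_singleton_left]
      refine ⟨hvW.1, ?_⟩
      rw [← card_pair hne]
      refine card_le_card fun x hx => ?_
      rw [mem_insert, mem_singleton] at hx
      rcases hx with rfl | rfl
      · exact mem_filter.2 ⟨hsub hc.mem.1, hg⟩
      · exact mem_filter.2 ⟨hsub hc.mem.2, hg'⟩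
  have := key _ subset_rfl
  rwa [union_sdiff_of_subset (peel_subset W)] at this

/-- A nonempty forest has a vertex of degree at most one, so each round removes something. This
turns acyclicity into a loop over the clock. -/
lemma forest_iff_iterate_peel {W : Finset V} {N : ℕ} (hN : #W ≤ N) :
    Forest G W ↔ (peel G)^[N] W = ∅ := by
  constructor
  · intro h
    induction N generalizing W with
    | zero => exact card_eq_zero.1 (by simpa using hN)
    | succ N ih =>
      rw [Function.iterate_succ_apply]
      refine ih ?_ (h.anti (peel_subset W))
      rcases W.eq_empty_or_nonempty with rfl | hW
      · simp [peel]
      · obtain ⟨v, hv, hl⟩ := h.exists_leaf hW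
        have : peel G W ⊂ W := (ssubset_iff_of_subset (peel_subset W)).2 ⟨v, hv, fun hv' => by
          have := (mem_filter.1 hv').2; omega⟩
        have := card_lt_card this
        omega
  · intro h
    have key : ∀ (N : ℕ) (W : Finset V), Forest G ((peel G)^[N] W) → Forest G W := by
      intro N
      induction N with
      | zero => exact fun W h => h
      | succ N ih => exact fun W h => (ih _ h).of_peel
    exact key N W (h ▸ forest_empty)

/-! ### Components -/

open Classical in
/-- The component of `p` in `X` (empty if `p ∉ X`). -/
noncomputable def comp (G : SimpleGraph V) (X : Finset V) (p : V) : Finset V :=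
  {v ∈ X | Conn G X p v}

open Classical in
lemma mem_comp {X : Finset V} {p v : V} : v ∈ comp G X p ↔ Conn G X p v := by
  rw [comp, mem_filter]
  exact ⟨fun h => h.2, fun h => ⟨h.mem.2, h⟩⟩

open Classical in
lemma comp_subset (X : Finset V) (p : V) : comp G X p ⊆ X := filter_subset _ _

lemma self_mem_comp {X : Finset V} {p : V} (h : p ∈ X) : p ∈ comp G X p := mem_comp.2 (.refl h)

lemma comp_eq_of_conn {X : Finset V} {p q : V} (h : Conn G X p q) : comp G X p = comp G X q := by
  ext v
  rw [mem_comp, mem_comp]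
  exact ⟨h.symm.trans, h.trans⟩

lemma comp_adj_closed {X : Finset V} {p x y : V} (hx : x ∈ comp G X p) (hy : y ∈ X)
    (e : G.Adj x y) : y ∈ comp G X p :=
  mem_comp.2 ((mem_comp.1 hx).trans (.adj e (comp_subset _ _ hx) hy))

lemma comp_disjoint {X : Finset V} {p q : V} (h : ¬Conn G X p q) :
    Disjoint (comp G X p) (comp G X q) :=
  disjoint_left.2 fun _ hx hy => h ((mem_comp.1 hx).trans (mem_comp.1 hy).symm)

lemma Conn.comp {X : Finset V} {p x : V} (h : Conn G X p x) : Conn G (comp G X p) p x :=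
  h.of_closed (self_mem_comp h.1) fun _ _ hx _ hy e => comp_adj_closed hx hy e

lemma connSet_comp {X : Finset V} {p : V} (h : p ∈ X) : ConnSet G (comp G X p) :=
  ⟨⟨p, self_mem_comp h⟩, fun _ hx _ hy => (mem_comp.1 hx).comp.symm.trans (mem_comp.1 hy).comp⟩

open Classical in
/-- One round of breadth-first search. -/
noncomputable def expand (G : SimpleGraph V) (X s : Finset V) : Finset V :=
  {v ∈ X | v ∈ s ∨ ∃ u ∈ s, G.Adj u v}

/-- Before a fixed point is reached every round adds an element, and `X` has room for at most `N` of
them. -/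
lemma iterate_stable {T : Finset V → Finset V} {s X : Finset V} (hT : ∀ t ⊆ X, t ⊆ T t)
    (hX : ∀ t ⊆ X, T t ⊆ X) (hs : s ⊆ X) {N : ℕ} (hN : #X ≤ N) : T (T^[N] s) = T^[N] s := by
  have hsub : ∀ j, T^[j] s ⊆ X := fun j => by
    induction j with
    | zero => exact hs
    | succ j ih => rw [Function.iterate_succ_apply']; exact hX _ ih
  have key : ∀ j, T (T^[j] s) = T^[j] s ∨ j + 1 ≤ #(T^[j + 1] s) := by
    intro j
    induction j with
    | zero =>
      by_cases h : T s = s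
      · exact Or.inl h
      · right
        have := card_lt_card ((hT s hs).ssubset_of_ne (Ne.symm h))
        simp only [Function.iterate_succ, Function.iterate_zero, Function.comp, id]
        omega
    | succ j ih =>
      by_cases h : T (T^[j + 1] s) = T^[j + 1] s
      · exact Or.inl h
      · right
        rcases ih with h' | h'
        · rw [Function.iterate_succ_apply', h', h'] at h
          exact absurd rfl h
        · have := card_lt_card ((hT _ (hsub (j + 1))).ssubset_of_ne (Ne.symm h))
          rw [Function.iterate_succ_apply']
          omega
  rcases key N with h | h
  · exact h
  · have := card_le_card (hsub (N + 1))
    omega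

open Classical in
lemma comp_eq_iterate {X : Finset V} {p : V} (hp : p ∈ X) {N : ℕ} (hN : #X ≤ N) :
    comp G X p = (expand G X)^[N] {p} := by
  have hsub : ∀ t ⊆ X, t ⊆ expand G X t := fun t ht x hx => mem_filter.2 ⟨ht hx, Or.inl hx⟩
  have hst := iterate_stable (T := expand G X) (s := {p}) hsub (fun t _ => filter_subset _ _)
    (singleton_subset_iff.2 hp) hN
  have hle : ∀ j, (expand G X)^[j] {p} ⊆ comp G X p := fun j => by
    induction j with
    | zero => exact singleton_subset_iff.2 (self_mem_comp hp)
    | succ j ih =>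
      rw [Function.iterate_succ_apply']
      intro x hx
      obtain ⟨hxX, hx | ⟨u, hu, e⟩⟩ := mem_filter.1 hx
      · exact ih hx
      · exact comp_adj_closed (ih hu) hxX e
  have hp' : ∀ j, p ∈ (expand G X)^[j] {p} := fun j => by
    induction j with
    | zero => exact mem_singleton_self p
    | succ j ih =>
      rw [Function.iterate_succ_apply']
      exact mem_filter.2 ⟨hp, Or.inl ih⟩
  refine Subset.antisymm (fun v hv => ?_) (hle N)
  refine (mem_comp.1 hv).induction (hp' N) fun x y hx _ hy e => ?_
  rw [← hst]
  exact mem_filter.2 ⟨hy, Or.inr ⟨x, hx, e⟩⟩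

end

/-! ### Ears -/

section
variable {V : Type*} [DecidableEq V] {G : SimpleGraph V}

/-- An ear of `F`: a connected set outside `F` that sends at least two edges to `F`. -/
structure IsEar (G : SimpleGraph V) (F X : Finset V) : Prop where
  connSet : ConnSet G X
  disj : Disjoint X F
  two_le : 2 ≤ eC G X F

lemma IsEar.mono {F F' X : Finset V} (h : IsEar G F X) (hF : F ⊆ F') (hd : Disjoint X F') :
    IsEar G F' X :=
  ⟨h.connSet, hd, h.two_le.trans (eC_mono subset_rfl hF)⟩

/-- An ear `X` added to `F` and earlier ears brings at least `#X - 1` inner edges and two edges to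
`F`, so the number of edges minus the number of vertices grows by at least one; in a forest it is
never positive. -/
lemma ears_bound {F H : Finset V} {E : Finset (Finset V)} (hH : Forest G H) (hF : F ⊆ H)
    (hE : ∀ X ∈ E, IsEar G F X) (hd : (E : Set (Finset V)).PairwiseDisjoint id)
    (hEH : ∀ X ∈ E, X ⊆ H) : eC G F F + 2 * #E ≤ 2 * #F := by
  have key : ∀ E' ⊆ E, ∃ W, W = F ∪ E'.biUnion id ∧
      eC G F F + 2 * #E' + 2 * #W ≤ eC G W W + 2 * #F := by
    intro E'
    induction E' using Finset.induction_on with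
    | empty => exact fun _ => ⟨F, by simp, by simp⟩
    | insert X E' hX ih =>
      intro hsub
      obtain ⟨W, hW, h⟩ := ih ((subset_insert _ _).trans hsub)
      have hXE := hE X (hsub (mem_insert_self _ _))
      have hdisj : Disjoint X W := by
        rw [hW, disjoint_union_right, disjoint_biUnion_right]
        refine ⟨hXE.disj, fun Y hY => ?_⟩
        exact hd (hsub (mem_insert_self _ _)) (hsub (mem_insert_of_mem hY))
          fun e => hX (e ▸ hY)
      refine ⟨X ∪ W, by rw [hW, biUnion_insert, id, union_left_comm], ?_⟩
      rw [eC_union_self hdisj, card_union_of_disjoint hdisj, card_insert_of_notMem hX]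
      have h1 := hXE.connSet.le_eC
      have h2 : eC G X F ≤ eC G X W := eC_mono subset_rfl (hW ▸ subset_union_left)
      have h3 := hXE.two_le
      omega
  obtain ⟨W, hW, h⟩ := key E subset_rfl
  have : Forest G W := hH.anti (hW ▸ union_subset hF (biUnion_subset.2 hEH))
  have := this.eC_le
  omega

/-- Disjoint ears that leave the forest `H` only inside `Z`. -/
lemma ears_card {F H Z : Finset V} {E : Finset (Finset V)} (hH : Forest G H) (hF : F ⊆ H)
    (hE : ∀ X ∈ E, IsEar G F X) (hd : (E : Set (Finset V)).PairwiseDisjoint id)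
    (hZ : ∀ X ∈ E, X \ H ⊆ Z) : eC G F F + 2 * #E ≤ 2 * #F + 2 * #Z := by
  classical
  have h1 := ears_bound (E := E.filter (· ⊆ H)) hH hF (fun X hX => hE X (mem_filter.1 hX).1)
    (hd.subset (coe_subset.2 (filter_subset _ _))) (fun X hX => (mem_filter.1 hX).2)
  -- An ear not inside `H` has a vertex in `Z`, and disjoint ears have different ones.
  have h2 : #(E.filter (¬· ⊆ H)) ≤ #Z := by
    have hne : ∀ X ∈ E.filter (¬· ⊆ H), (X \ H).Nonempty := fun X hX =>
      sdiff_nonempty.2 (mem_filter.1 hX).2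
    rcases (E.filter (¬· ⊆ H)).eq_empty_or_nonempty with h0 | ⟨X₀, hX₀⟩
    · simp [h0]
    have : Nonempty V := ⟨(hne X₀ hX₀).choose⟩
    choose! g hg using hne
    refine card_le_card_of_injOn g (fun X hX => hZ X (mem_filter.1 hX).1 (hg X hX)) ?_
    intro X hX Y hY hXY
    by_contra hne
    have hX' := mem_sdiff.1 (hg X hX)
    have hY' := mem_sdiff.1 (hg Y hY)
    rw [← hXY] at hY'
    exact disjoint_left.1 (hd (mem_filter.1 hX).1 (mem_filter.1 hY).1 hne) hX'.1 hY'.1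
  have h3 := card_filter_add_card_filter_not (s := E) (· ⊆ H)
  omega

/-! ### Branching vertices -/

open Classical in
/-- The component of `q` after the removal of its neighbour `p`; empty if `p` and `q` are not
adjacent. -/
noncomputable def branchSet (G : SimpleGraph V) (U : Finset V) (p q : V) : Finset V :=
  if G.Adj p q then comp G (U.erase p) q else ∅

/-- All components of `p` after the removal of `p`, with the possible exception of that of `q`,
send at most one edge to `F`; but together with `p` they send at least two. -/
def ValidAt (G : SimpleGraph V) (F U : Finset V) (p q : V) : Prop :=
  p ∈ U ∧ 3 ≤ eC G (comp G U p) F ∧ 2 ≤ eC G (comp G U p \ branchSet G U p q) F ∧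
    ∀ r ∈ U, G.Adj p r → r ∉ branchSet G U p q → eC G (comp G (U.erase p) r) F ≤ 1

lemma comp_erase_subset {U : Finset V} (p r : V) : comp G (U.erase p) r ⊆ comp G U r :=
  fun _ hx => mem_comp.2 ((mem_comp.1 hx).mono (erase_subset _ _))

lemma exists_adj_of_mem_comp {U : Finset V} {p x : V} (hx : x ∈ comp G U p) (hne : x ≠ p) :
    ∃ r ∈ U, G.Adj p r ∧ Conn G (U.erase p) r x := by
  have hc := mem_comp.1 hx
  rw [← insert_erase hc.1] at hc
  obtain ⟨g, hg, hgx⟩ := hc.exists_adj (mem_erase.2 ⟨hne, (mem_comp.1 hx).mem.2⟩) (notMem_erase _ _)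
  exact ⟨g, (mem_erase.1 hgx.1).2, hg, hgx⟩

lemma Forest.not_conn_erase {U : Finset V} (hU : Forest G U) {p g h : V} (hp : p ∈ U)
    (hg : G.Adj p g) (hh : G.Adj p h) (hne : g ≠ h) : ¬Conn G (U.erase p) g h := by
  rw [← insert_erase hp, forest_insert_iff (notMem_erase _ _)] at hU
  exact hU.2 g h hg hh hne

/-- Consider the component of `c` and the branches that hang from a vertex `q` at a neighbour `p` in
that component. Take a smallest of these sets that sends two edges to `F`. Its root `p` is valid
with parent `q`, as a branch further down with two edges would be smaller. The whole component has
no parent; there `q = p` makes `branchSet` empty. -/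
theorem exists_validAt {F U : Finset V} (hU : Forest G U) {c : V} (hc : c ∈ U)
    (h3 : 3 ≤ eC G (comp G U c) F) : ∃ p q, ValidAt G F U p q := by
  let Cand : ℕ → Prop := fun m => ∃ p q, p ∈ comp G U c ∧ ∃ X : Finset V, #X = m ∧ 2 ≤ eC G X F ∧
    ((X = comp G U p ∧ q = p) ∨ (X = comp G (U.erase q) p ∧ G.Adj p q ∧ q ∈ U))
  classical
  have hex : ∃ m, Cand m :=
    ⟨_, c, c, self_mem_comp hc, comp G U c, rfl, by omega, Or.inl ⟨rfl, rfl⟩⟩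
  obtain ⟨p, q, hp, X, hXc, hX2, hX⟩ := Nat.find_spec hex
  have hmin := fun m (hm : m < #X) => Nat.find_min hex (hXc ▸ hm)
  have hpU := comp_subset _ _ hp
  have hCp : comp G U p = comp G U c := (comp_eq_of_conn (mem_comp.1 hp)).symm
  refine ⟨p, q, hpU, by rwa [hCp], ?_, ?_⟩
  · refine hX2.trans (eC_mono ?_ subset_rfl)
    rcases hX with ⟨rfl, rfl⟩ | ⟨rfl, e, hq⟩
    · simp [branchSet]
    · intro x hx
      rw [mem_sdiff, branchSet, if_pos e]
      refine ⟨comp_erase_subset _ _ hx, fun hx' => ?_⟩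
      have hxp : x ≠ p := fun h => by
        have := comp_subset _ _ hx'
        simp [h] at this
      obtain ⟨r, hrU, er, hr⟩ := exists_adj_of_mem_comp hx hxp
      have hrq : r ≠ q := (mem_erase.1 hrU).1
      refine hU.not_conn_erase hpU er e hrq ((hr.mono ?_).trans (mem_comp.1 hx').symm)
      exact erase_subset_erase _ (erase_subset _ _)
  · intro r hr er hrB
    by_contra hlt
    have hrp : r ∈ U.erase p := mem_erase.2 ⟨er.ne', hr⟩
    refine hmin #(comp G (U.erase p) r) (card_lt_card ?_) ⟨r, p, ?_, _, rfl, by omega,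
      Or.inr ⟨rfl, er.symm, hpU⟩⟩
    · refine (ssubset_iff_of_subset ?_).2 ⟨p, ?_, fun h => by
        have := comp_subset _ _ h
        simp at this⟩
      · intro x hx
        rcases hX with ⟨rfl, rfl⟩ | ⟨rfl, e, hq⟩
        · exact mem_comp.2 ((Conn.adj er hpU hr).trans ((mem_comp.1 hx).mono (erase_subset _ _)))
        · rw [branchSet, if_pos e] at hrB
          have hpq : p ∈ U.erase q := mem_erase.2 ⟨e.ne, hpU⟩
          have hcl : comp G (U.erase p) r ⊆ U.erase q := fun y hy => by
            refine mem_erase.2 ⟨fun h => hrB ?_, (mem_erase.1 (comp_subset _ _ hy)).2⟩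
            rw [h] at hy
            exact mem_comp.2 (mem_comp.1 hy).symm
          exact mem_comp.2 ((Conn.adj er hpq (hcl (self_mem_comp hrp))).trans
            ((mem_comp.1 hx).comp.mono hcl))
      · rcases hX with ⟨rfl, rfl⟩ | ⟨rfl, e, hq⟩
        · exact self_mem_comp hpU
        · exact self_mem_comp (mem_erase.2 ⟨e.ne, hpU⟩)
    · rw [← hCp]
      exact mem_comp.2 (Conn.adj er hpU hr)

/-! ### The structure kept while branching -/

/-- Ghost data of the branching: `d` and `f` are the numbers of deleted and of kept vertices. -/
structure EarInv (G : SimpleGraph V) (F U : Finset V) (s d f : ℕ) : Prop where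
  exists_ears : ∃ D Y : Finset (Finset V), Disjoint D Y ∧
    ((D ∪ Y : Finset (Finset V)) : Set (Finset V)).PairwiseDisjoint id ∧
    (∀ X ∈ D ∪ Y, IsEar G F X) ∧
    (∀ X ∈ D ∪ Y, ∀ c ∈ U, 3 ≤ eC G (comp G U c) F → Disjoint X (comp G U c)) ∧
    (∀ X ∈ Y, X ⊆ U) ∧ #D = d ∧ 2 * f + 2 * #F ≤ eC G F F + 2 * #Y + 2 * s

lemma earInv_init (F U : Finset V) : EarInv G F U #F 0 0 :=
  ⟨∅, ∅, by simp, by simp, by simp, by simp, by simp, by simp, by simp⟩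

/-- Only the ears of `Y` are used. They lie in `U`, so one that is not inside `H` is charged to a
vertex of `U \ H`, that is, to a deletion of the last phase. -/
lemma EarInv.kept_le {F U H Z : Finset V} {s d f : ℕ} (h : EarInv G F U s d f) (hH : Forest G H)
    (hF : F ⊆ H) (hZ : U \ H ⊆ Z) : f ≤ s + #Z := by
  obtain ⟨D, Y, -, hdisj, hear, -, hYU, -, hcount⟩ := h.exists_ears
  have := ears_card (E := Y) (Z := Z) hH hF (fun X hX => hear X (mem_union_right _ hX))
    (hdisj.subset (by simp)) fun X hX => (sdiff_subset_sdiff (hYU X hX) subset_rfl).trans hZ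
  omega

/-- All ears are used, against an arbitrary forest that contains `F`. In the application this is the
greedy forest, whose complement has fewer than `k` vertices unless the state accepts. -/
lemma EarInv.add_le [Fintype V] {F U H : Finset V} {s d f : ℕ} (h : EarInv G F U s d f)
    (hH : Forest G H) (hF : F ⊆ H) : d + f ≤ s + #Hᶜ := by
  obtain ⟨D, Y, hDY, hdisj, hear, -, -, hd, hcount⟩ := h.exists_ears
  have := ears_card (E := D ∪ Y) (Z := Hᶜ) hH hF hear hdisj fun X hX x hx => by
    rw [mem_compl]; exact (mem_sdiff.1 hx).2
  rw [card_union_of_disjoint hDY] at this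
  omega

section
variable {F U : Finset V} {p q : V}

lemma exists_adj_of_mem_comp_sdiff {x : V}
    (hx : x ∈ comp G U p \ branchSet G U p q) (hne : x ≠ p) :
    ∃ r ∈ U, G.Adj p r ∧ r ∉ branchSet G U p q ∧ Conn G (U.erase p) r x := by
  obtain ⟨hx, hxB⟩ := mem_sdiff.1 hx
  obtain ⟨r, hr, e, hc⟩ := exists_adj_of_mem_comp hx hne
  refine ⟨r, hr, e, fun hrB => hxB ?_, hc⟩
  rw [branchSet] at hrB ⊢
  split_ifs at hrB ⊢ with hpq
  · exact mem_comp.2 ((mem_comp.1 hrB).trans hc)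
  · simp at hrB

lemma ValidAt.comp_subset_sdiff (h : ValidAt G F U p q) {r : V} (hr : r ∈ U) (e : G.Adj p r)
    (hrB : r ∉ branchSet G U p q) :
    comp G (U.erase p) r ⊆ comp G U p \ branchSet G U p q := by
  intro x hx
  refine mem_sdiff.2 ⟨mem_comp.2 ((Conn.adj e h.1 hr).trans
    ((mem_comp.1 hx).mono (erase_subset _ _))), fun hxB => hrB ?_⟩
  rw [branchSet] at hxB ⊢
  split_ifs at hxB ⊢ with hpq
  · exact mem_comp.2 ((mem_comp.1 hxB).trans (mem_comp.1 hx).symm)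
  · simp at hxB

lemma ValidAt.self_notMem_branchSet : p ∉ branchSet G U p q := by
  rw [branchSet]
  split_ifs
  · exact fun h => by simpa using comp_subset _ _ h
  · simp

lemma ValidAt.connSet (h : ValidAt G F U p q) :
    ConnSet G (comp G U p \ branchSet G U p q) := by
  set X := comp G U p \ branchSet G U p q with hX
  have hpX : p ∈ X := mem_sdiff.2 ⟨self_mem_comp h.1, ValidAt.self_notMem_branchSet⟩
  have key : ∀ x ∈ X, Conn G X p x := by
    intro x hx
    by_cases hxp : x = p
    · rw [hxp]; exact .refl hpX
    · obtain ⟨r, hr, e, hrB, hc⟩ := exists_adj_of_mem_comp_sdiff hx hxp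
      have hsub := h.comp_subset_sdiff hr e hrB
      exact (Conn.adj e hpX (hsub (self_mem_comp hc.1))).trans (hc.comp.mono hsub)
  exact ⟨⟨p, hpX⟩, fun x hx y hy => (key x hx).symm.trans (key y hy)⟩

/-- The new ear consists of `p` and its branches other than that of `q`. Without `p` these branches
send at most one edge each to `F`, so no component with three edges meets the ear, and the ears
found later stay disjoint from it. -/
lemma EarInv.delete {s d f : ℕ} (h : EarInv G F U s d f) (hFU : Disjoint F U)
    (hv : ValidAt G F U p q) : EarInv G F (U.erase p) s (d + 1) f := by
  obtain ⟨D, Y, hDY, hdisj, hear, hbig, hYU, hd, hcount⟩ := h.exists_ears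
  set X := comp G U p \ branchSet G U p q with hX
  have hXC : X ⊆ comp G U p := sdiff_subset
  have hXear : IsEar G F X :=
    ⟨hv.connSet, (hFU.mono_right (hXC.trans (comp_subset _ _))).symm, hv.2.2.1⟩
  have hXd : ∀ Z ∈ D ∪ Y, Disjoint X Z := fun Z hZ =>
    ((hbig Z hZ p hv.1 hv.2.1).mono_right hXC).symm
  have hXn : X ∉ D ∪ Y := fun hm => by
    have := hXd X hm
    rw [disjoint_self_iff_empty] at this
    exact hXear.connSet.1.ne_empty this
  rw [mem_union, not_or] at hXn
  refine ⟨insert X D, Y, disjoint_insert_left.2 ⟨hXn.2, hDY⟩, ?_, ?_, ?_, ?_, ?_, hcount⟩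
  · rw [insert_union, coe_insert]
    exact hdisj.insert fun Z hZ _ => hXd Z hZ
  · intro Z hZ
    rw [insert_union, mem_insert] at hZ
    rcases hZ with rfl | hZ
    · exact hXear
    · exact hear Z hZ
  · intro Z hZ c hc hc3
    have hcU := (mem_erase.1 hc).2
    rw [insert_union, mem_insert] at hZ
    rcases hZ with rfl | hZ
    · refine disjoint_left.2 fun x hx hxc => ?_
      have hxp : x ≠ p := (mem_erase.1 (comp_subset _ _ hxc)).1
      obtain ⟨r, hr, e, hrB, hrx⟩ := exists_adj_of_mem_comp_sdiff hx hxp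
      have := hv.2.2.2 r hr e hrB
      rw [comp_eq_of_conn hrx, ← comp_eq_of_conn (mem_comp.1 hxc)] at this
      omega
    · exact (hbig Z hZ c hcU (hc3.trans (eC_mono (comp_erase_subset _ _) subset_rfl))).mono_right
        (comp_erase_subset _ _)
  · intro Z hZ x hx
    refine mem_erase.2 ⟨fun h => ?_, hYU Z hZ hx⟩
    exact disjoint_left.1 (hbig Z (mem_union_right _ hZ) p hv.1 hv.2.1) hx
      (by rw [h]; exact self_mem_comp hv.1)
  · rw [card_insert_of_notMem hXn.1, hd]

lemma comp_erase_eC_singleton_le (hU : Forest G U) (hp : p ∈ U) (r : V) :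
    eC G (comp G (U.erase p) r) {p} ≤ 1 := by
  rw [eC_comm]
  classical
  rw [eC_singleton_left, card_le_one]
  intro a ha b hb
  rw [mem_filter, mem_comp] at ha hb
  by_contra hne
  exact hU.not_conn_erase hp ha.2 hb.2 hne (ha.1.symm.trans hb.1)

lemma eC_comp_singleton_eq_zero {c : V} (hp : p ∈ U) (hc : ¬Conn G U p c) :
    eC G (comp G U c) {p} = 0 := by
  rw [← Nat.le_zero, ← not_lt, eC_pos]
  rintro ⟨x, hx, y, hy, e⟩
  rw [mem_singleton] at hy
  subst hy
  exact hc ((Conn.adj e.symm hp (comp_subset _ _ hx)).trans (mem_comp.1 hx).symm)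

/-- A branch of `p`, other than that of `q`, with exactly one edge to `F` gets a second one, to `p`,
and becomes an ear. These new ears and the edges from `p` to `F` are at least two in number, which
pays for the growth of `f` and of `#F` by one each. -/
lemma EarInv.keep {s d f : ℕ} (h : EarInv G F U s d f) (hU : Forest G U) (hFU : Disjoint F U)
    (hv : ValidAt G F U p q) : EarInv G (insert p F) (U.erase p) s d (f + 1) := by
  classical
  obtain ⟨D, Y, hDY, hdisj, hear, hbig, hYU, hd, hcount⟩ := h.exists_ears
  have hpU := hv.1
  have hpF : p ∉ F := fun h => disjoint_left.1 hFU h hpU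
  set R := U.filter fun r => G.Adj p r ∧ r ∉ branchSet G U p q with hR
  set N := R.image (comp G (U.erase p)) with hN
  set E := N.filter fun X => eC G X F = 1 with hE
  have hRe : ∀ r ∈ R, r ∈ U.erase p := fun r hr => by
    obtain ⟨hrU, e, -⟩ := mem_filter.1 hr
    exact mem_erase.2 ⟨e.ne', hrU⟩
  have hNdisj : (N : Set (Finset V)).PairwiseDisjoint id := by
    intro X hX Z hZ hne
    obtain ⟨r, hr, rfl⟩ := mem_image.1 (mem_coe.1 hX)
    obtain ⟨r', hr', rfl⟩ := mem_image.1 (mem_coe.1 hZ)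
    exact comp_disjoint fun hc => hne (comp_eq_of_conn hc)
  have hNle : ∀ X ∈ N, eC G X F ≤ 1 := fun X hX => by
    obtain ⟨r, hr, rfl⟩ := mem_image.1 hX
    obtain ⟨hrU, e, hrB⟩ := mem_filter.1 hr
    exact hv.2.2.2 r hrU e hrB
  have hcover : comp G U p \ branchSet G U p q ⊆ {p} ∪ N.biUnion id := by
    intro x hx
    by_cases hxp : x = p
    · simp [hxp]
    · obtain ⟨r, hr, e, hrB, hrx⟩ := exists_adj_of_mem_comp_sdiff hx hxp
      refine mem_union_right _ (mem_biUnion.2 ⟨_, mem_image_of_mem _ (mem_filter.2 ⟨hr, e, hrB⟩), ?_⟩)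
      exact mem_comp.2 hrx
  have hpN : Disjoint {p} (N.biUnion id) := by
    rw [disjoint_singleton_left, mem_biUnion]
    rintro ⟨X, hX, hpX⟩
    obtain ⟨r, hr, rfl⟩ := mem_image.1 hX
    simpa using comp_subset _ _ hpX
  have hm : 2 ≤ eC G {p} F + #E := by
    have h1 := hv.2.2.1.trans (eC_mono (G := G) hcover (Subset.refl F))
    rw [eC_union_left hpN, eC_biUnion_left hNdisj] at h1
    have h2 : ∑ X ∈ N, eC G (id X) F ≤ #E := by
      rw [hE, card_filter]
      refine sum_le_sum fun X hX => ?_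
      have := hNle X hX
      simp only [id]
      split_ifs <;> omega
    omega
  have hEC : ∀ X ∈ E, X ⊆ comp G U p := fun X hX => by
    obtain ⟨r, hr, rfl⟩ := mem_image.1 (mem_filter.1 hX).1
    obtain ⟨hrU, e, hrB⟩ := mem_filter.1 hr
    exact (hv.comp_subset_sdiff hrU e hrB).trans sdiff_subset
  have hEne : ∀ X ∈ E, X.Nonempty := fun X hX => by
    obtain ⟨r, hr, rfl⟩ := mem_image.1 (mem_filter.1 hX).1
    exact ⟨r, self_mem_comp (hRe r hr)⟩
  have hEd : ∀ X ∈ E, ∀ Z ∈ D ∪ Y, Disjoint X Z := fun X hX Z hZ =>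
    ((hbig Z hZ p hpU hv.2.1).mono_right (hEC X hX)).symm
  have hEn : ∀ X ∈ E, X ∉ D ∪ Y := fun X hX hm => by
    have := hEd X hX X hm
    rw [disjoint_self_iff_empty] at this
    exact (hEne X hX).ne_empty this
  have hXF : ∀ X : Finset V, eC G X (insert p F) = eC G X {p} + eC G X F := fun X => by
    rw [insert_eq, eC_union_right _ (disjoint_singleton_left.2 hpF)]
  have hEtwo : ∀ X ∈ E, eC G X (insert p F) = 2 := fun X hX => by
    obtain ⟨hXN, hX1⟩ := mem_filter.1 hX
    obtain ⟨r, hr, rfl⟩ := mem_image.1 hXN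
    obtain ⟨hrU, e, hrB⟩ := mem_filter.1 hr
    have h1 := comp_erase_eC_singleton_le hU hpU r
    have h2 : 0 < eC G (comp G (U.erase p) r) {p} :=
      eC_pos.2 ⟨r, self_mem_comp (hRe r hr), p, mem_singleton_self _, e.symm⟩
    rw [hXF]
    omega
  have hpold : ∀ X ∈ D ∪ Y, p ∉ X := fun X hX hp =>
    disjoint_left.1 (hbig X hX p hpU hv.2.1) hp (self_mem_comp hpU)
  have hU' : ∀ X ∈ E, X ⊆ U.erase p := fun X hX => by
    obtain ⟨r, hr, rfl⟩ := mem_image.1 (mem_filter.1 hX).1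
    exact comp_subset _ _
  refine ⟨D, Y ∪ E, disjoint_union_right.2 ⟨hDY, disjoint_left.2 fun X hX hXE =>
    hEn X hXE (mem_union_left _ hX)⟩, ?_, ?_, ?_, ?_, hd, ?_⟩
  · rw [← union_assoc, coe_union, Set.pairwiseDisjoint_union]
    exact ⟨hdisj, hNdisj.subset (coe_subset.2 (filter_subset _ _)), fun Z hZ X hX _ => (hEd X hX Z hZ).symm⟩
  · intro X hX
    rw [← union_assoc, mem_union] at hX
    rcases hX with hX | hX
    · exact (hear X hX).mono (subset_insert _ _)
        (disjoint_insert_right.2 ⟨hpold X hX, (hear X hX).disj⟩)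
    · refine ⟨?_, ?_, (hEtwo X hX).ge⟩
      · obtain ⟨r, hr, rfl⟩ := mem_image.1 (mem_filter.1 hX).1
        exact connSet_comp (hRe r hr)
      · refine disjoint_insert_right.2 ⟨fun hp => by simpa using hU' X hX hp, ?_⟩
        exact (hFU.mono_right ((hU' X hX).trans (erase_subset _ _))).symm
  · intro X hX c hc hc3
    have hcU := (mem_erase.1 hc).2
    rw [← union_assoc, mem_union] at hX
    rcases hX with hX | hX
    · by_cases hpc : Conn G U p c
      · refine (hbig X hX p hpU hv.2.1).mono_right ((comp_erase_subset _ _).trans ?_)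
        rw [comp_eq_of_conn hpc]
      · have h0 := eC_comp_singleton_eq_zero hpU hpc
        have h1 := hc3.trans (eC_mono (G := G) (comp_erase_subset p c) (Subset.refl (insert p F)))
        rw [hXF, h0, zero_add] at h1
        exact (hbig X hX c hcU h1).mono_right (comp_erase_subset _ _)
    · have h2 := hEtwo X hX
      obtain ⟨r, hr, rfl⟩ := mem_image.1 (mem_filter.1 hX).1
      refine comp_disjoint fun hrc => ?_
      rw [comp_eq_of_conn hrc] at h2
      omega
  · intro X hX
    rcases mem_union.1 hX with hX | hX
    · exact fun x hx => mem_erase.2 ⟨fun h => hpold X (mem_union_right _ hX) (h ▸ hx), hYU X hX hx⟩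
    · exact hU' X hX
  · have hYE : Disjoint Y E := disjoint_left.2 fun X hX hXE => hEn X hXE (mem_union_right _ hX)
    rw [card_union_of_disjoint hYE, card_insert_of_notMem hpF, insert_eq,
      eC_union_self (disjoint_singleton_left.2 hpF), eC_self_singleton]
    omega

/-! ### Neighbours of deleted vertices -/

/-- All neighbours of `p` in `U`, with the possible exception of one, lie in components that send
at most one edge to `F`. -/
def OneLoose (G : SimpleGraph V) (F U : Finset V) (p : V) : Prop :=
  ∃ q, ∀ r ∈ U, G.Adj p r → r ≠ q → eC G (comp G U r) F ≤ 1

/-- Since `U` is a forest, the branch of `q` contains no neighbour of `p` except `q`. -/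
lemma ValidAt.oneLoose (hU : Forest G U) (h : ValidAt G F U p q) :
    OneLoose G F (U.erase p) p := by
  refine ⟨q, fun r hr e hrq => ?_⟩
  have hrU := (mem_erase.1 hr).2
  refine h.2.2.2 r hrU e fun hrB => ?_
  rw [branchSet] at hrB
  split_ifs at hrB with hpq
  · exact hU.not_conn_erase h.1 hpq e hrq.symm (mem_comp.1 hrB)
  · simp at hrB

lemma OneLoose.delete {w : V} (h : OneLoose G F U w) : OneLoose G F (U.erase p) w := by
  obtain ⟨q, hq⟩ := h
  refine ⟨q, fun r hr e hrq => ?_⟩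
  exact (eC_mono (comp_erase_subset _ _) subset_rfl).trans (hq r (mem_erase.1 hr).2 e hrq)

/-- A component with at most one edge to `F` is not that of `p`, so keeping `p` gives it no new
edge. -/
lemma OneLoose.keep {w : V} (h : OneLoose G F U w) (hp : p ∈ U) (hpF : p ∉ F)
    (h2 : 2 ≤ eC G (comp G U p) F) : OneLoose G (insert p F) (U.erase p) w := by
  obtain ⟨q, hq⟩ := h
  refine ⟨q, fun r hr e hrq => ?_⟩
  have h1 := hq r (mem_erase.1 hr).2 e hrq
  have hpr : ¬Conn G U p r := fun hc => by
    rw [comp_eq_of_conn hc] at h2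
    omega
  refine (eC_mono (comp_erase_subset _ _) subset_rfl).trans ?_
  rw [insert_eq, eC_union_right _ (disjoint_singleton_left.2 hpF), eC_comp_singleton_eq_zero hp hpr]
  omega

end
end

/-! ### Components with at most two edges to the kept part -/

section
variable {V : Type*} [DecidableEq V] {G : SimpleGraph V} {F U : Finset V}

/-- All components of the forest `U` send at most two edges to `F`. -/
structure Thin (G : SimpleGraph V) (F U : Finset V) : Prop where
  disj : Disjoint F U
  forest : Forest G U
  le_two : ∀ c ∈ U, eC G (comp G U c) F ≤ 2

/-- `z` reaches `F` in `F ∪ U` without `u`. -/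
def RF (G : SimpleGraph V) (F U : Finset V) (u z : V) : Prop :=
  ∃ f ∈ F, Conn G ((F ∪ U).erase u) z f

/-- `u` has two neighbours that are connected in `X`. -/
def Forced (G : SimpleGraph V) (X : Finset V) (u : V) : Prop :=
  ∃ x y, x ≠ y ∧ G.Adj u x ∧ G.Adj u y ∧ Conn G X x y

/-- Without `y`, the vertex `x` does not reach `F` any more. -/
def Broken (G : SimpleGraph V) (F U : Finset V) (y x : V) : Prop :=
  x = y ∨ (Conn G (F ∪ U) x y ∧ ¬RF G F U y x)

lemma Forced.mono {X Y : Finset V} {u : V} (h : Forced G X u) (hX : X ⊆ Y) : Forced G Y u := by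
  obtain ⟨x, y, hne, ex, ey, hc⟩ := h
  exact ⟨x, y, hne, ex, ey, hc.mono hX⟩

lemma forced_iff {X : Finset V} {u : V} (hX : Forest G X) (hu : u ∉ X) :
    Forced G X u ↔ ¬Forest G (insert u X) := by
  rw [forest_insert_iff hu]
  constructor
  · rintro ⟨x, y, hne, ex, ey, hc⟩ ⟨-, h⟩
    exact h x y ex ey hne hc
  · intro h
    by_contra hn
    exact h ⟨hX, fun x y ex ey hne hc => hn ⟨x, y, hne, ex, ey, hc⟩⟩

/-- Until it enters `F`, a path from `z` stays in the branch of `z` in `U.erase u`; `ab` is an edge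
by which that branch is left for `F`. If `z` itself lies in `F`, the edge is `uz`. -/
lemma RF.edge {u z : V} (hu : u ∈ U) (e : G.Adj u z) (h : RF G F U u z) :
    ∃ a b, a ∈ comp G U u ∧ b ∈ F ∧ G.Adj a b ∧ ((a = u ∧ b = z) ∨ Conn G (U.erase u) z a) := by
  obtain ⟨f, hf, hc⟩ := h
  by_cases hz : z ∈ F
  · exact ⟨u, z, self_mem_comp hu, hz, e, Or.inl ⟨rfl, rfl⟩⟩
  have hz1 := mem_erase.1 hc.1
  have hzU : z ∈ U := (mem_union.1 hz1.2).resolve_left hz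
  have hzU' : z ∈ U.erase u := mem_erase.2 ⟨hz1.1, hzU⟩
  by_contra hn
  have hn' : ∀ a b, Conn G (U.erase u) z a → b ∈ F → ¬G.Adj a b := fun a b ha hb eab =>
    hn ⟨a, b, mem_comp.2 ((Conn.adj e hu hzU).trans (ha.mono (erase_subset _ _))), hb, eab,
      Or.inr ha⟩
  have hfU : Conn G (U.erase u) z f := hc.induction (P := fun x => Conn G (U.erase u) z x)
    (.refl hzU') fun x y hx _ hy exy => by
      rw [mem_erase, mem_union] at hy
      rcases hy.2 with hyF | hyU
      · exact absurd exy (hn' x y hx hyF)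
      · exact hx.trans (.adj exy hx.mem.2 (mem_erase.2 ⟨hy.1, hyU⟩))
  obtain ⟨w⟩ := hfU.2
  rcases hfU.symm.2 with ⟨w⟩
  cases w with
  | nil => exact hz hf
  | cons e' w' =>
    have := Conn.trans hfU (Conn.adj e'.1 e'.2.1 e'.2.2)
    exact hn' _ _ this hf e'.1.symm

namespace Thin

/-- Different neighbours of `u` lie in different branches of the forest `U`, so they supply
different edges to `F`. -/
lemma edge_ne (T : Thin G F U) {u z z' a b a' b' : V} (hu : u ∈ U) (ez : G.Adj u z)
    (ez' : G.Adj u z') (hne : z ≠ z')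
    (h : (a = u ∧ b = z) ∨ Conn G (U.erase u) z a)
    (h' : (a' = u ∧ b' = z') ∨ Conn G (U.erase u) z' a') : ¬(a = a' ∧ b = b') := by
  rintro ⟨rfl, rfl⟩
  rcases h with ⟨ha, hb⟩ | h
  · rcases h' with ⟨_, hb'⟩ | h'
    · exact hne (hb.symm.trans hb')
    · exact (mem_erase.1 h'.mem.2).1 ha
  · rcases h' with ⟨ha, _⟩ | h'
    · exact (mem_erase.1 h.mem.2).1 ha
    · exact T.forest.not_conn_erase hu ez ez' hne (h.trans h'.symm)

lemma not_three (T : Thin G F U) {u x y z : V} (hu : u ∈ U) (ex : G.Adj u x) (ey : G.Adj u y)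
    (ez : G.Adj u z)
    (hxy : x ≠ y) (hxz : x ≠ z) (hyz : y ≠ z) (hx : RF G F U u x) (hy : RF G F U u y)
    (hz : RF G F U u z) : False := by
  obtain ⟨a, b, ha, hb, hab, h⟩ := hx.edge hu ex
  obtain ⟨a', b', ha', hb', hab', h'⟩ := hy.edge hu ey
  obtain ⟨a'', b'', ha'', hb'', hab'', h''⟩ := hz.edge hu ez
  have := T.le_two u hu
  have h3 : 3 ≤ eC G (comp G U u) F := eC_ge_three.2 ⟨a, b, a', b', a'', b'', ⟨ha, hb, hab⟩,
    ⟨ha', hb', hab'⟩, ⟨ha'', hb'', hab''⟩, T.edge_ne hu ex ey hxy h h', T.edge_ne hu ex ez hxz h h'',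
    T.edge_ne hu ey ez hyz h' h''⟩
  omega

/-- Otherwise the connection from `x` to `y` would avoid `F` and close a cycle with `u` inside the
forest `U`. -/
lemma reaches (T : Thin G F U) {u x y : V} (hu : u ∈ U) (ex : G.Adj u x) (ey : G.Adj u y)
    (hne : x ≠ y)
    (hc : Conn G ((F ∪ U).erase u) x y) : RF G F U u x := by
  by_contra hn
  have hF : ∀ z, Conn G ((F ∪ U).erase u) x z → z ∈ U.erase u := fun z hz => by
    obtain ⟨h1, h2⟩ := mem_erase.1 hz.mem.2
    exact mem_erase.2 ⟨h1, (mem_union.1 h2).resolve_left fun hzF => hn ⟨z, hzF, hz⟩⟩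
  refine T.forest.not_conn_erase hu ex ey hne (hc.comp.mono fun z hz => hF z (mem_comp.1 hz))

/-- A vertex outside `X` with two neighbours connected in `X` has only those two neighbours that
reach `F`. -/
lemma conn_of_reaches (T : Thin G F U) {X : Finset V} {c a b : V} (hX : X ⊆ F ∪ U) (hcU : c ∈ U)
    (hcX : c ∉ X)
    (hc : Forced G X c) (ea : G.Adj c a) (eb : G.Adj c b) (ha : RF G F U c a)
    (hb : RF G F U c b) : Conn G X a b := by
  obtain ⟨g, h, hne, eg, eh, hgh⟩ := hc
  have hsub := subset_erase.2 ⟨hX, hcX⟩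
  have hg := T.reaches hcU eg eh hne (hgh.mono hsub)
  have hh := T.reaches hcU eh eg hne.symm (hgh.symm.mono hsub)
  have key : ∀ d, G.Adj c d → RF G F U c d → d = g ∨ d = h := fun d ed hd => by
    by_contra hn
    rw [not_or] at hn
    exact T.not_three hcU ed eg eh hn.1 hn.2 hne hd hg hh
  rcases key a ea ha with rfl | rfl <;> rcases key b eb hb with rfl | rfl
  · exact .refl hgh.1
  · exact hgh
  · exact hgh.symm
  · exact .refl hgh.mem.2

/-- Removal of a forced vertex does not separate vertices that it does not break. -/
lemma conn_of_insert (T : Thin G F U) {X : Finset V} {c x x' : V} (hX : X ⊆ F ∪ U) (hcU : c ∈ U)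
    (hcX : c ∉ X)
    (hc : Forced G X c) (hx : ¬Broken G F U c x) (hx' : ¬Broken G F U c x')
    (h : Conn G (insert c X) x x') : Conn G X x x' := by
  have hmem : ∀ {z}, ¬Broken G F U c z → z ∈ insert c X → z ∈ X := fun hz hm =>
    (mem_insert.1 hm).resolve_left fun h => hz (Or.inl h)
  have hxX := hmem hx h.mem.1
  have hxX' := hmem hx' h.mem.2
  have hsub := subset_erase.2 ⟨hX, hcX⟩
  have hcW : c ∈ F ∪ U := mem_union_right _ hcU
  -- A neighbour of `c` that is connected in `X` with an unbroken vertex reaches `F` through that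
  -- vertex.
  have key : ∀ {z a}, ¬Broken G F U c z → G.Adj c a → Conn G X z a → RF G F U c a := by
    intro z a hz ea hza
    have hzc : Conn G (F ∪ U) z c := (hza.mono hX).trans (.adj ea.symm (hX hza.mem.2) hcW)
    have hr : RF G F U c z := by
      by_contra hn
      exact hz (Or.inr ⟨hzc, hn⟩)
    obtain ⟨f, hf, hzf⟩ := hr
    exact ⟨f, hf, (hza.symm.mono hsub).trans hzf⟩
  rcases h.insert_cases hxX hxX' hcX with h | ⟨a, b, ea, eb, ha, hb⟩
  · exact h
  · exact ha.trans ((T.conn_of_reaches hX hcU hcX hc ea eb (key hx ea ha)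
      (key hx' eb hb.symm)).trans hb)

lemma conn_of_union (T : Thin G F U) {X Z : Finset V} {x x' : V} (hX : X ⊆ F ∪ U) (hZ : Z ⊆ U)
    (hXZ : Disjoint X Z) (hc : ∀ c ∈ Z, Forced G X c) (hx : ∀ c ∈ Z, ¬Broken G F U c x)
    (hx' : ∀ c ∈ Z, ¬Broken G F U c x') (h : Conn G (X ∪ Z) x x') : Conn G X x x' := by
  induction Z using Finset.induction_on with
  | empty => simpa using h
  | insert c Z hcZ ih =>
    have hsub := subset_insert c Z
    rw [union_insert] at h
    refine ih (hsub.trans hZ) (hXZ.mono_right hsub) (fun d hd => hc d (hsub hd))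
      (fun d hd => hx d (hsub hd)) (fun d hd => hx' d (hsub hd)) ?_
    have hm := mem_insert_self c Z
    refine T.conn_of_insert (union_subset hX ((hsub.trans hZ).trans subset_union_right)) (hZ hm) ?_
      ((hc c hm).mono subset_union_left) (hx c hm) (hx' c hm) h
    rw [mem_union, not_or]
    exact ⟨fun h => disjoint_left.1 hXZ h hm, hcZ⟩

/-- If `y` reached `F` only through `y'`, both neighbours of `y` on a cycle would be connected with
`y'` inside `U.erase y`, hence with each other, although `U` is a forest. -/
lemma not_broken_cyclic (T : Thin G F U) {y y' : V} (hy : y ∈ U) (hy' : y' ∈ U) (hne : y ≠ y')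
    (hcy : Forced G ((F ∪ U).erase y) y) : ¬Broken G F U y' y := by
  rintro (h | ⟨-, hn⟩)
  · exact hne h
  have key : ∀ g, G.Adj y g → RF G F U y g → Conn G (U.erase y) g y' := by
    rintro g eg ⟨f, hf, hc⟩
    have hyy' : y' ∈ U.erase y := mem_erase.2 ⟨hne.symm, hy'⟩
    by_cases hg : g = y'
    · rw [hg]; exact .refl hyy'
    have hgW := (mem_erase.1 hc.1).2
    have hg' : g ∈ (F ∪ U).erase y' := mem_erase.2 ⟨hg, hgW⟩
    have hyW : y ∈ (F ∪ U).erase y' := mem_erase.2 ⟨hne, mem_union_right _ hy⟩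
    have hnF : ∀ z, Conn G ((F ∪ U).erase y') g z → z ∉ F := fun z hz hzF =>
      hn ⟨z, hzF, (Conn.adj eg hyW hg').trans hz⟩
    have hgU : g ∈ U.erase y :=
      mem_erase.2 ⟨eg.ne', (mem_union.1 hgW).resolve_left (hnF g (.refl hg'))⟩
    have := hc.induction (P := fun z => Conn G (U.erase y) g y' ∨
      (Conn G (U.erase y) g z ∧ Conn G ((F ∪ U).erase y') g z)) (Or.inr ⟨.refl hgU, .refl hg'⟩) (by
        rintro z w (h | ⟨h1, h2⟩) hz hw e
        · exact Or.inl h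
        · by_cases hwy : w = y'
          · subst hwy
            exact Or.inl (h1.trans (.adj e h1.mem.2 hyy'))
          · obtain ⟨hw1, hw2⟩ := mem_erase.1 hw
            have h3 := h2.trans (Conn.adj e h2.mem.2 (mem_erase.2 ⟨hwy, hw2⟩))
            have hwU : w ∈ U.erase y :=
              mem_erase.2 ⟨hw1, (mem_union.1 hw2).resolve_left (hnF w h3)⟩
            exact Or.inr ⟨h1.trans (.adj e h1.mem.2 hwU), h3⟩)
    rcases this with h | h
    · exact h
    · exact absurd hf (hnF f h.2)
  obtain ⟨g, h, hgh, eg, eh, hc⟩ := hcy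
  exact T.forest.not_conn_erase hy eg eh hgh ((key g eg (T.reaches hy eg eh hgh hc)).trans
    (key h eh (T.reaches hy eh eg hgh.symm hc.symm)).symm)

/-- A vertex is broken by at most one cyclic vertex. -/
lemma broken_unique (T : Thin G F U) {x y y' : V} (hy : y ∈ U) (hy' : y' ∈ U)
    (hcy : Forced G ((F ∪ U).erase y) y) (hcy' : Forced G ((F ∪ U).erase y') y')
    (h : Broken G F U y x) (h' : Broken G F U y' x) : y = y' := by
  by_contra hne
  rcases h with rfl | ⟨h1, h2⟩
  · exact T.not_broken_cyclic hy hy' hne hcy h'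
  rcases h' with rfl | ⟨h1', h2'⟩
  · exact T.not_broken_cyclic hy' hy (Ne.symm hne) hcy' (Or.inr ⟨h1, h2⟩)
  have hxy : x ≠ y := by
    rintro rfl
    exact T.not_broken_cyclic hy hy' hne hcy (Or.inr ⟨h1', h2'⟩)
  have hxy' : x ≠ y' := by
    rintro rfl
    exact T.not_broken_cyclic hy' hy (Ne.symm hne) hcy' (Or.inr ⟨h1, h2⟩)
  -- If `x` can get to `y'` without `y`, then `y` breaks `y'`; otherwise `x` gets to `y` without
  -- `y'`, and `y'` breaks `y`. Both contradict `not_broken_cyclic`.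
  by_cases hc : Conn G ((F ∪ U).erase y) x y'
  · refine T.not_broken_cyclic hy' hy (Ne.symm hne) hcy' (Or.inr ⟨h1'.symm.trans h1, ?_⟩)
    rintro ⟨f, hf, hcf⟩
    exact h2 ⟨f, hf, hc.trans hcf⟩
  · have hx : x ∈ (F ∪ U).erase y := mem_erase.2 ⟨hxy, h1.mem.1⟩
    have hx' : x ∈ (F ∪ U).erase y' := mem_erase.2 ⟨hxy', h1.mem.1⟩
    have := h1.induction (P := fun z => Conn G ((F ∪ U).erase y') x y ∨
      (z ≠ y ∧ Conn G ((F ∪ U).erase y) x z ∧ Conn G ((F ∪ U).erase y') x z))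
      (Or.inr ⟨hxy, .refl hx, .refl hx'⟩) (by
        rintro z w (h | ⟨hz, h3, h4⟩) hzW hw e
        · exact Or.inl h
        · by_cases hwy : w = y
          · subst hwy
            exact Or.inl (h4.trans (.adj e h4.mem.2 (mem_erase.2 ⟨hne, hw⟩)))
          · have h5 := h3.trans (Conn.adj e h3.mem.2 (mem_erase.2 ⟨hwy, hw⟩))
            have hwy' : w ≠ y' := fun h => hc (h ▸ h5)
            exact Or.inr ⟨hwy, h5, h4.trans (.adj e h4.mem.2 (mem_erase.2 ⟨hwy', hw⟩))⟩)
    rcases this with h | h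
    · refine T.not_broken_cyclic hy hy' hne hcy (Or.inr ⟨h1.symm.trans h1', ?_⟩)
      rintro ⟨f, hf, hcf⟩
      exact h2' ⟨f, hf, h.trans hcf⟩
    · exact h.1 rfl

/-- A forced vertex does not break the neighbours of another cyclic vertex. -/
lemma not_broken_neighbour (T : Thin G F U) {X : Finset V} {c v a : V} (hX : X ⊆ F ∪ U)
    (hcU : c ∈ U) (hcX : c ∉ X)
    (hc : Forced G X c) (hvU : v ∈ U) (hvX : v ∉ X) (hvc : v ≠ c)
    (hcv : Forced G ((F ∪ U).erase v) v) (ea : G.Adj v a) (haW : a ∈ F ∪ U) :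
    ¬Broken G F U c a := by
  have hb := T.not_broken_cyclic hvU hcU hvc hcv
  have hvW : v ∈ F ∪ U := mem_union_right _ hvU
  have hr : Conn G (F ∪ U) v c → RF G F U c v := fun h => by
    by_contra hn
    exact hb (Or.inr ⟨h, hn⟩)
  rintro (rfl | ⟨h1, h2⟩)
  · obtain ⟨f, hf, hvf⟩ := hr (Conn.adj ea hvW haW)
    obtain ⟨g, h, hne, eg, eh, hgh⟩ := hc
    have hsub := subset_erase.2 ⟨hX, hcX⟩
    refine T.not_three hcU ea.symm eg eh ?_ ?_ hne ⟨f, hf, hvf⟩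
      (T.reaches hcU eg eh hne (hgh.mono hsub)) (T.reaches hcU eh eg hne.symm (hgh.symm.mono hsub))
    · rintro rfl; exact hvX hgh.mem.1
    · rintro rfl; exact hvX hgh.mem.2
  · obtain ⟨f, hf, hvf⟩ := hr ((Conn.adj ea hvW haW).trans h1)
    by_cases hac : a = c
    · subst hac
      obtain ⟨g, h, hne, eg, eh, hgh⟩ := hc
      have hsub := subset_erase.2 ⟨hX, hcX⟩
      refine T.not_three hcU ea.symm eg eh ?_ ?_ hne ⟨f, hf, hvf⟩
        (T.reaches hcU eg eh hne (hgh.mono hsub))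
        (T.reaches hcU eh eg hne.symm (hgh.symm.mono hsub))
      · rintro rfl; exact hvX hgh.mem.1
      · rintro rfl; exact hvX hgh.mem.2
    · exact h2 ⟨f, hf, (Conn.adj ea.symm (mem_erase.2 ⟨hac, haW⟩) hvf.1).trans hvf⟩

end Thin

/-! ### Bases -/

/-- A maximal forest between `F` and `F ∪ U`. -/
structure IsBase (G : SimpleGraph V) (F U B : Finset V) : Prop where
  subset : F ⊆ B
  le : B ⊆ F ∪ U
  forest : Forest G B
  forced : ∀ v ∈ F ∪ U, v ∉ B → Forced G B v

lemma IsBase.mem_U {B : Finset V} (h : IsBase G F U B) {v : V} (hv : v ∈ F ∪ U) (hvB : v ∉ B) :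
    v ∈ U :=
  (mem_union.1 hv).resolve_left fun hF => hvB (h.subset hF)

lemma IsBase.cyclic {B : Finset V} (h : IsBase G F U B) {v : V} (hv : v ∈ F ∪ U) (hvB : v ∉ B) :
    Forced G ((F ∪ U).erase v) v :=
  (h.forced v hv hvB).mono fun _ hx => mem_erase.2 ⟨fun h => hvB (h ▸ hx), h.le hx⟩

namespace Thin

/-- Two neighbours of `y` are connected in `B`. If `A.erase y` forced every vertex of `B \ A`, they
would remain connected after the removal of those vertices, and `y` would lie on a cycle in `A`. The
exchanged set is maximal because it forces `y`, and hence the removal of `y` does not separate the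
neighbours of the other omitted vertices. -/
lemma exchange (T : Thin G F U) {A B : Finset V} (hA : IsBase G F U A)
    (hB : IsBase G F U B) {y : V} (hyA : y ∈ A)
    (hyB : y ∉ B) : ∃ z ∈ B, z ∉ A ∧ IsBase G F U (insert z (A.erase y)) := by
  have hyW := hA.le hyA
  have hyU := hB.mem_U hyW hyB
  have hyF : y ∉ F := fun h => hyB (hB.subset h)
  have hycyc := hB.cyclic hyW hyB
  have hA' : Forest G (A.erase y) := hA.forest.anti (erase_subset _ _)
  have hA'W : A.erase y ⊆ F ∪ U := (erase_subset _ _).trans hA.le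
  have hz : ∃ z ∈ B, z ∉ A ∧ Forest G (insert z (A.erase y)) := by
    by_contra! hn
    have hforced : ∀ z ∈ B \ A, Forced G (A.erase y) z := fun z hz => by
      obtain ⟨hzB, hzA⟩ := mem_sdiff.1 hz
      exact (forced_iff hA' fun h => hzA (erase_subset _ _ h)).2 (hn z hzB hzA)
    have hsub : B \ A ⊆ U := fun z hz => by
      obtain ⟨hzB, hzA⟩ := mem_sdiff.1 hz
      exact hA.mem_U (hB.le hzB) hzA
    have hdisj : Disjoint (A.erase y) (B \ A) :=
      disjoint_sdiff.mono_left (erase_subset _ _)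
    obtain ⟨g, h, hne, eg, eh, hgh⟩ := hB.forced y hyW hyB
    have hnb : ∀ a, G.Adj y a → a ∈ B → ∀ c ∈ B \ A, ¬Broken G F U c a := fun a ea ha c hc =>
      T.not_broken_neighbour hA'W (hsub hc) (disjoint_right.1 hdisj hc) (hforced c hc) hyU
        (notMem_erase _ _) (fun h => hyB (h ▸ (mem_sdiff.1 hc).1)) hycyc ea (hB.le ha)
    have := T.conn_of_union hA'W hsub hdisj hforced (hnb g eg hgh.mem.1) (hnb h eh hgh.mem.2)
      (hgh.mono fun x hx => by
        by_cases hxA : x ∈ A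
        · exact mem_union_left _ (mem_erase.2 ⟨fun h => hyB (h ▸ hx), hxA⟩)
        · exact mem_union_right _ (mem_sdiff.2 ⟨hx, hxA⟩))
    exact hA.forest.not_conn_erase hyA eg eh hne this
  obtain ⟨z, hzB, hzA, hzF⟩ := hz
  have hzW := hB.le hzB
  have hsubz : insert z (A.erase y) ⊆ F ∪ U := insert_subset hzW hA'W
  have hyz : y ≠ z := fun h => hyB (h ▸ hzB)
  have hyn : y ∉ insert z (A.erase y) := by simp [hyz]
  -- Adding `y` gives `insert z A`, which is not a forest by the maximality of `A`.
  have hyforced : Forced G (insert z (A.erase y)) y := by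
    rw [forced_iff hzF hyn, insert_comm, insert_erase hyA]
    exact (forced_iff hA.forest hzA).1 (hA.forced z hzW hzA)
  refine ⟨z, hzB, hzA, fun x hx => mem_insert_of_mem (mem_erase.2 ⟨fun h => hyF (h ▸ hx),
    hA.subset hx⟩), hsubz, hzF, fun v hv hvn => ?_⟩
  by_cases hvy : v = y
  · rw [hvy]; exact hyforced
  have hvA : v ∉ A := fun h => hvn (mem_insert_of_mem (mem_erase.2 ⟨hvy, h⟩))
  obtain ⟨a, b, hne, ea, eb, hab⟩ := hA.forced v hv hvA
  have hnb : ∀ a, G.Adj v a → a ∈ A → ¬Broken G F U y a := fun a ea ha =>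
    T.not_broken_neighbour hsubz hyU hyn hyforced (hA.mem_U hv hvA) hvn hvy (hA.cyclic hv hvA) ea
      (hA.le ha)
  refine ⟨a, b, hne, ea, eb, T.conn_of_insert hsubz hyU hyn hyforced (hnb a ea hab.mem.1)
    (hnb b eb hab.mem.2) (hab.mono ?_)⟩
  rw [insert_comm, insert_erase hyA]
  exact subset_insert _ _

lemma card_eq (T : Thin G F U) {A B : Finset V} (hA : IsBase G F U A)
    (hB : IsBase G F U B) : #A = #B := by
  induction hm : #(A \ B) generalizing A with
  | zero =>
    have hAB : A ⊆ B := sdiff_eq_empty_iff_subset.1 (card_eq_zero.1 hm)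
    congr 1
    refine hAB.antisymm fun v hv => ?_
    by_contra hvA
    exact (forced_iff hA.forest hvA).1 (hA.forced v (hB.le hv) hvA)
      (hB.forest.anti (insert_subset hv hAB))
  | succ m ih =>
    obtain ⟨y, hy⟩ : (A \ B).Nonempty := card_pos.1 (by omega)
    obtain ⟨hyA, hyB⟩ := mem_sdiff.1 hy
    obtain ⟨z, hzB, hzA, hbase⟩ := T.exchange hA hB hyA hyB
    have h1 : #(insert z (A.erase y)) = #A := by
      rw [card_insert_of_notMem fun h => hzA (erase_subset _ _ h), card_erase_add_one hyA]
    have h2 : insert z (A.erase y) \ B = (A \ B).erase y := by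
      ext x
      simp only [mem_sdiff, mem_insert, mem_erase]
      constructor
      · rintro ⟨rfl | h, h'⟩
        · exact absurd hzB h'
        · exact ⟨h.1, h.2, h'⟩
      · rintro ⟨h1, h2, h3⟩
        exact ⟨Or.inr ⟨h1, h2⟩, h3⟩
    rw [← h1]
    refine ih hbase ?_
    rw [h2, card_erase_of_mem hy, hm]
    rfl

/-- Vertices that no cyclic vertex breaks are connected in every base if at all. -/
lemma conn_base (T : Thin G F U) {B : Finset V} (hB : IsBase G F U B) {a b : V}
    (ha : ∀ c ∈ F ∪ U, c ∉ B → ¬Broken G F U c a) (hb : ∀ c ∈ F ∪ U, c ∉ B → ¬Broken G F U c b)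
    (h : Conn G (F ∪ U) a b) : Conn G B a b := by
  refine T.conn_of_union (Z := (F ∪ U) \ B) hB.le ?_ disjoint_sdiff ?_ ?_ ?_ ?_
  · exact fun c hc => hB.mem_U (mem_sdiff.1 hc).1 (mem_sdiff.1 hc).2
  · exact fun c hc => hB.forced c (mem_sdiff.1 hc).1 (mem_sdiff.1 hc).2
  · exact fun c hc => ha c (mem_sdiff.1 hc).1 (mem_sdiff.1 hc).2
  · exact fun c hc => hb c (mem_sdiff.1 hc).1 (mem_sdiff.1 hc).2
  · rwa [union_sdiff_of_subset hB.le]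

/-! ### Deleted vertices with at most one loose neighbour -/

/-- A vertex that `y` breaks lies outside `F`, in the component of `y` in `U`, and that component
sends two edges to `F` because `y` lies on a cycle. -/
lemma not_broken_of_le_one (T : Thin G F U) {y r : V} (hy : y ∈ U) (hcy : Forced G
    ((F ∪ U).erase y) y)
    (hr : r ∈ F ∪ U) (h : r ∈ F ∨ eC G (comp G U r) F ≤ 1) : ¬Broken G F U y r := by
  have hyF : y ∉ F := fun h => disjoint_left.1 T.disj h hy
  have hy2 : 2 ≤ eC G (comp G U y) F := by
    obtain ⟨g, g', hne, eg, eg', hc⟩ := hcy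
    obtain ⟨a, b, ha, hb, hab, h⟩ := (T.reaches hy eg eg' hne hc).edge hy eg
    obtain ⟨a', b', ha', hb', hab', h'⟩ := (T.reaches hy eg' eg hne.symm hc.symm).edge hy eg'
    exact eC_ge_two.2 ⟨a, b, a', b', ⟨ha, hb, hab⟩, ⟨ha', hb', hab'⟩,
      T.edge_ne hy eg eg' hne h h'⟩
  rcases h with hF | h1
  · rintro (rfl | ⟨-, hn⟩)
    · exact hyF hF
    · exact hn ⟨r, hF, .refl (mem_erase.2 ⟨fun h => hyF (h ▸ hF), hr⟩)⟩
  · rintro (rfl | ⟨hc, hn⟩)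
    · omega
    by_cases hry : r = y
    · subst hry; omega
    have hr' : r ∈ (F ∪ U).erase y := mem_erase.2 ⟨hry, hr⟩
    have hnF : ∀ z, Conn G ((F ∪ U).erase y) r z → z ∉ F := fun z hz hzF => hn ⟨z, hzF, hz⟩
    have hrU : r ∈ U := (mem_union.1 hr).resolve_left (hnF r (.refl hr'))
    have := hc.induction (P := fun z => Conn G U r y ∨
      (z ≠ y ∧ Conn G ((F ∪ U).erase y) r z ∧ Conn G U r z))
      (Or.inr ⟨hry, .refl hr', .refl hrU⟩) (by
        rintro z w (h | ⟨hz, h3, h4⟩) hzW hw e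
        · exact Or.inl h
        · by_cases hwy : w = y
          · subst hwy
            exact Or.inl (h4.trans (.adj e h4.mem.2 hy))
          · have h5 := h3.trans (Conn.adj e h3.mem.2 (mem_erase.2 ⟨hwy, hw⟩))
            exact Or.inr ⟨hwy, h5, h4.trans (.adj e h4.mem.2
              ((mem_union.1 hw).resolve_left (hnF w h5)))⟩)
    rcases this with h | h
    · rw [comp_eq_of_conn h] at h1
      omega
    · exact h.1 rfl

lemma oneLoose_iff {p : V} (h : OneLoose G F U p) :
    ∃ q, ∀ r ∈ F ∪ U, G.Adj p r → r ≠ q → r ∈ F ∨ eC G (comp G U r) F ≤ 1 := by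
  obtain ⟨q, hq⟩ := h
  refine ⟨q, fun r hr e hrq => ?_⟩
  rcases mem_union.1 hr with h | h
  · exact Or.inl h
  · exact Or.inr (hq r h e hrq)

/-- If `y` is forced by the base `B` and the deleted vertex `p` is forced by `B` together with `y`
but not by `B`, then it is forced only by sets that contain `y`. -/
lemma mem_of_forced (T : Thin G F U) {B A : Finset V} {p y : V} (hp : OneLoose G F U p)
    (hB : IsBase G F U B)
    (hyW : y ∈ F ∪ U) (hyB : y ∉ B) (hpB : ¬Forced G B p) (hpy : Forced G (insert y B) p)
    (hA : A ⊆ F ∪ U) (hpA : Forced G A p) : y ∈ A := by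
  by_contra hyA
  obtain ⟨q, hq⟩ := oneLoose_iff hp
  have hyU := hB.mem_U hyW hyB
  have hycyc := hB.cyclic hyW hyB
  have hfree : ∀ r ∈ F ∪ U, G.Adj p r → r ≠ q → ¬Broken G F U y r := fun r hr e hrq =>
    T.not_broken_of_le_one hyU hycyc hr (hq r hr e hrq)
  -- If not even the exceptional neighbour `q` were broken by `y`, the removal of `y` would not
  -- separate the neighbours of `p`, and `B` would force `p`.
  have hbq : Broken G F U y q := by
    by_contra hbq
    obtain ⟨x, x', hne, ex, ex', hc⟩ := hpy
    have hsub : insert y B ⊆ F ∪ U := insert_subset hyW hB.le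
    have hb : ∀ r ∈ insert y B, G.Adj p r → ¬Broken G F U y r := fun r hr e => by
      by_cases hrq : r = q
      · rwa [hrq]
      · exact hfree r (hsub hr) e hrq
    exact hpB ⟨x, x', hne, ex, ex', T.conn_of_insert hB.le hyU hyB (hB.forced y hyW hyB)
      (hb x hc.mem.1 ex) (hb x' hc.mem.2 ex') hc⟩
  obtain ⟨a, b, hne, ea, eb, hab⟩ := hpA
  have hAe : A ⊆ (F ∪ U).erase y := subset_erase.2 ⟨hA, hyA⟩
  -- Since `y ∉ A`, a neighbour connected with `q` in `A` would be broken together with `q`; but `q`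
  -- is the only neighbour that can be broken.
  have main : ∀ a b, G.Adj p b → a ≠ b → Conn G A a b → a ≠ q := by
    rintro a b eb hne hab rfl
    refine hfree b (hA hab.mem.2) eb hne.symm ?_
    rcases hbq with h | ⟨h1, h2⟩
    · exact absurd (h ▸ hab.1) hyA
    · refine Or.inr ⟨(hab.symm.mono hA).trans h1, ?_⟩
      rintro ⟨f, hf, hbf⟩
      exact h2 ⟨f, hf, (hab.mono hAe).trans hbf⟩
  have hfree' : ∀ r ∈ F ∪ U, G.Adj p r → r ≠ q → ∀ c ∈ F ∪ U, c ∉ B → ¬Broken G F U c r :=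
    fun r hr e hrq c hc hcB =>
      T.not_broken_of_le_one (hB.mem_U hc hcB) (hB.cyclic hc hcB) hr (hq r hr e hrq)
  exact hpB ⟨a, b, hne, ea, eb, T.conn_base hB
    (hfree' a (hA hab.mem.1) ea (main a b eb hne hab))
    (hfree' b (hA hab.mem.2) eb (main b a ea hne.symm hab.symm)) (hab.mono hA)⟩

/-- If a deleted vertex `p` is forced inside `F ∪ U`, then a base that does not force it does so
after the addition of one vertex. -/
lemma exists_forced_insert (T : Thin G F U) {B : Finset V} {p : V} (hp : OneLoose G F U p)
    (hB : IsBase G F U B)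
    (hpB : ¬Forced G B p) (hpA : Forced G (F ∪ U) p) :
    ∃ y ∈ F ∪ U, y ∉ B ∧ Forced G (insert y B) p := by
  obtain ⟨q, hq⟩ := oneLoose_iff hp
  have hfree : ∀ r ∈ F ∪ U, G.Adj p r → r ≠ q → ∀ c ∈ F ∪ U, c ∉ B → ¬Broken G F U c r :=
    fun r hr e hrq c hc hcB =>
      T.not_broken_of_le_one (hB.mem_U hc hcB) (hB.cyclic hc hcB) hr (hq r hr e hrq)
  obtain ⟨a, b, hne, ea, eb, hab⟩ := hpA
  -- The vertex to add is the one outside `B` that breaks `q`; by `broken_unique` there is at most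
  -- one.
  by_cases hbq : ∃ y ∈ F ∪ U, y ∉ B ∧ Broken G F U y q
  · obtain ⟨y, hyW, hyB, hy⟩ := hbq
    refine ⟨y, hyW, hyB, a, b, hne, ea, eb, ?_⟩
    have hnb : ∀ r ∈ F ∪ U, G.Adj p r → ∀ c ∈ (F ∪ U) \ insert y B, ¬Broken G F U c r := by
      intro r hr e c hc hcr
      rw [mem_sdiff, mem_insert, not_or] at hc
      by_cases hrq : r = q
      · rw [hrq] at hcr
        exact hc.2.1 (T.broken_unique (hB.mem_U hc.1 hc.2.2) (hB.mem_U hyW hyB)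
          (hB.cyclic hc.1 hc.2.2) (hB.cyclic hyW hyB) hcr hy)
      · exact hfree r hr e hrq c hc.1 hc.2.2 hcr
    have hsub : insert y B ⊆ F ∪ U := insert_subset hyW hB.le
    refine T.conn_of_union (Z := (F ∪ U) \ insert y B) hsub (fun c hc => ?_) disjoint_sdiff
      (fun c hc => ?_) (hnb a hab.mem.1 ea) (hnb b hab.mem.2 eb) ?_
    · rw [mem_sdiff, mem_insert, not_or] at hc
      exact hB.mem_U hc.1 hc.2.2
    · rw [mem_sdiff, mem_insert, not_or] at hc
      exact (hB.forced c hc.1 hc.2.2).mono (subset_insert _ _)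
    · rwa [union_sdiff_of_subset hsub]
  · push Not at hbq
    have hnb : ∀ r ∈ F ∪ U, G.Adj p r → ∀ c ∈ F ∪ U, c ∉ B → ¬Broken G F U c r := by
      intro r hr e c hc hcB
      by_cases hrq : r = q
      · rw [hrq]; exact hbq c hc hcB
      · exact hfree r hr e hrq c hc hcB
    exact absurd ⟨a, b, hne, ea, eb, T.conn_base hB (hnb a hab.mem.1 ea) (hnb b hab.mem.2 eb) hab⟩
      hpB

end Thin
end

/-! ### The search tree -/

section
variable {n : ℕ}

/-- The least element of `X`, as a set. -/
def pick (X : Finset (Fin n)) : Finset (Fin n) := {v ∈ X | ∀ w ∈ X, v ≤ w}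

lemma exists_pick_eq {X : Finset (Fin n)} (h : X.Nonempty) : ∃ v ∈ X, pick X = {v} := by
  refine ⟨X.min' h, X.min'_mem h, ?_⟩
  ext v
  rw [pick, mem_filter, mem_singleton]
  constructor
  · rintro ⟨hv, hle⟩
    exact le_antisymm (hle _ (X.min'_mem h)) (X.min'_le v hv)
  · rintro rfl
    exact ⟨X.min'_mem h, fun w hw => X.min'_le w hw⟩

/-- A state of the search: the kept vertices `F`, the deleted vertices `D` and `D₁`, and budgets. -/
structure State (n : ℕ) where
  /-- whether the budget `a` grows with the kept vertices of the initial set -/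
  grow : Bool
  /-- the kept vertices -/
  F : Finset (Fin n)
  /-- the deleted vertices, except those deleted by branching on a valid vertex -/
  D : Finset (Fin n)
  /-- the vertices deleted by branching on a valid vertex -/
  D₁ : Finset (Fin n)
  /-- the number of free deletions -/
  eps : ℕ
  /-- the budget for deletions -/
  a : ℕ
  /-- the budget for keeping valid vertices -/
  f : ℕ
  /-- the budget for keeping vertices in the last phase -/
  kap : ℕ
  /-- the budget for deletions in the last phase -/
  nu : ℕ

namespace State

/-- The undecided vertices. -/
def U (s : State n) : Finset (Fin n) := (s.F ∪ s.D ∪ s.D₁)ᶜ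

/-- The greedy extension of the kept vertices by undecided ones. -/
noncomputable def H₁ (G : SimpleGraph (Fin n)) (s : State n) : Finset (Fin n) :=
  greedy G (List.finRange n) s.F s.U

/-- The greedy extension of `H₁` to a maximal forest. -/
noncomputable def H₂ (G : SimpleGraph (Fin n)) (s : State n) : Finset (Fin n) :=
  greedy G (List.finRange n) (s.H₁ G) univ

open Classical in
/-- The vertices to branch on. -/
noncomputable def valid (G : SimpleGraph (Fin n)) (s : State n) : Finset (Fin n) :=
  {p | ∃ q, ValidAt G s.F s.U p q}

open Classical in
/-- The vertices that have to be kept for the sake of a vertex of `D₁`. -/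
noncomputable def needed (G : SimpleGraph (Fin n)) (s : State n) : Finset (Fin n) :=
  {v | (v ∈ s.U ∧ v ∉ s.H₁ G) ∧ ∃ p, p ∈ s.D₁ ∧ ¬Forced G (s.H₁ G) p ∧
    Forced G (insert v (s.H₁ G)) p}

/-- Keep `X`. -/
def keep (s : State n) (X : Finset (Fin n)) : State n := { s with F := s.F ∪ X }

/-- Delete `X`. -/
def del (s : State n) (X : Finset (Fin n)) : State n := { s with D := s.D ∪ X }

/-- Delete `X` as a valid vertex. -/
def del₁ (s : State n) (X : Finset (Fin n)) : State n := { s with D₁ := s.D₁ ∪ X }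

/-- The children of a state with an undecided vertex of the initial set. -/
def branchInit (s : State n) (X : Finset (Fin n)) : List (State n) :=
  [{ s.keep X with f := s.f + 1, a := if s.grow then s.a + 1 else s.a }] ++
    (if s.grow ∨ 0 < s.eps then [{ s.del X with eps := s.eps - 1 }]
      else if 0 < s.a then [{ s.del X with a := s.a - 1, kap := s.kap + 1 + 1 }] else [])

/-- The children of a state with a valid vertex. -/
def branchValid (s : State n) (X : Finset (Fin n)) : List (State n) :=
  (if 0 < s.a then [{ s.del₁ X with a := s.a - 1 }] else []) ++
    (if 0 < s.f then [{ s.keep X with f := s.f - 1 }] else [])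

/-- The children of a state of the last phase. -/
def branchLast (s : State n) (X : Finset (Fin n)) : List (State n) :=
  (if 0 < s.kap then [{ s.keep X with kap := s.kap - 1 }] else []) ++
    (if 0 < s.nu then [{ s.del X with nu := s.nu - 1 }] else [])

open Classical in
/-- One step of the search: `none` if a large minimal feedback vertex set has been found, and the
list of children otherwise. -/
noncomputable def step (G : SimpleGraph (Fin n)) (k : ℕ) (S : Finset (Fin n)) (s : State n) :
    Option (List (State n)) :=
  if ¬Forest G s.F then some []
  else if k ≤ #(s.H₂ G)ᶜ then none
  else if (s.U ∩ S).Nonempty then some (s.branchInit (pick (s.U ∩ S)))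
  else if (s.valid G).Nonempty then some (s.branchValid (pick (s.valid G)))
  else if (s.needed G).Nonempty then some [s.keep (pick (s.needed G))]
  else if (s.U \ s.H₁ G).Nonempty then some (s.branchLast (pick (s.U \ s.H₁ G)))
  else some []

/-- Some descendant of the state is accepting. -/
inductive Acc (G : SimpleGraph (Fin n)) (k : ℕ) (S : Finset (Fin n)) : State n → Prop
  | accept (s : State n) (h : s.step G k S = none) : Acc G k S s
  | child (s c : State n) (ch : List (State n)) (h : s.step G k S = some ch) (hc : c ∈ ch)
      (ha : Acc G k S c) : Acc G k S s

/-! ### Soundness of the search and the potential of a state. -/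

variable {G : SimpleGraph (Fin n)} {k : ℕ} {S : Finset (Fin n)} {s : State n}

lemma F_subset_H₁ : s.F ⊆ s.H₁ G := subset_greedy _ _ _

lemma H₁_subset : s.H₁ G ⊆ s.F ∪ s.U := greedy_subset _ _ _

lemma H₁_subset_H₂ : s.H₁ G ⊆ s.H₂ G := subset_greedy _ _ _

lemma forest_H₁ (h : Forest G s.F) : Forest G (s.H₁ G) := forest_greedy _ _ _ h

lemma maxForest_H₂ (h : Forest G s.F) : MaxForest G (s.H₂ G) :=
  ⟨forest_greedy _ _ _ (forest_H₁ h), fun v hv =>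
    greedy_maximal _ _ _ v (List.mem_finRange v) (mem_univ v) hv⟩

lemma step_eq_none (hF : Forest G s.F) (h : k ≤ #(s.H₂ G)ᶜ) : s.step G k S = none := by
  simp [step, hF, h]

/-- Nothing about the branching is needed: an accepting state exhibits its forest `H₂`. -/
lemma Acc.sound (h : Acc G k S s) : ∃ H, MaxForest G H ∧ k ≤ #Hᶜ := by
  induction h with
  | accept s h =>
    rw [step] at h
    split_ifs at h with h1 h2
    exact ⟨s.H₂ G, maxForest_H₂ h1, h2⟩
  | child _ _ _ _ _ _ ih => exact ih

lemma mem_U {v : Fin n} : v ∈ s.U ↔ v ∉ s.F ∧ v ∉ s.D ∧ v ∉ s.D₁ := by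
  simp [U]

open Classical in
lemma valid_subset : s.valid G ⊆ s.U := fun p hp => by
  obtain ⟨q, hq⟩ := (mem_filter.1 hp).2
  exact hq.1

open Classical in
lemma needed_subset : s.needed G ⊆ s.U := fun _ hp => (mem_filter.1 hp).2.1.1

lemma U_keep (v : Fin n) : (s.keep {v}).U = s.U.erase v := by
  ext x; simp only [mem_U, keep, mem_erase, mem_union, mem_singleton]; tauto

lemma U_del (v : Fin n) : (s.del {v}).U = s.U.erase v := by
  ext x; simp only [mem_U, del, mem_erase, mem_union, mem_singleton]; tauto

lemma U_del₁ (v : Fin n) : (s.del₁ {v}).U = s.U.erase v := by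
  ext x; simp only [mem_U, del₁, mem_erase, mem_union, mem_singleton]; tauto

/-- The potential that bounds the number of leaves below a state. -/
noncomputable def pot (S : Finset (Fin n)) (s : State n) : ℝ :=
  if s.grow then 5 ^ #(s.U ∩ S) * 2 ^ (s.a + s.f) * (s.kap + s.nu).choose s.kap
  else (17 / 6) ^ #(s.U ∩ S) * 3 ^ s.a * (3 / 2) ^ s.f * 2 ^ (s.nu + s.kap)

lemma one_le_pot : 1 ≤ s.pot S := by
  rw [pot]
  split_ifs
  · have h1 : (1 : ℝ) ≤ 5 ^ #(s.U ∩ S) := one_le_pow₀ (by norm_num)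
    have h2 : (1 : ℝ) ≤ 2 ^ (s.a + s.f) := one_le_pow₀ (by norm_num)
    have h3 : (1 : ℝ) ≤ (s.kap + s.nu).choose s.kap := by
      exact_mod_cast Nat.choose_pos (Nat.le_add_right _ _)
    exact one_le_mul_of_one_le_of_one_le (one_le_mul_of_one_le_of_one_le h1 h2) h3
  · have h1 : (1 : ℝ) ≤ (17 / 6) ^ #(s.U ∩ S) := one_le_pow₀ (by norm_num)
    have h2 : (1 : ℝ) ≤ 3 ^ s.a := one_le_pow₀ (by norm_num)
    have h3 : (1 : ℝ) ≤ (3 / 2) ^ s.f := one_le_pow₀ (by norm_num)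
    have h4 : (1 : ℝ) ≤ 2 ^ (s.nu + s.kap) := one_le_pow₀ (by norm_num)
    exact one_le_mul_of_one_le_of_one_le
      (one_le_mul_of_one_le_of_one_le (one_le_mul_of_one_le_of_one_le h1 h2) h3) h4

lemma pot_of_grow {s : State n} (h : s.grow = true) : s.pot S =
    5 ^ #(s.U ∩ S) * 2 ^ (s.a + s.f) * (s.kap + s.nu).choose s.kap := by
  rw [pot, if_pos h]

lemma pot_of_not_grow {s : State n} (h : s.grow = false) : s.pot S =
    (17 / 6) ^ #(s.U ∩ S) * 3 ^ s.a * (3 / 2) ^ s.f * 2 ^ (s.nu + s.kap) := by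
  rw [pot, if_neg (by simp [h])]

section
variable {v : Fin n}

/-- This is where the bases 5 and 17/6 come from. With `grow`, a kept vertex raises two budgets of
weight 2 and a deletion is free: `4 + 1 = 5`. Without it, a kept vertex costs 3/2 and a paid
deletion `2 ^ 2 / 3 = 4 / 3`, together 17/6; a free deletion costs only 1. -/
lemma branchInit_pot (hv : v ∈ s.U ∩ S) :
    ((s.branchInit {v}).map (pot S)).sum ≤ s.pot S := by
  have hc : #(s.U ∩ S) = #(s.U.erase v ∩ S) + 1 := by
    rw [erase_inter, card_erase_add_one hv]
  have hk : ∀ e a f, ({ s.keep {v} with eps := e, a := a, f := f } : State n).U = s.U.erase v :=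
    fun _ _ _ => U_keep v
  have hd : ∀ e a f κ, ({ s.del {v} with eps := e, a := a, f := f, kap := κ } : State n).U =
    s.U.erase v := fun _ _ _ _ => U_del v
  cases hg : s.grow with
  | true =>
    have h1 := hk s.eps (s.a + 1) (s.f + 1)
    have h2 := hd (s.eps - 1) s.a s.f s.kap
    simp only [branchInit, hg, if_true, true_or, List.cons_append, List.nil_append, List.map_cons,
      List.map_nil, List.sum_cons, List.sum_nil]
    rw [pot_of_grow (by exact hg), pot_of_grow (by exact hg), pot_of_grow hg]
    simp only [keep, del] at h1 h2 ⊢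
    simp only [h1, h2, hc]
    rw [show s.a + 1 + (s.f + 1) = s.a + s.f + 2 by ring, pow_add _ _ 2, pow_succ 5]
    linarith
  | false =>
    have h1 := hk s.eps s.a (s.f + 1)
    have hP : (0 : ℝ) ≤ (17 / 6) ^ #(s.U.erase v ∩ S) * 3 ^ s.a * (3 / 2) ^ s.f *
      2 ^ (s.nu + s.kap) := by positivity
    by_cases he : 0 < s.eps
    · have h2 := hd (s.eps - 1) s.a s.f s.kap
      simp only [branchInit, hg, Bool.false_eq_true, if_false, false_or, he, if_true,
        List.cons_append, List.nil_append, List.map_cons,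
        List.map_nil, List.sum_cons, List.sum_nil]
      rw [pot_of_not_grow (by exact hg), pot_of_not_grow (by exact hg), pot_of_not_grow hg]
      simp only [keep, del] at h1 h2 ⊢
      simp only [h1, h2, hc]
      rw [pow_succ, pow_succ]
      linarith
    · by_cases ha : 0 < s.a
      · have h2 := hd s.eps (s.a - 1) s.f (s.kap + 1 + 1)
        simp only [branchInit, hg, Bool.false_eq_true, if_false, false_or, he, ha, if_true,
          List.cons_append, List.nil_append, List.map_cons,
          List.map_nil, List.sum_cons, List.sum_nil]
        rw [pot_of_not_grow (by exact hg), pot_of_not_grow (by exact hg), pot_of_not_grow hg]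
        simp only [keep, del] at h1 h2 ⊢
        simp only [h1, h2, hc]
        obtain ⟨b, hb⟩ : ∃ b, s.a = b + 1 := ⟨s.a - 1, by omega⟩
        rw [hb, Nat.add_sub_cancel] at *
        rw [show s.nu + (s.kap + 1 + 1) = s.nu + s.kap + 2 by ring, pow_add _ (s.nu + s.kap) 2]
        simp only [pow_succ] at hP ⊢
        linarith
      · simp only [branchInit, hg, Bool.false_eq_true, if_false, false_or, he, ha,
          List.cons_append, List.nil_append, List.map_cons,
          List.map_nil, List.sum_cons, List.sum_nil]
        rw [pot_of_not_grow (by exact hg), pot_of_not_grow hg]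
        simp only [keep] at h1 ⊢
        simp only [h1, hc]
        rw [pow_succ, pow_succ]
        linarith

/-- The weights of the two children are `1 / 2 + 1 / 2` with `grow` and `1 / 3 + 2 / 3` without. -/
lemma branchValid_pot (h0 : s.U ∩ S = ∅) :
    ((s.branchValid {v}).map (pot S)).sum ≤ s.pot S := by
  have hz : s.U.erase v ∩ S = ∅ := by rw [erase_inter, h0]; rfl
  have hk : ∀ f, ({ s.keep {v} with f := f } : State n).U = s.U.erase v := fun _ => U_keep v
  have hd : ∀ a, ({ s.del₁ {v} with a := a } : State n).U = s.U.erase v := fun _ => U_del₁ v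
  have h1 := hk (s.f - 1)
  have h2 := hd (s.a - 1)
  have hpos := one_le_pot (s := s) (S := S)
  simp only [keep, del₁] at h1 h2
  cases hg : s.grow with
  | true =>
    rw [pot_of_grow hg] at hpos ⊢
    rw [branchValid]
    split_ifs with ha hf hf <;> simp only [List.cons_append, List.nil_append, List.map_cons,
      List.map_nil, List.sum_cons, List.sum_nil]
    · rw [pot_of_grow (by exact hg), pot_of_grow (by exact hg)]
      simp only [keep, del₁, h1, h2, h0, hz]
      rw [show s.a - 1 + s.f = s.a + s.f - 1 by omega, show s.a + (s.f - 1) = s.a + s.f - 1 by omega,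
        show s.a + s.f = s.a + s.f - 1 + 1 by omega, pow_succ, Nat.add_sub_cancel]
      linarith
    · rw [pot_of_grow (by exact hg)]
      simp only [del₁, h2, h0, hz]
      rw [add_zero]
      gcongr <;> norm_num
    · rw [pot_of_grow (by exact hg)]
      simp only [keep, h1, h0, hz]
      rw [add_zero]
      gcongr <;> norm_num
    · linarith
  | false =>
    rw [pot_of_not_grow hg] at hpos ⊢
    have hP : (0 : ℝ) ≤ (17 / 6) ^ #(∅ : Finset (Fin n)) * 3 ^ (s.a - 1) * (3 / 2) ^ (s.f - 1) *
      2 ^ (s.nu + s.kap) := by positivity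
    rw [branchValid]
    split_ifs with ha hf hf <;> simp only [List.cons_append, List.nil_append, List.map_cons,
      List.map_nil, List.sum_cons, List.sum_nil]
    · rw [pot_of_not_grow (by exact hg), pot_of_not_grow (by exact hg)]
      simp only [keep, del₁, h1, h2, h0, hz]
      obtain ⟨b, hb⟩ : ∃ b, s.a = b + 1 := ⟨s.a - 1, by omega⟩
      obtain ⟨f, hf'⟩ : ∃ f, s.f = f + 1 := ⟨s.f - 1, by omega⟩
      simp only [hb, hf', Nat.add_sub_cancel, pow_succ] at hP ⊢
      linarith
    · rw [pot_of_not_grow (by exact hg)]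
      simp only [del₁, h2, h0, hz]
      rw [add_zero]
      gcongr <;> norm_num
    · rw [pot_of_not_grow (by exact hg)]
      simp only [keep, h1, h0, hz]
      rw [add_zero]
      gcongr <;> norm_num
    · linarith

/-- Pascal's rule with `grow`, and `1 / 2 + 1 / 2` without. -/
lemma branchLast_pot (h0 : s.U ∩ S = ∅) :
    ((s.branchLast {v}).map (pot S)).sum ≤ s.pot S := by
  have hz : s.U.erase v ∩ S = ∅ := by rw [erase_inter, h0]; rfl
  have hk : ∀ f, ({ s.keep {v} with kap := f } : State n).U = s.U.erase v := fun _ => U_keep v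
  have hd : ∀ a, ({ s.del {v} with nu := a } : State n).U = s.U.erase v := fun _ => U_del v
  have h1 := hk (s.kap - 1)
  have h2 := hd (s.nu - 1)
  have hpos := one_le_pot (s := s) (S := S)
  simp only [keep, del] at h1 h2
  cases hg : s.grow with
  | true =>
    rw [pot_of_grow hg] at hpos ⊢
    rw [branchLast]
    split_ifs with ha hf hf <;> simp only [List.cons_append, List.nil_append, List.map_cons,
      List.map_nil, List.sum_cons, List.sum_nil]
    · rw [pot_of_grow (by exact hg), pot_of_grow (by exact hg)]
      simp only [keep, del, h1, h2, h0, hz]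
      obtain ⟨b, hb⟩ : ∃ b, s.kap = b + 1 := ⟨s.kap - 1, by omega⟩
      obtain ⟨f, hf'⟩ : ∃ f, s.nu = f + 1 := ⟨s.nu - 1, by omega⟩
      simp only [hb, hf', Nat.add_sub_cancel]
      rw [show b + 1 + (f + 1) = (b + (f + 1)) + 1 by ring, Nat.choose_succ_succ,
        show b + 1 + f = b + (f + 1) by ring]
      push_cast
      linarith
    · rw [pot_of_grow (by exact hg)]
      simp only [keep, h1, h0, hz]
      obtain ⟨b, hb⟩ : ∃ b, s.kap = b + 1 := ⟨s.kap - 1, by omega⟩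
      have hn : s.nu = 0 := by omega
      simp [hb, hn]
    · rw [pot_of_grow (by exact hg)]
      simp only [del, h2, h0, hz]
      have hn : s.kap = 0 := by omega
      simp [hn]
    · linarith
  | false =>
    rw [pot_of_not_grow hg] at hpos ⊢
    rw [branchLast]
    split_ifs with ha hf hf <;> simp only [List.cons_append, List.nil_append, List.map_cons,
      List.map_nil, List.sum_cons, List.sum_nil]
    · rw [pot_of_not_grow (by exact hg), pot_of_not_grow (by exact hg)]
      simp only [keep, del, h1, h2, h0, hz]
      rw [show s.nu - 1 + s.kap = s.nu + s.kap - 1 by omega,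
        show s.nu + (s.kap - 1) = s.nu + s.kap - 1 by omega,
        show s.nu + s.kap = s.nu + s.kap - 1 + 1 by omega, pow_succ, Nat.add_sub_cancel]
      linarith
    · rw [pot_of_not_grow (by exact hg)]
      simp only [keep, h1, h0, hz]
      rw [add_zero]
      gcongr <;> norm_num
    · rw [pot_of_not_grow (by exact hg)]
      simp only [del, h2, h0, hz]
      rw [add_zero]
      gcongr <;> norm_num
    · linarith

end
end State
end

/-! ### The number of visited states -/

/-- A search whose potential `Φ` does not increase and whose measure `μ` decreases visits at most
`(μ + 1) * Φ` states below each state of the stack. -/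
theorem exists_run {σ : Type*} (step : σ → Option (List σ)) (μ : σ → ℕ) (Φ : σ → ℝ)
    (A : σ → Prop) (hΦ : ∀ s, 1 ≤ Φ s)
    (hstep : ∀ s ch, step s = some ch →
      (∀ c ∈ ch, μ c < μ s) ∧ (ch.map Φ).sum ≤ Φ s ∧ (A s ↔ ∃ c ∈ ch, A c))
    (hnone : ∀ s, step s = none → A s) (M : ℕ) (l : List σ) (hl : ∀ s ∈ l, μ s < M) :
    ∃ b N, Run step l b N ∧ (N : ℝ) ≤ M * (l.map Φ).sum ∧ (b = true ↔ ∃ s ∈ l, A s) := by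
  -- A run of the rest `l` of the stack is given and `ch` is put in front of it. The outer induction
  -- is on the measure, the inner one on `ch`; an accepting state makes the given run superfluous.
  have key : ∀ m (ch l : List σ) (b : Bool) (N : ℕ), (∀ s ∈ ch, μ s < m) → Run step l b N →
      ∃ b' N', Run step (ch ++ l) b' N' ∧ (N' : ℝ) ≤ N + m * (ch.map Φ).sum ∧
        (b' = true ↔ (∃ s ∈ ch, A s) ∨ b = true) := by
    intro m
    induction m with
    | zero =>
      intro ch l b N hch hr
      cases ch with
      | nil => exact ⟨b, N, hr, by simp, by simp⟩
      | cons s ch => exact absurd (hch s List.mem_cons_self) (by omega)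
    | succ m ih =>
      intro ch
      induction ch with
      | nil => intro l b N _ hr; exact ⟨b, N, hr, by simp, by simp⟩
      | cons s ch ih' =>
        intro l b N hch hr
        obtain ⟨b₁, N₁, hr₁, hN₁, hb₁⟩ := ih' l b N (fun c hc => hch c (List.mem_cons_of_mem _ hc)) hr
        have hs := hch s List.mem_cons_self
        have hpos := hΦ s
        have hsum : 0 ≤ (ch.map Φ).sum := List.sum_nonneg fun x hx => by
          obtain ⟨c, -, rfl⟩ := List.mem_map.1 hx
          linarith [hΦ c]
        simp only [List.cons_append, List.map_cons, List.sum_cons]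
        rcases hst : step s with _ | ch'
        · refine ⟨true, 1, .accept s _ hst, ?_, ?_⟩
          · push_cast at hN₁ ⊢
            have : (0 : ℝ) ≤ N := Nat.cast_nonneg N
            have hm : (0 : ℝ) ≤ m := Nat.cast_nonneg m
            nlinarith [mul_nonneg hm hsum, mul_nonneg hm (by linarith : (0 : ℝ) ≤ Φ s)]
          · simp only [true_iff]
            exact Or.inl ⟨s, List.mem_cons_self, hnone s hst⟩
        · obtain ⟨hμ, hle, hA⟩ := hstep s ch' hst
          obtain ⟨b₂, N₂, hr₂, hN₂, hb₂⟩ := ih ch' (ch ++ l) b₁ N₁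
            (fun c hc => by have := hμ c hc; omega) hr₁
          refine ⟨b₂, N₂ + 1, .expand s _ ch' b₂ N₂ hst hr₂, ?_, ?_⟩
          · push_cast at hN₁ ⊢
            have hm : (0 : ℝ) ≤ m := Nat.cast_nonneg m
            nlinarith [mul_le_mul_of_nonneg_left hle hm]
          · rw [hb₂, hb₁, ← hA]
            simp only [List.mem_cons]
            constructor
            · rintro (h | ⟨c, hc, h⟩ | h)
              · exact Or.inl ⟨s, Or.inl rfl, h⟩
              · exact Or.inl ⟨c, Or.inr hc, h⟩
              · exact Or.inr h
            · rintro (⟨c, rfl | hc, h⟩ | h)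
              · exact Or.inl h
              · exact Or.inr (Or.inl ⟨c, hc, h⟩)
              · exact Or.inr (Or.inr h)
  obtain ⟨b, N, hr, hN, hb⟩ := key M l [] false 0 hl .nil
  exact ⟨b, N, by simpa using hr, by simpa using hN, by simpa using hb⟩

/-! ### Size of the search tree. -/

namespace State
variable {n : ℕ} {G : SimpleGraph (Fin n)} {k : ℕ} {S : Finset (Fin n)} {s : State n}

lemma step_some {ch : List (State n)} (h : s.step G k S = some ch) :
    ch = [] ∨ (∃ v ∈ s.U ∩ S, ch = s.branchInit {v}) ∨
      (s.U ∩ S = ∅ ∧ ∃ v ∈ s.U, ch = s.branchValid {v} ∨ ch = [s.keep {v}] ∨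
        ch = s.branchLast {v}) := by
  rw [step] at h
  split_ifs at h with h1 h2 h3 h4 h5 h6
  · obtain ⟨v, hv, hp⟩ := exists_pick_eq h3
    rw [hp] at h
    exact Or.inr (Or.inl ⟨v, hv, (Option.some.inj h).symm⟩)
  · obtain ⟨v, hv, hp⟩ := exists_pick_eq h4
    rw [hp] at h
    exact Or.inr (Or.inr ⟨not_nonempty_iff_eq_empty.1 h3, v, valid_subset hv,
      Or.inl (Option.some.inj h).symm⟩)
  · obtain ⟨v, hv, hp⟩ := exists_pick_eq h5
    rw [hp] at h
    exact Or.inr (Or.inr ⟨not_nonempty_iff_eq_empty.1 h3, v, needed_subset hv,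
      Or.inr (Or.inl (Option.some.inj h).symm)⟩)
  · obtain ⟨v, hv, hp⟩ := exists_pick_eq h6
    rw [hp] at h
    exact Or.inr (Or.inr ⟨not_nonempty_iff_eq_empty.1 h3, v, (mem_sdiff.1 hv).1,
      Or.inr (Or.inr (Option.some.inj h).symm)⟩)
  all_goals exact Or.inl (Option.some.inj h).symm

lemma branchInit_U {v : Fin n} {c : State n} (hc : c ∈ s.branchInit {v}) : c.U = s.U.erase v := by
  rw [branchInit, List.mem_append] at hc
  rcases hc with hc | hc
  · rw [List.mem_singleton.1 hc]; exact U_keep v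
  · split_ifs at hc
    · rw [List.mem_singleton.1 hc]; exact U_del v
    · rw [List.mem_singleton.1 hc]; exact U_del v
    · simp at hc

lemma branchValid_U {v : Fin n} {c : State n} (hc : c ∈ s.branchValid {v}) : c.U = s.U.erase v := by
  rw [branchValid, List.mem_append] at hc
  rcases hc with hc | hc
  · split_ifs at hc
    · rw [List.mem_singleton.1 hc]; exact U_del₁ v
    · simp at hc
  · split_ifs at hc
    · rw [List.mem_singleton.1 hc]; exact U_keep v
    · simp at hc

lemma branchLast_U {v : Fin n} {c : State n} (hc : c ∈ s.branchLast {v}) : c.U = s.U.erase v := by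
  rw [branchLast, List.mem_append] at hc
  rcases hc with hc | hc
  · split_ifs at hc
    · rw [List.mem_singleton.1 hc]; exact U_keep v
    · simp at hc
  · split_ifs at hc
    · rw [List.mem_singleton.1 hc]; exact U_del v
    · simp at hc

lemma step_card_lt {ch : List (State n)} (h : s.step G k S = some ch) :
    ∀ c ∈ ch, #c.U < #s.U := by
  have key : ∀ v ∈ s.U, #(s.U.erase v) < #s.U := fun v hv => card_lt_card (erase_ssubset hv)
  intro c hc
  rcases step_some h with rfl | ⟨v, hv, rfl⟩ | ⟨-, v, hv, rfl | rfl | rfl⟩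
  · simp at hc
  · rw [branchInit_U hc]; exact key v (mem_inter.1 hv).1
  · rw [branchValid_U hc]; exact key v hv
  · rw [List.mem_singleton.1 hc, U_keep]; exact key v hv
  · rw [branchLast_U hc]; exact key v hv

lemma step_pot_le {ch : List (State n)} (h : s.step G k S = some ch) :
    (ch.map (pot S)).sum ≤ s.pot S := by
  rcases step_some h with rfl | ⟨v, hv, rfl⟩ | ⟨h0, v, hv, rfl | rfl | rfl⟩
  · simpa using zero_le_one.trans one_le_pot
  · exact branchInit_pot hv
  · exact branchValid_pot h0
  -- Keeping a needed vertex touches no budget, and `U ∩ S` is already empty, so the potential is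
  -- unchanged.
  · simp only [List.map_cons, List.map_nil, List.sum_cons, List.sum_nil, add_zero]
    have h1 : (s.keep {v}).U ∩ S = s.U ∩ S := by
      rw [U_keep, erase_inter, h0]; rfl
    rw [pot, pot, h1]
    exact le_rfl
  · exact branchLast_pot h0

lemma step_length_le {ch : List (State n)} (h : s.step G k S = some ch) : ch.length ≤ 2 := by
  rcases step_some h with rfl | ⟨v, hv, rfl⟩ | ⟨-, v, hv, rfl | rfl | rfl⟩
  · simp
  · rw [branchInit]; split_ifs <;> simp
  · rw [branchValid]; split_ifs <;> simp
  · simp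
  · rw [branchLast]; split_ifs <;> simp

theorem exists_run_states (G : SimpleGraph (Fin n)) (k : ℕ) (S : Finset (Fin n))
    (l : List (State n)) : ∃ b N, Run (step G k S) l b N ∧
      (N : ℝ) ≤ (n + 1 : ℕ) * (l.map (pot S)).sum ∧ (b = true ↔ ∃ s ∈ l, Acc G k S s) := by
  refine exists_run (step G k S) (fun s => #s.U) (pot S) (Acc G k S) (fun _ => one_le_pot)
    (fun s ch h => ⟨step_card_lt h, step_pot_le h, ?_, ?_⟩) (fun s h => .accept s h) (n + 1) l
    fun s _ => ?_
  · rintro (⟨_, h'⟩ | ⟨_, c, ch', h', hc, ha⟩)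
    · rw [h] at h'; cases h'
    · rw [h] at h'; cases h'
      exact ⟨c, hc, ha⟩
  · rintro ⟨c, hc, ha⟩
    exact .child s c ch h hc ha
  · have := card_le_univ s.U
    rw [Fintype.card_fin] at this
    omega

end State

/-! ### Thinness is kept in the last phase -/

section
variable {V : Type*} [DecidableEq V] {G : SimpleGraph V} {F U : Finset V}

lemma Thin.delete (T : Thin G F U) (v : V) : Thin G F (U.erase v) :=
  ⟨T.disj.mono_right (erase_subset _ _), T.forest.anti (erase_subset _ _), fun c hc =>
    (eC_mono (comp_erase_subset _ _) subset_rfl).trans (T.le_two c (mem_erase.1 hc).2)⟩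

/-- A branch of `v` has at most one edge to `v`. If it also had two edges to `F`, these would be all
edges from the component to `F`, so both neighbours of `v` on a cycle would lie in this branch,
against acyclicity of `U`. -/
lemma Thin.keep (T : Thin G F U) {v : V} (hv : v ∈ U) (hcv : Forced G ((F ∪ U).erase v) v) :
    Thin G (insert v F) (U.erase v) := by
  have hvF : v ∉ F := fun h => disjoint_left.1 T.disj h hv
  refine ⟨disjoint_insert_left.2 ⟨notMem_erase _ _, T.disj.mono_right (erase_subset _ _)⟩,
    T.forest.anti (erase_subset _ _), fun c hc => ?_⟩
  have hcU := (mem_erase.1 hc).2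
  have hsplit : ∀ X, eC G X (insert v F) = eC G X {v} + eC G X F := fun X => by
    rw [insert_eq, eC_union_right _ (disjoint_singleton_left.2 hvF)]
  by_cases hvc : Conn G U v c
  · have h1 := comp_erase_eC_singleton_le T.forest hv c
    rw [hsplit]
    by_contra hlt
    have h2 : 2 ≤ eC G (comp G (U.erase v) c) F := by omega
    obtain ⟨a, b, a', b', hab, hab', hne⟩ := eC_ge_two.1 h2
    have hsub : comp G (U.erase v) c ⊆ comp G U v := fun x hx =>
      mem_comp.2 (hvc.trans ((mem_comp.1 hx).mono (erase_subset _ _)))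
    have key : ∀ a'' b'', a'' ∈ comp G U v → b'' ∈ F → G.Adj a'' b'' →
        a'' ∈ comp G (U.erase v) c := by
      intro a'' b'' ha'' hb'' e''
      by_contra hn
      have : 3 ≤ eC G (comp G U v) F := eC_ge_three.2 ⟨a, b, a', b', a'', b'',
        ⟨hsub hab.1, hab.2⟩, ⟨hsub hab'.1, hab'.2⟩, ⟨ha'', hb'', e''⟩, hne,
        fun h => hn (h.1 ▸ hab.1), fun h => hn (h.1 ▸ hab'.1)⟩
      have := T.le_two v hv
      omega
    have hconn : ∀ x, G.Adj v x → RF G F U v x → Conn G (U.erase v) c x := by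
      intro x ex hx
      obtain ⟨a, b, ha, hb, eab, h⟩ := hx.edge hv ex
      have hac := key a b ha hb eab
      rcases h with ⟨rfl, -⟩ | h
      · exact absurd (comp_subset _ _ hac) (notMem_erase _ _)
      · exact (mem_comp.1 hac).trans h.symm
    obtain ⟨x, y, hxy, ex, ey, hc⟩ := hcv
    exact T.forest.not_conn_erase hv ex ey hxy
      ((hconn x ex (T.reaches hv ex ey hxy hc)).symm.trans
        (hconn y ey (T.reaches hv ey ex hxy.symm hc.symm)))
  · refine (eC_mono (comp_erase_subset _ _) subset_rfl).trans ?_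
    rw [hsplit, eC_comp_singleton_eq_zero hv hvc, zero_add]
    exact T.le_two c hcU

lemma MaxForest.isBase [Fintype V] {A : Finset V} (h : MaxForest G A) (hF : F ⊆ A)
    (hA : A ⊆ F ∪ U) : IsBase G F U A :=
  ⟨hF, hA, h.1, fun v _ hvA => (forced_iff h.1 hvA).2 (h.2 v hvA)⟩

lemma exists_isBase_superset {X : Finset V} (hF : F ⊆ X) (hX : X ⊆ F ∪ U) (hfX : Forest G X) :
    ∃ B, IsBase G F U B ∧ X ⊆ B := by
  have hsub := subset_greedy (G := G) (F ∪ U).toList (F ∪ U) X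
  have hfor := forest_greedy (G := G) (F ∪ U).toList (F ∪ U) X hfX
  refine ⟨greedy G (F ∪ U).toList X (F ∪ U), ⟨hF.trans hsub,
    (greedy_subset _ _ _).trans (union_subset hX subset_rfl), hfor, fun v hv hvB => ?_⟩, hsub⟩
  exact (forced_iff hfor hvB).2 (greedy_maximal _ _ _ v (mem_toList.2 hv) hv hvB)

/-- Extend `B` to a base; as all bases have the same size, nothing was added. -/
lemma Thin.isBase_of_card (T : Thin G F U) {A B : Finset V} (hA : IsBase G F U A) (hF : F ⊆ B)
    (hB : B ⊆ F ∪ U) (hfB : Forest G B) (hc : #B = #A) : IsBase G F U B := by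
  obtain ⟨C, hC, hBC⟩ := exists_isBase_superset hF hB hfB
  rwa [eq_of_subset_of_card_le hBC (by rw [hc, T.card_eq hA hC])]

end

/-! ### Following solutions through the last phase. -/

namespace State
variable {n : ℕ} {G : SimpleGraph (Fin n)} {k : ℕ} {S : Finset (Fin n)} {s t : State n}

/-- The states differ at most in their budgets. -/
structure Same (s t : State n) : Prop where
  F : s.F = t.F
  D : s.D = t.D
  D₁ : s.D₁ = t.D₁

lemma Same.U (h : Same s t) : s.U = t.U := by rw [State.U, State.U, h.F, h.D, h.D₁]
lemma Same.H₁ (h : Same s t) : s.H₁ G = t.H₁ G := by rw [State.H₁, State.H₁, h.F, h.U]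
lemma Same.H₂ (h : Same s t) : s.H₂ G = t.H₂ G := by rw [State.H₂, State.H₂, h.H₁]
lemma Same.valid (h : Same s t) : s.valid G = t.valid G := by
  rw [State.valid, State.valid, h.F, h.U]
lemma Same.needed (h : Same s t) : s.needed G = t.needed G := by
  rw [State.needed, State.needed, h.D₁, h.U, h.H₁]

lemma Same.keep (h : Same s t) (X : Finset (Fin n)) : Same (s.keep X) (t.keep X) :=
  ⟨by rw [State.keep, State.keep, h.F], h.D, h.D₁⟩
lemma Same.del (h : Same s t) (X : Finset (Fin n)) : Same (s.del X) (t.del X) :=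
  ⟨h.F, by rw [State.del, State.del, h.D], h.D₁⟩
lemma Same.del₁ (h : Same s t) (X : Finset (Fin n)) : Same (s.del₁ X) (t.del₁ X) :=
  ⟨h.F, h.D, by rw [State.del₁, State.del₁, h.D₁]⟩

/-- A maximal forest compatible with the decisions made so far. -/
structure Sol (G : SimpleGraph (Fin n)) (s : State n) (A : Finset (Fin n)) : Prop where
  max : MaxForest G A
  subset : s.F ⊆ A
  le : A ⊆ s.F ∪ s.U

lemma mem_keep {v : Fin n} : (s.keep {v}).F = insert v s.F := by
  rw [keep, insert_eq, union_comm]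

lemma Sol.keep {A : Finset (Fin n)} {v : Fin n} (h : Sol G s A) (hv : v ∈ A) :
    Sol G (s.keep {v}) A := by
  refine ⟨h.max, by rw [mem_keep]; exact insert_subset hv h.subset, fun x hx => ?_⟩
  rw [mem_keep, U_keep, mem_union, mem_insert, mem_erase]
  have := mem_union.1 (h.le hx)
  tauto

lemma Sol.of_keep {A : Finset (Fin n)} {v : Fin n} (h : Sol G (s.keep {v}) A) (hv : v ∈ s.U) :
    Sol G s A ∧ v ∈ A := by
  have h1 := h.subset
  have h2 := h.le
  rw [mem_keep] at h1
  rw [mem_keep, U_keep] at h2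
  refine ⟨⟨h.max, (subset_insert _ _).trans h1, fun x hx => ?_⟩, h1 (mem_insert_self _ _)⟩
  have := h2 hx
  rw [mem_union, mem_insert, mem_erase] at this
  rw [mem_union]
  rcases this with (rfl | h) | h
  · exact Or.inr hv
  · exact Or.inl h
  · exact Or.inr h.2

lemma Sol.del {A : Finset (Fin n)} {v : Fin n} (h : Sol G s A) (hv : v ∉ A) :
    Sol G (s.del {v}) A := by
  refine ⟨h.max, h.subset, fun x hx => ?_⟩
  rw [U_del]
  have := mem_union.1 (h.le hx)
  rw [mem_union, mem_erase]
  rcases this with h | h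
  · exact Or.inl h
  · exact Or.inr ⟨fun e => hv (e ▸ hx), h⟩

lemma Sol.of_del {A : Finset (Fin n)} {v : Fin n} (h : Sol G (s.del {v}) A) (hv : v ∈ s.U) :
    Sol G s A ∧ v ∉ A := by
  have h2 := h.le
  rw [U_del] at h2
  refine ⟨⟨h.max, h.subset, h2.trans (union_subset_union subset_rfl (erase_subset _ _))⟩,
    fun hvA => ?_⟩
  rcases mem_union.1 (h2 hvA) with h | h
  · exact (mem_U.1 hv).1 h
  · exact notMem_erase _ _ h

lemma disjoint_F_U : Disjoint s.F s.U := disjoint_left.2 fun _ h h' => (mem_U.1 h').1 h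

lemma isBase_H₁ (hF : Forest G s.F) : IsBase G s.F s.U (s.H₁ G) := by
  refine ⟨F_subset_H₁, H₁_subset, forest_H₁ hF, fun v hv hvH => ?_⟩
  have hvU : v ∈ s.U := (mem_union.1 hv).resolve_left fun h => hvH (F_subset_H₁ h)
  exact (forced_iff (forest_H₁ hF) hvH).2
    (greedy_maximal _ _ _ v (List.mem_finRange v) hvU hvH)

lemma acc_of_le (hF : Forest G s.F) (h : k ≤ #(s.H₂ G)ᶜ) (hts : Same t s) : Acc G k S t :=
  .accept t (step_eq_none (hts.F ▸ hF) (by rwa [hts.H₂]))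

lemma step_valid (hF : Forest G s.F) (hlive : ¬k ≤ #(s.H₂ G)ᶜ) (h0 : s.U ∩ S = ∅)
    (hv : (s.valid G).Nonempty) (hts : Same t s) :
    t.step G k S = some (t.branchValid (pick (s.valid G))) := by
  rw [step, hts.F, hts.H₂, hts.U, hts.valid, if_neg (not_not.2 hF), if_neg hlive, h0,
    if_neg Finset.not_nonempty_empty, if_pos hv]

lemma step_needed (hF : Forest G s.F) (hlive : ¬k ≤ #(s.H₂ G)ᶜ) (h0 : s.U ∩ S = ∅)
    (hv : s.valid G = ∅) (hn : (s.needed G).Nonempty) (hts : Same t s) :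
    t.step G k S = some [t.keep (pick (s.needed G))] := by
  rw [step, hts.F, hts.H₂, hts.U, hts.valid, hts.needed, if_neg (not_not.2 hF), if_neg hlive, h0,
    if_neg Finset.not_nonempty_empty, hv, if_neg Finset.not_nonempty_empty, if_pos hn]

lemma step_last (hF : Forest G s.F) (hlive : ¬k ≤ #(s.H₂ G)ᶜ) (h0 : s.U ∩ S = ∅)
    (hv : s.valid G = ∅) (hn : s.needed G = ∅) (hl : (s.U \ s.H₁ G).Nonempty) (hts : Same t s) :
    t.step G k S = some (t.branchLast (pick (s.U \ s.H₁ G))) := by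
  rw [step, hts.F, hts.H₂, hts.U, hts.valid, hts.needed, hts.H₁, if_neg (not_not.2 hF),
    if_neg hlive, h0, if_neg Finset.not_nonempty_empty, hv, if_neg Finset.not_nonempty_empty, hn,
    if_neg Finset.not_nonempty_empty, if_pos hl]

open Classical in
lemma valid_eq_empty (T : Thin G s.F s.U) : s.valid G = ∅ := by
  refine filter_eq_empty_iff.2 fun p _ => ?_
  rintro ⟨q, hq⟩
  have := T.le_two p hq.1
  have := hq.2.1
  omega

open Classical in
/-- In the last phase the search succeeds with a budget `#N` for kept vertices, where each vertex
of `N` can be exchanged for another one at the price of an undeleted vertex. -/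
theorem exists_last_phase {F₀ U₀ : Finset (Fin n)} (T₀ : Thin G F₀ U₀)
    (hk : ∀ B, IsBase G F₀ U₀ B → k ≤ #Bᶜ) (m : ℕ) : ∀ s : State n, #s.U = m → F₀ ⊆ s.F →
    s.F ∪ s.U ⊆ F₀ ∪ U₀ → Disjoint s.D₁ (F₀ ∪ U₀) → (∀ p ∈ s.D₁, OneLoose G F₀ U₀ p) →
    Thin G s.F s.U → s.U ∩ S = ∅ → (∃ A, Sol G s A) →
    ∃ A N, Sol G s A ∧ N ⊆ s.U ∧ N ⊆ A ∧
      (∀ y ∈ N, ∃ z ∈ F₀ ∪ U₀, z ∉ A ∧ IsBase G F₀ U₀ (insert z (A.erase y)) ∧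
        ¬MaxForest G (insert z (A.erase y)) ∧ ∀ p ∈ s.D₁, Forced G (insert z (A.erase y)) p) ∧
      ∀ t, Same t s → #N ≤ t.kap → #(s.U \ A) ≤ t.nu → Acc G k S t := by
  induction m with
  | zero => 
    intro s hm hF₀ hW hD hL T h0 ⟨A, hA⟩
    refine ⟨A, ∅, hA, by simp, by simp, by simp, fun t hts _ _ => ?_⟩
    have hF : Forest G s.F := hA.max.1.anti hA.subset
    refine acc_of_le hF ?_ hts
    have hU : s.U = ∅ := card_eq_zero.1 hm
    have hAF : A = s.F := Subset.antisymm (by simpa [hU] using hA.le) hA.subset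
    have hAH : A ⊆ s.H₂ G := by
      rw [hAF]; exact F_subset_H₁.trans H₁_subset_H₂
    have : s.H₂ G = A := by
      refine Subset.antisymm (fun v hv => ?_) hAH
      by_contra hvA
      exact hA.max.2 v hvA ((maxForest_H₂ hF).1.anti (insert_subset hv hAH))
    rw [this]
    exact hk A (hA.max.isBase (hF₀.trans hA.subset) (hA.le.trans hW))
  | succ m ih =>
    intro s hm hF₀ hW hD hL T h0 ⟨A₀, hA₀⟩
    have hF : Forest G s.F := hA₀.max.1.anti hA₀.subset
    by_cases hlive : k ≤ #(s.H₂ G)ᶜ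
    · exact ⟨A₀, ∅, hA₀, by simp, by simp, by simp, fun t hts _ _ => acc_of_le hF hlive hts⟩
    have hv := valid_eq_empty (G := G) T
    have hstat : ∀ {A}, Sol G s A → IsBase G F₀ U₀ A := fun h =>
      h.max.isBase (hF₀.trans h.subset) (h.le.trans hW)
    have hforces : ∀ {A}, Sol G s A → ∀ p ∈ s.D₁, Forced G A p := fun {A} h p hp => by
      have hpA : p ∉ A := fun hpA => disjoint_left.1 hD hp (hW (h.le hpA))
      exact (forced_iff h.max.1 hpA).2 (h.max.2 p hpA)
    have hH₁ := isBase_H₁ (G := G) (s := s) hF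
    have hH₁W : s.H₁ G ⊆ F₀ ∪ U₀ := H₁_subset.trans hW
    -- The greedy set is a base for the current state; having the size of a solution, it is also one
    -- for the state in which the phase began.
    have hH₁s : IsBase G F₀ U₀ (s.H₁ G) := T₀.isBase_of_card (hstat hA₀)
      (hF₀.trans F_subset_H₁) hH₁W (forest_H₁ hF)
      (T.card_eq hH₁ (hA₀.max.isBase hA₀.subset hA₀.le))
    have hcard : ∀ v ∈ s.U, #(s.U.erase v) = m := fun v hv => by
      rw [card_erase_of_mem hv, hm]; rfl
    have h0' : ∀ v, s.U.erase v ∩ S = ∅ := fun v => by rw [erase_inter, h0]; rfl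
    have hkeepW : ∀ v ∈ s.U, (s.keep {v}).F ∪ (s.keep {v}).U ⊆ F₀ ∪ U₀ := fun v hv => by
      rw [mem_keep, U_keep]
      refine union_subset (insert_subset (hW (mem_union_right _ hv)) (subset_union_left.trans hW)) ?_
      exact (erase_subset _ _).trans (subset_union_right.trans hW)
    have hkeepT : ∀ v ∈ s.U, v ∉ s.H₁ G → Thin G (s.keep {v}).F (s.keep {v}).U :=
      fun v hv hvH => by
        rw [mem_keep, U_keep]
        exact T.keep hv (hH₁.cyclic (mem_union_right _ hv) hvH)
    by_cases hn : (s.needed G).Nonempty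
    · obtain ⟨v, hvn, hpick⟩ := exists_pick_eq hn
      obtain ⟨⟨hvU, hvH⟩, p, hp, hpH, hpv⟩ := (mem_filter.1 hvn).2
      -- A needed vertex lies in every solution, so it is kept without branching and without budget.
      have hvall : ∀ {A}, Sol G s A → v ∈ A := fun hA =>
        T₀.mem_of_forced (hL p hp) hH₁s (hW (mem_union_right _ hvU)) hvH hpH hpv (hA.le.trans hW)
          (hforces hA p hp)
      obtain ⟨A, N, hA, hNU, hNA, hN, hacc⟩ := ih (s.keep {v}) (by rw [U_keep]; exact hcard v hvU)
        (hF₀.trans (by rw [mem_keep]; exact subset_insert _ _)) (hkeepW v hvU) hD hL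
        (hkeepT v hvU hvH) (by rw [U_keep]; exact h0' v) ⟨A₀, hA₀.keep (hvall hA₀)⟩
      obtain ⟨hA', hvA⟩ := hA.of_keep hvU
      rw [U_keep] at hNU hacc
      refine ⟨A, N, hA', hNU.trans (erase_subset _ _), hNA, hN, fun t hts hkap hnu => ?_⟩
      refine .child t _ _ (step_needed hF hlive h0 hv hn hts) (List.mem_singleton_self _) ?_
      rw [hpick]
      exact hacc _ (hts.keep _) hkap
        ((card_le_card (sdiff_subset_sdiff (erase_subset _ _) subset_rfl)).trans hnu)
    rw [not_nonempty_iff_eq_empty] at hn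
    -- Otherwise `exists_forced_insert` would produce a needed vertex.
    have hH₁D : ∀ p ∈ s.D₁, Forced G (s.H₁ G) p := by
      intro p hp
      by_contra hpH
      obtain ⟨y, hyW, hyH, hpy⟩ := T₀.exists_forced_insert (hL p hp) hH₁s hpH
        ((hforces hA₀ p hp).mono (hA₀.le.trans hW))
      have hyA := T₀.mem_of_forced (hL p hp) hH₁s hyW hyH hpH hpy (hA₀.le.trans hW)
        (hforces hA₀ p hp)
      have hyU : y ∈ s.U := (mem_union.1 (hA₀.le hyA)).resolve_left fun h => hyH (F_subset_H₁ h)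
      have : y ∈ s.needed G := mem_filter.2 ⟨mem_univ _, ⟨hyU, hyH⟩, p, hp, hpH, hpy⟩
      rw [hn] at this
      simp at this
    by_cases hl : (s.U \ s.H₁ G).Nonempty
    · obtain ⟨y, hyn, hpick⟩ := exists_pick_eq hl
      obtain ⟨hyU, hyH⟩ := mem_sdiff.1 hyn
      -- Delete `y` whenever some solution avoids it; only a vertex that lies in all solutions
      -- enters `N`.
      by_cases hy : ∃ A, Sol G s A ∧ y ∉ A
      · obtain ⟨A₁, hA₁, hyA₁⟩ := hy
        obtain ⟨A, N, hA, hNU, hNA, hN, hacc⟩ := ih (s.del {y})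
          (by rw [U_del]; exact hcard y hyU) hF₀
          (by rw [U_del]; exact (union_subset_union subset_rfl (erase_subset _ _)).trans hW) hD hL
          (by rw [U_del]; exact T.delete y) (by rw [U_del]; exact h0' y) ⟨A₁, hA₁.del hyA₁⟩
        obtain ⟨hA', hyA⟩ := hA.of_del hyU
        rw [U_del] at hNU hacc
        refine ⟨A, N, hA', hNU.trans (erase_subset _ _), hNA, hN, fun t hts hkap hnu => ?_⟩
        have hsd : #(s.U \ A) = #(s.U.erase y \ A) + 1 := by
          rw [erase_sdiff_comm, card_erase_add_one (mem_sdiff.2 ⟨hyU, hyA⟩)]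
        refine .child t { t.del {y} with nu := t.nu - 1 } _ (step_last hF hlive h0 hv hn hl hts) ?_
          (hacc _ ?_ hkap ?_)
        · rw [hpick, branchLast, if_pos (show 0 < t.nu by omega)]
          exact List.mem_append_right _ (List.mem_singleton_self _)
        · exact ⟨(hts.del {y}).F, (hts.del {y}).D, (hts.del {y}).D₁⟩
        · change _ ≤ t.nu - 1
          omega
      · push Not at hy
        obtain ⟨A, N, hA, hNU, hNA, hN, hacc⟩ := ih (s.keep {y})
          (by rw [U_keep]; exact hcard y hyU)
          (hF₀.trans (by rw [mem_keep]; exact subset_insert _ _)) (hkeepW y hyU) hD hL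
          (hkeepT y hyU hyH) (by rw [U_keep]; exact h0' y) ⟨A₀, hA₀.keep (hy A₀ hA₀)⟩
        obtain ⟨hA', hyA⟩ := hA.of_keep hyU
        rw [U_keep] at hNU hacc
        have hyN : y ∉ N := fun h => notMem_erase _ _ (hNU h)
        refine ⟨A, insert y N, hA', insert_subset hyU (hNU.trans (erase_subset _ _)),
          insert_subset hyA hNA, fun x hx => ?_, fun t hts hkap hnu => ?_⟩
        · rcases mem_insert.1 hx with rfl | hx
          -- The partner `z` is taken from the greedy base. The exchanged set is no maximal forest,
          -- since it would be a solution without `y`. It forces `D₁`, since the greedy base does so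
          -- without `y`.
          · obtain ⟨z, hzH, hzA, hbase⟩ := T₀.exchange (hstat hA') hH₁s hyA hyH
            have hxz : x ≠ z := fun h => hyH (h ▸ hzH)
            have hxn : x ∉ insert z (A.erase x) := by simp [hxz]
            refine ⟨z, hH₁W hzH, hzA, hbase, fun hmax => ?_, fun p hp => ?_⟩
            · refine hxn (hy _ ⟨hmax, fun w hw => ?_, insert_subset (H₁_subset hzH)
                ((erase_subset _ _).trans hA'.le)⟩)
              refine mem_insert_of_mem (mem_erase.2 ⟨fun h => ?_, hA'.subset hw⟩)
              exact (mem_U.1 hyU).1 (h ▸ hw)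
            · by_contra hpn
              refine hyH (T₀.mem_of_forced (hL p hp) hbase (hW (mem_union_right _ hyU)) hxn hpn
                ((hforces hA' p hp).mono ?_) hH₁W (hH₁D p hp))
              rw [insert_comm, insert_erase hyA]
              exact subset_insert _ _
          · exact hN x hx
        · rw [card_insert_of_notMem hyN] at hkap
          refine .child t { t.keep {y} with kap := t.kap - 1 } _
            (step_last hF hlive h0 hv hn hl hts) ?_ (hacc _ ?_ ?_ ?_)
          · rw [hpick, branchLast, if_pos (show 0 < t.kap by omega)]
            exact List.mem_append_left _ (List.mem_singleton_self _)
          · exact ⟨(hts.keep {y}).F, (hts.keep {y}).D, (hts.keep {y}).D₁⟩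
          · change _ ≤ t.kap - 1
            omega
          · exact (card_le_card (sdiff_subset_sdiff (erase_subset _ _) subset_rfl)).trans hnu
    · exfalso
      rw [not_nonempty_iff_eq_empty, sdiff_eq_empty_iff_subset] at hl
      -- With no undecided vertex outside the greedy base, the greedy forest is the solution `A₀`,
      -- and the state would have accepted.
      have hAH : A₀ ⊆ s.H₁ G := hA₀.le.trans (union_subset F_subset_H₁ hl)
      have hAH₂ := hAH.trans (H₁_subset_H₂ (G := G))
      have : s.H₂ G = A₀ := by
        refine Subset.antisymm (fun v hv => ?_) hAH₂
        by_contra hvA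
        exact hA₀.max.2 v hvA ((maxForest_H₂ hF).1.anti (insert_subset hv hAH₂))
      rw [this] at hlive
      exact hlive (hk A₀ (hstat hA₀))

end State

/-! ### Double counting of exchanges. -/

section
variable {V : Type*} [DecidableEq V] [Fintype V] {G : SimpleGraph V} {F U : Finset V}

lemma exists_maxForest_superset {X : Finset V} (hX : Forest G X) : ∃ H, MaxForest G H ∧ X ⊆ H := by
  refine ⟨greedy G univ.toList X univ, ⟨forest_greedy _ _ _ hX, fun v hv => ?_⟩,
    subset_greedy _ _ _⟩
  exact greedy_maximal _ _ _ v (by simp) (mem_univ v) hv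

/-- Double counting of the vertices outside `F ∪ U` that become undeleted by exchanges. -/
lemma Thin.card_mul_le (T : Thin G F U) {k e : ℕ} {A N D D₁ : Finset V} (hA : MaxForest G A)
    (hAW : A ⊆ F ∪ U) (hD : Disjoint D (F ∪ U))
    (hcov : ∀ v, v ∈ F ∪ U ∨ v ∈ D ∨ v ∈ D₁) (hAc : #Aᶜ = k + e)
    (hmin : ∀ H, MaxForest G H → #Hᶜ < k + e → #Hᶜ < k) (hNU : N ⊆ U) (hNA : N ⊆ A)
    (hN : ∀ y ∈ N, ∃ z ∈ F ∪ U, z ∉ A ∧ IsBase G F U (insert z (A.erase y)) ∧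
        ¬MaxForest G (insert z (A.erase y)) ∧ ∀ p ∈ D₁, Forced G (insert z (A.erase y)) p) :
    #N * (e + 1) ≤ 2 * #D := by
  classical
  rcases N.eq_empty_or_nonempty with rfl | ⟨y₀, hy₀⟩
  · simp
  have : Nonempty V := ⟨y₀⟩
  choose! z hzW hzA hbase hnmax hforced using hN
  let O : V → Finset V := fun y => D.filter fun w => ¬Forced G (insert (z y) (A.erase y)) w
  have hyn : ∀ y ∈ N, y ∉ insert (z y) (A.erase y) := fun y hy h => by
    rcases mem_insert.1 h with h | h
    · exact hzA y hy (h ▸ hNA hy)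
    · exact notMem_erase _ _ h
  have hcyc : ∀ y ∈ N, Forced G ((F ∪ U).erase y) y := fun y hy =>
    (hbase y hy).cyclic (hAW (hNA hy)) (hyn y hy)
  -- A maximal forest above the exchanged base has a smaller complement than `A`, hence one of size
  -- less than `k` by `hmin`. So it gains at least `e + 1` vertices, and all of them lie in `D`.
  have h1 : ∀ y ∈ N, e + 1 ≤ #(O y) := by
    intro y hy
    obtain ⟨H, hH, hsub⟩ := exists_maxForest_superset (hbase y hy).forest
    have hcard : #(insert (z y) (A.erase y)) = #A := by
      rw [card_insert_of_notMem fun h => hzA y hy (erase_subset _ _ h),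
        card_erase_add_one (hNA hy)]
    have hss : insert (z y) (A.erase y) ⊂ H :=
      hsub.ssubset_of_ne fun h => hnmax y hy (h ▸ hH)
    have hlt := card_lt_card hss
    have hHc := card_add_card_compl H
    have hAc' := card_add_card_compl A
    have hHk := hmin H hH (by omega)
    have hOsub : H \ insert (z y) (A.erase y) ⊆ O y := by
      intro w hw
      obtain ⟨hwH, hwn⟩ := mem_sdiff.1 hw
      have hnf : ¬Forced G (insert (z y) (A.erase y)) w := by
        rw [forced_iff (hbase y hy).forest hwn, not_not]
        exact hH.1.anti (insert_subset hwH hsub)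
      rcases hcov w with h | h | h
      · exact absurd ((hbase y hy).forced w h hwn) hnf
      · exact mem_filter.2 ⟨h, hnf⟩
      · exact absurd (hforced y hy w h) hnf
    have := card_le_card hOsub
    rw [card_sdiff_of_subset hsub, hcard] at this
    omega
  -- Two neighbours of `w` are connected in `A`. Exchanging `y` releases `w` only if `y` breaks one
  -- of them, and each is broken by at most one member of `N`.
  have h2 : ∀ w ∈ D, #(N.filter fun y => w ∈ O y) ≤ 2 := by
    intro w hw
    have hwA : w ∉ A := fun h => disjoint_left.1 hD hw (hAW h)
    obtain ⟨x, x', hne, ex, ex', hc⟩ := (forced_iff hA.1 hwA).2 (hA.2 w hwA)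
    have hB : ∀ x, #(N.filter fun y => Broken G F U y x) ≤ 1 := fun x => by
      rw [card_le_one]
      intro a ha b hb
      rw [mem_filter] at ha hb
      exact T.broken_unique (hNU ha.1) (hNU hb.1) (hcyc a ha.1) (hcyc b hb.1) ha.2 hb.2
    have hsub : (N.filter fun y => w ∈ O y) ⊆ (N.filter fun y => Broken G F U y x) ∪
        N.filter fun y => Broken G F U y x' := by
      intro y hy
      obtain ⟨hyN, hyO⟩ := mem_filter.1 hy
      by_contra hn
      simp only [mem_union, mem_filter, hyN, true_and, not_or] at hn
      refine (mem_filter.1 hyO).2 ⟨x, x', hne, ex, ex', ?_⟩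
      refine T.conn_of_insert (hbase y hyN).le (hNU hyN) (hyn y hyN)
        ((hbase y hyN).forced y (hAW (hNA hyN)) (hyn y hyN)) hn.1 hn.2 (hc.mono ?_)
      rw [insert_comm, insert_erase (hNA hyN)]
      exact subset_insert _ _
    have := (card_le_card hsub).trans (card_union_le _ _)
    have := hB x
    have := hB x'
    omega
  calc #N * (e + 1) = ∑ y ∈ N, (e + 1) := by rw [sum_const, smul_eq_mul]
    _ ≤ ∑ y ∈ N, #(O y) := sum_le_sum h1
    _ = ∑ y ∈ N, ∑ w ∈ D, if w ∈ O y then 1 else 0 := sum_congr rfl fun y _ => by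
        rw [← card_filter]
        congr 1
        ext w
        simp only [O, mem_filter]
        tauto
    _ = ∑ w ∈ D, #(N.filter fun y => w ∈ O y) := by
        rw [sum_comm]
        exact sum_congr rfl fun w _ => (card_filter _ _).symm
    _ ≤ ∑ w ∈ D, 2 := sum_le_sum h2
    _ = 2 * #D := by rw [sum_const, smul_eq_mul, mul_comm]

end

/-! ### Budgets spent along a solution. -/

namespace State
variable {n : ℕ} {G : SimpleGraph (Fin n)} {k e : ℕ} {S H : Finset (Fin n)} {s t : State n}

lemma card_deleted {A : Finset (Fin n)} (hF : s.F ⊆ A) (hD : Disjoint s.D A)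
    (hD₁ : Disjoint s.D₁ A) (hDD : Disjoint s.D s.D₁) : #s.D + #s.D₁ + #(s.U \ A) = #Aᶜ := by
  rw [← card_union_of_disjoint hDD, ← card_union_of_disjoint]
  · congr 1
    ext v
    rw [mem_union, mem_union, mem_sdiff, mem_compl, mem_U]
    have h1 : v ∈ s.D → v ∉ A := fun h => disjoint_left.1 hD h
    have h2 : v ∈ s.D₁ → v ∉ A := fun h => disjoint_left.1 hD₁ h
    have h3 := @hF v
    tauto
  · refine disjoint_left.2 fun v hv hv' => ?_
    have := mem_U.1 (mem_sdiff.1 hv').1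
    rcases mem_union.1 hv with h | h
    · exact this.2.1 h
    · exact this.2.2 h

/-- What the decisions on the valid vertices need: `d` and `f` vertices are deleted and kept by
branching on valid vertices, `ν` vertices are deleted and `m` are kept in the last phase. -/
def Needs (G : SimpleGraph (Fin n)) (k e : ℕ) (S : Finset (Fin n)) (s₀ d₀ f₀ : ℕ) (s : State n) :
    Prop :=
  ∃ d f ν m, d₀ ≤ d ∧ f₀ ≤ f ∧ f ≤ s₀ + ν ∧ d + f ≤ s₀ + k ∧ #s.D + d + ν = k + e ∧
    m * (e + 1) ≤ 2 * #s.D ∧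
    ∀ t, Same t s → d - d₀ ≤ t.a → f - f₀ ≤ t.f → m ≤ t.kap → ν ≤ t.nu → Acc G k S t

open Classical in
/-- The phase of branching on valid vertices. -/
theorem needs_of_earInv (hS : Forest G Sᶜ) (hH : MaxForest G H) (hHc : #Hᶜ = k + e)
    (hmin : ∀ H', MaxForest G H' → #H'ᶜ < k + e → #H'ᶜ < k) (s₀ m : ℕ) :
    ∀ (s : State n) (d f : ℕ), #s.U = m → s.F ⊆ H → Disjoint s.D H → Disjoint s.D₁ H →
      Disjoint s.D s.D₁ → #s.D₁ = d → s.U ∩ S = ∅ → EarInv G s.F s.U s₀ d f →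
      (∀ p ∈ s.D₁, OneLoose G s.F s.U p) →
      (∀ t, Same t s → Acc G k S t) ∨ Needs G k e S s₀ d f s := by
  induction m using Nat.strong_induction_on with
  | _ m ih =>
    intro s d f hm hFH hDH hD₁H hDD hd h0 hear hL
    have hF : Forest G s.F := hH.1.anti hFH
    by_cases hlive : k ≤ #(s.H₂ G)ᶜ
    · exact Or.inl fun t hts => acc_of_le hF hlive hts
    right
    have hU : Forest G s.U := hS.anti fun x hx => by
      rw [mem_compl]
      exact fun hxS => notMem_empty x (h0 ▸ mem_inter.2 ⟨hx, hxS⟩)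
    have hlt : ∀ v ∈ s.U, #(s.U.erase v) < m := fun v hv =>
      hm ▸ card_lt_card (erase_ssubset hv)
    have h0' : ∀ v, s.U.erase v ∩ S = ∅ := fun v => by rw [erase_inter, h0]; rfl
    -- Applied to the greedy forest and not to `H`: as the state does not accept, `d + f < s₀ + k`,
    -- which leaves room for one more decision.
    have hsum := hear.add_le (maxForest_H₂ hF).1 (F_subset_H₁.trans H₁_subset_H₂)
    by_cases hv : (s.valid G).Nonempty
    · obtain ⟨p, hp, hpick⟩ := exists_pick_eq hv
      obtain ⟨q, hq⟩ := (mem_filter.1 hp).2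
      have hpU := hq.1
      have hpF : p ∉ s.F := (mem_U.1 hpU).1
      by_cases hpH : p ∈ H
      · have hFc : (s.keep {p}).F ⊆ H := by rw [mem_keep]; exact insert_subset hpH hFH
        have hearc : EarInv G (s.keep {p}).F (s.keep {p}).U s₀ d (f + 1) := by
          rw [mem_keep, U_keep]; exact hear.keep hU disjoint_F_U hq
        have key := ih _ (hlt p hpU) (s.keep {p}) d (f + 1) (by rw [U_keep]) hFc hDH hD₁H hDD hd
          (by rw [U_keep]; exact h0' p) hearc
          (fun w hw => by
            rw [mem_keep, U_keep]
            exact (hL w hw).keep hpU hpF (by have := hq.2.1; omega))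
        have hacc : ∀ t, Same t s → 0 < t.f →
            Acc G k S { t.keep {p} with f := t.f - 1 } → Acc G k S t := fun t hts ht ha => by
          refine .child t _ _ (step_valid hF hlive h0 hv hts) ?_ ha
          rw [hpick, branchValid, if_pos ht]
          exact List.mem_append_right _ (List.mem_singleton_self _)
        rcases key with hall | ⟨d', f', ν, m', h1, h2, h3, h4, h5, h6, h7⟩
        -- The child accepts with any budgets. Here `ν` only records the deletions that `H` would
        -- still make, so that the equation for `k + e` holds.
        · refine ⟨d, f + 1, #((s.keep {p}).U \ H), 0, le_rfl, Nat.le_succ _,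
            hearc.kept_le hH.1 hFc subset_rfl, by omega, ?_, by omega, fun t hts _ hf _ _ => ?_⟩
          · rw [← hHc, ← card_deleted hFc hDH hD₁H hDD]
            exact congrArg (fun x => #s.D + x + _) hd.symm
          · refine hacc t hts (by omega) (hall _ ?_)
            exact ⟨(hts.keep {p}).F, (hts.keep {p}).D, (hts.keep {p}).D₁⟩
        · refine ⟨d', f', ν, m', h1, by omega, h3, h4, h5, h6, fun t hts ha hf hκ hν => ?_⟩
          refine hacc t hts (by omega) (h7 _ ?_ ha ?_ hκ hν)
          · exact ⟨(hts.keep {p}).F, (hts.keep {p}).D, (hts.keep {p}).D₁⟩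
          · change _ ≤ t.f - 1
            omega
      · have hearc : EarInv G (s.del₁ {p}).F (s.del₁ {p}).U s₀ (d + 1) f := by
          rw [U_del₁]; exact hear.delete disjoint_F_U hq
        have hD₁c : Disjoint (s.del₁ {p}).D₁ H :=
          disjoint_union_left.2 ⟨hD₁H, disjoint_singleton_left.2 hpH⟩
        have hDDc : Disjoint (s.del₁ {p}).D (s.del₁ {p}).D₁ :=
          disjoint_union_right.2 ⟨hDD, disjoint_singleton_right.2 (mem_U.1 hpU).2.1⟩
        have hdc : #(s.del₁ {p}).D₁ = d + 1 := by
          rw [del₁, card_union_of_disjoint (disjoint_singleton_right.2 (mem_U.1 hpU).2.2),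
            card_singleton, hd]
        have key := ih _ (hlt p hpU) (s.del₁ {p}) (d + 1) f (by rw [U_del₁]) hFH hDH hD₁c hDDc hdc
          (by rw [U_del₁]; exact h0' p) hearc
          (fun w hw => by
            rw [U_del₁]
            rcases mem_union.1 hw with hw | hw
            · exact (hL w hw).delete
            · rw [mem_singleton.1 hw]; exact hq.oneLoose hU)
        have hacc : ∀ t, Same t s → 0 < t.a →
            Acc G k S { t.del₁ {p} with a := t.a - 1 } → Acc G k S t := fun t hts ht ha => by
          refine .child t _ _ (step_valid hF hlive h0 hv hts) ?_ ha
          rw [hpick, branchValid, if_pos ht]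
          exact List.mem_append_left _ (List.mem_singleton_self _)
        rcases key with hall | ⟨d', f', ν, m', h1, h2, h3, h4, h5, h6, h7⟩
        · refine ⟨d + 1, f, #((s.del₁ {p}).U \ H), 0, Nat.le_succ _, le_rfl,
            hearc.kept_le hH.1 hFH subset_rfl, by omega, ?_, by omega, fun t hts ha _ _ _ => ?_⟩
          · rw [← hHc, ← card_deleted (s := s.del₁ {p}) hFH hDH hD₁c hDDc]
            exact congrArg (fun x => #s.D + x + _) hdc.symm
          · refine hacc t hts (by omega) (hall _ ?_)
            exact ⟨(hts.del₁ {p}).F, (hts.del₁ {p}).D, (hts.del₁ {p}).D₁⟩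
        · refine ⟨d', f', ν, m', by omega, h2, h3, h4, h5, h6, fun t hts ha hf hκ hν => ?_⟩
          refine hacc t hts (by omega) (h7 _ ?_ ?_ hf hκ hν)
          · exact ⟨(hts.del₁ {p}).F, (hts.del₁ {p}).D, (hts.del₁ {p}).D₁⟩
          · change _ ≤ t.a - 1
            omega
    · have T : Thin G s.F s.U := by
        refine ⟨disjoint_F_U, hU, fun c hc => ?_⟩
        by_contra hlt
        obtain ⟨p, q, hq⟩ := exists_validAt (F := s.F) hU hc (by omega)
        exact hv ⟨p, mem_filter.2 ⟨mem_univ _, q, hq⟩⟩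
      have hHW : H ⊆ s.F ∪ s.U := fun x hx => by
        rw [mem_union, mem_U]
        have h1 : x ∉ s.D := fun h => disjoint_left.1 hDH h hx
        have h2 : x ∉ s.D₁ := fun h => disjoint_left.1 hD₁H h hx
        tauto
      have hHb := hH.isBase hFH hHW
      have hcompl : ∀ B, IsBase G s.F s.U B → #Bᶜ = k + e := fun B hB => by
        rw [← hHc, card_compl, card_compl, T.card_eq hB hHb]
      have hDW : Disjoint s.D (s.F ∪ s.U) := disjoint_left.2 fun x hx hxW => by
        rcases mem_union.1 hxW with h | h
        · exact disjoint_left.1 hDH hx (hFH h)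
        · exact (mem_U.1 h).2.1 hx
      have hD₁W : Disjoint s.D₁ (s.F ∪ s.U) := disjoint_left.2 fun x hx hxW => by
        rcases mem_union.1 hxW with h | h
        · exact disjoint_left.1 hD₁H hx (hFH h)
        · exact (mem_U.1 h).2.2 hx
      -- From here on `H` is replaced by a solution `A` with a complement of the same size.
      obtain ⟨A, N, hA, hNU, hNA, hN, hacc⟩ := exists_last_phase (k := k) (S := S) T
        (fun B hB => by rw [hcompl B hB]; omega) _ s rfl subset_rfl subset_rfl hD₁W hL T h0
        ⟨H, hH, hFH, hHW⟩
      have hAb := hcompl A (hA.max.isBase hA.subset hA.le)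
      refine ⟨d, f, #(s.U \ A), #N, le_rfl, le_rfl, hear.kept_le hA.max.1 hA.subset subset_rfl,
        by omega, ?_, ?_, fun t hts _ _ hκ hν => hacc t hts hκ hν⟩
      · rw [← hAb, ← card_deleted hA.subset (hDW.mono_right hA.le) (hD₁W.mono_right hA.le) hDD, hd]
      · refine T.card_mul_le hA.max hA.le hDW (fun v => ?_) hAb hmin hNU hNA hN
        rw [mem_union, mem_U]
        tauto

/-- The phase of deciding the vertices of the initial set `S`, following the forest `H`. -/
theorem acc_of_initial (hH : MaxForest G H) (m : ℕ) : ∀ s : State n, #(s.U ∩ S) = m → s.F ⊆ H →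
    Disjoint s.D H → s.F ∪ s.D ⊆ S → s.D₁ = ∅ →
    (s.grow = false → #((s.U ∩ S) \ H) - s.eps ≤ s.a) →
    (∀ t : State n, t.F = S ∩ H → t.D = S \ H → t.D₁ = ∅ → t.f = s.f + #(s.U ∩ S ∩ H) →
      t.nu = s.nu →
      (s.grow = true → t.a = s.a + #(s.U ∩ S ∩ H) ∧ t.kap = s.kap) →
      (s.grow = false → t.a = s.a - (#((s.U ∩ S) \ H) - s.eps) ∧
        t.kap = s.kap + 2 * (#((s.U ∩ S) \ H) - s.eps)) → Acc G k S t) →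
    Acc G k S s := by
  induction m with
  | zero =>
    intro s hm hFH hDH hS hD₁ _ hacc
    have h0 : s.U ∩ S = ∅ := card_eq_zero.1 hm
    have hmem : ∀ v ∈ S, v ∈ s.F ∨ v ∈ s.D := fun v hv => by
      by_contra hn
      rw [not_or] at hn
      have : v ∈ s.U ∩ S := mem_inter.2 ⟨mem_U.2 ⟨hn.1, hn.2, by simp [hD₁]⟩, hv⟩
      simp [h0] at this
    refine hacc s ?_ ?_ hD₁ (by simp [h0]) rfl (by simp [h0]) (by simp [h0])
    · ext v
      rw [mem_inter]
      refine ⟨fun h => ⟨hS (mem_union_left _ h), hFH h⟩, fun h => ?_⟩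
      exact (hmem v h.1).resolve_right fun hD => disjoint_left.1 hDH hD h.2
    · ext v
      rw [mem_sdiff]
      refine ⟨fun h => ⟨hS (mem_union_right _ h), disjoint_left.1 hDH h⟩, fun h => ?_⟩
      exact (hmem v h.1).resolve_left fun hF => h.2 (hFH hF)
  | succ m ih =>
    intro s hm hFH hDH hS hD₁ ha hacc
    have hF : Forest G s.F := hH.1.anti hFH
    by_cases hlive : k ≤ #(s.H₂ G)ᶜ
    · exact acc_of_le hF hlive ⟨rfl, rfl, rfl⟩
    have hne : (s.U ∩ S).Nonempty := card_pos.1 (by omega)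
    obtain ⟨v, hv, hpick⟩ := exists_pick_eq hne
    have hstep : s.step G k S = some (s.branchInit {v}) := by
      rw [step, if_neg (not_not.2 hF), if_neg hlive, if_pos hne, hpick]
    obtain ⟨hvU, hvS⟩ := mem_inter.1 hv
    have hcard : #((s.U.erase v) ∩ S) = m := by
      rw [erase_inter, card_erase_of_mem hv, hm]; rfl
    by_cases hvH : v ∈ H
    · have e1 : s.U.erase v ∩ S ∩ H = (s.U ∩ S ∩ H).erase v := by
        rw [erase_inter, erase_inter]
      have e2 : (s.U.erase v ∩ S) \ H = (s.U ∩ S) \ H := by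
        rw [erase_inter, erase_sdiff_comm, erase_eq_of_notMem]
        simp [hvH]
      have c1 : #(s.U.erase v ∩ S ∩ H) + 1 = #(s.U ∩ S ∩ H) := by
        rw [e1, card_erase_add_one (mem_inter.2 ⟨hv, hvH⟩)]
      set c : State n := { s.keep {v} with f := s.f + 1, a := if s.grow then s.a + 1 else s.a }
        with hc
      have hcU : c.U = s.U.erase v := U_keep v
      have hcF : c.F = insert v s.F := mem_keep
      refine .child s c _ hstep (List.mem_append_left _ (List.mem_singleton_self _)) ?_
      refine ih c (by rw [hcU, hcard]) (by rw [hcF]; exact insert_subset hvH hFH) hDH ?_ hD₁ ?_ ?_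
      · rw [hcF, insert_union]
        exact insert_subset hvS hS
      · intro hg
        have hg' : s.grow = false := hg
        rw [hcU, e2]
        simpa [hc, hg', keep] using ha hg'
      · intro t h1 h2 h3 h4 h5 h6 h7
        refine hacc t h1 h2 h3 ?_ h5 (fun hg => ?_) fun hg => ?_
        · rw [hcU] at h4
          have : c.f = s.f + 1 := rfl
          omega
        · obtain ⟨h8, h9⟩ := h6 hg
          rw [hcU] at h8
          have : c.a = s.a + 1 := by simp [hc, hg]
          exact ⟨by omega, h9⟩
        · have h8 := h7 hg
          rw [hcU, e2] at h8
          have : c.a = s.a := by simp [hc, hg]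
          rw [this] at h8
          exact h8
    · have e1 : s.U.erase v ∩ S ∩ H = s.U ∩ S ∩ H := by
        rw [erase_inter, erase_inter, erase_eq_of_notMem]
        simp [hvH]
      have c2 : #((s.U.erase v ∩ S) \ H) + 1 = #((s.U ∩ S) \ H) := by
        rw [erase_inter, erase_sdiff_comm, card_erase_add_one (mem_sdiff.2 ⟨hv, hvH⟩)]
      have hDc : Disjoint (s.D ∪ {v}) H :=
        disjoint_union_left.2 ⟨hDH, disjoint_singleton_left.2 hvH⟩
      have hSc : s.F ∪ (s.D ∪ {v}) ⊆ S := by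
        rw [← union_assoc]
        exact union_subset hS (singleton_subset_iff.2 hvS)
      by_cases hcond : s.grow = true ∨ 0 < s.eps
      · set c : State n := { s.del {v} with eps := s.eps - 1 } with hc
        have hcU : c.U = s.U.erase v := U_del v
        refine .child s c _ hstep ?_ ?_
        · rw [branchInit, if_pos hcond]
          exact List.mem_append_right _ (List.mem_singleton_self _)
        refine ih c (by rw [hcU, hcard]) hFH hDc hSc hD₁ ?_ ?_
        · intro hg
          have hg' : s.grow = false := hg
          have h8 := ha hg'
          have he : 0 < s.eps := by simpa [hg'] using hcond
          rw [hcU]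
          change _ - (s.eps - 1) ≤ s.a
          omega
        · intro t h1 h2 h3 h4 h5 h6 h7
          refine hacc t h1 h2 h3 ?_ h5 (fun hg => ?_) fun hg => ?_
          · rw [hcU, e1] at h4; exact h4
          · have h8 := h6 hg
            rw [hcU, e1] at h8; exact h8
          · have h8 := h7 hg
            have he : 0 < s.eps := by simpa [hg] using hcond
            rw [hcU] at h8
            change t.a = s.a - (_ - (s.eps - 1)) ∧ t.kap = s.kap + 2 * (_ - (s.eps - 1)) at h8
            omega
      · rw [not_or] at hcond
        have hg : s.grow = false := by simpa using hcond.1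
        have he : s.eps = 0 := by omega
        have h8 := ha hg
        set c : State n := { s.del {v} with a := s.a - 1, kap := s.kap + 1 + 1 } with hc
        have hcU : c.U = s.U.erase v := U_del v
        refine .child s c _ hstep ?_ ?_
        · rw [branchInit, if_neg (show ¬(s.grow = true ∨ 0 < s.eps) from not_or.2 hcond),
            if_pos (show 0 < s.a by omega)]
          exact List.mem_append_right _ (List.mem_singleton_self _)
        refine ih c (by rw [hcU, hcard]) hFH hDc hSc hD₁ ?_ ?_
        · intro _
          rw [hcU]
          change _ - s.eps ≤ s.a - 1
          omega
        · intro t h1 h2 h3 h4 h5 h6 h7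
          refine hacc t h1 h2 h3 ?_ h5 (fun hg' => ?_) fun _ => ?_
          · rw [hcU, e1] at h4; exact h4
          · rw [hg] at hg'; cases hg'
          · have h9 := h7 hg
            rw [hcU] at h9
            change t.a = s.a - 1 - (_ - s.eps) ∧ t.kap = s.kap + 1 + 1 + 2 * (_ - s.eps) at h9
            omega

end State

/-! ### The initial states -/

section
variable {σ : Type*} {n : ℕ}

/-- Push `f i` on the list `l`, for the indices `i` with `c i`. -/
def pushAll (c : Fin n → Prop) [DecidablePred c] (f : Fin n → σ) (l : List σ) : List σ :=
  (List.finRange n).foldl (fun l i => if c i then f i :: l else l) l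

lemma mem_pushAll (c : Fin n → Prop) [DecidablePred c] (f : Fin n → σ) (l : List σ) (s : σ) :
    s ∈ pushAll c f l ↔ s ∈ l ∨ ∃ i, c i ∧ f i = s := by
  have key : ∀ (L : List (Fin n)) (l : List σ),
      s ∈ L.foldl (fun l i => if c i then f i :: l else l) l ↔ s ∈ l ∨ ∃ i ∈ L, c i ∧ f i = s := by
    intro L
    induction L with
    | nil => simp
    | cons i L ih =>
      intro l
      rw [List.foldl_cons, ih]
      split_ifs with h
      · simp only [List.mem_cons]; grind
      · simp only [List.mem_cons]; grind
  rw [pushAll, key]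
  simp

lemma foldl_length_le {m : ℕ} (g : List σ → Fin n → List σ)
    (hg : ∀ l i, (g l i).length ≤ l.length + m) (l : List σ) :
    ((List.finRange n).foldl g l).length ≤ l.length + n * m := by
  have key : ∀ (L : List (Fin n)) (l : List σ), (L.foldl g l).length ≤ l.length + L.length * m := by
    intro L
    induction L with
    | nil => simp
    | cons i L ih =>
      intro l
      have h1 := ih (g l i)
      have h2 := hg l i
      rw [List.foldl_cons, List.length_cons, add_mul]
      omega
  simpa using key (List.finRange n) l

lemma length_pushAll_le (c : Fin n → Prop) [DecidablePred c] (f : Fin n → σ) (l : List σ) :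
    (pushAll c f l).length ≤ l.length + n := by
  have := foldl_length_le (m := 1) (fun l i => if c i then f i :: l else l)
    (fun l i => by split_ifs <;> simp) l
  simpa [pushAll] using this

end

namespace State
variable {n : ℕ} {G : SimpleGraph (Fin n)} {k e : ℕ} {S H : Finset (Fin n)} {s t : State n}

/-- The initial state with the budget `a`, which grows with the kept vertices of `S`. -/
def initGrow (n k a : ℕ) : State n := ⟨true, ∅, ∅, ∅, 0, a, k - a, 1, n⟩

/-- The initial state with `e` free deletions and `ν` deletions in the last phase. -/
def initFixed (n k e ν : ℕ) : State n := ⟨false, ∅, ∅, ∅, e, k - ν, ν, 0, ν⟩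

/-- The initial states of the search. -/
def init (n k : ℕ) : List (State n) :=
  -- For `k > n` the answer is no. Otherwise the vertices, the only range of the loops, suffice to
  -- enumerate the parameters; the budget 0 is listed apart because a vertex `i` stands for the
  -- budget `i + 1`.
  if k ≤ n then
    initGrow n k 0 :: (List.finRange n).foldl
      (fun l (e : Fin n) => pushAll (fun ν : Fin n => (ν : ℕ) ≤ k) (fun ν => initFixed n k e ν) l)
      (pushAll (fun i : Fin n => (i : ℕ) + 1 ≤ k) (fun i => initGrow n k (i + 1)) [])
  else []

lemma mem_init : s ∈ init n k ↔ k ≤ n ∧ ((∃ a ≤ k, initGrow n k a = s) ∨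
    ∃ e < n, ∃ ν < n, ν ≤ k ∧ initFixed n k e ν = s) := by
  rw [init]
  split_ifs with hk
  · have key : ∀ (L : List (Fin n)) (l : List (State n)),
        s ∈ L.foldl (fun l (e : Fin n) =>
          pushAll (fun ν : Fin n => (ν : ℕ) ≤ k) (fun ν => initFixed n k e ν) l) l ↔
        s ∈ l ∨ ∃ e ∈ L, ∃ ν : Fin n, (ν : ℕ) ≤ k ∧ initFixed n k e ν = s := by
      intro L
      induction L with
      | nil => simp
      | cons i L ih =>
        intro l
        rw [List.foldl_cons, ih, mem_pushAll]
        simp only [List.mem_cons]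
        grind
    rw [List.mem_cons, key, mem_pushAll]
    simp only [List.not_mem_nil, false_or, List.mem_finRange, true_and, hk]
    constructor
    · rintro (rfl | ⟨i, hi, rfl⟩ | ⟨e, ν, hν, rfl⟩)
      · exact .inl ⟨0, Nat.zero_le _, rfl⟩
      · exact .inl ⟨_, hi, rfl⟩
      · exact .inr ⟨e, e.2, ν, ν.2, hν, rfl⟩
    · rintro (⟨_ | a, ha, rfl⟩ | ⟨e, he, ν, hν, hk', rfl⟩)
      · exact .inl rfl
      · exact .inr (.inl ⟨⟨a, by omega⟩, ha, rfl⟩)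
      · exact .inr (.inr ⟨⟨e, he⟩, ⟨ν, hν⟩, hk', rfl⟩)
  · simp [hk]

lemma length_init_le (n k : ℕ) : (init n k).length ≤ (n + 1) ^ 2 := by
  rw [init]
  split_ifs
  · have h1 := length_pushAll_le (fun i : Fin n => (i : ℕ) + 1 ≤ k) (fun i => initGrow n k (i + 1)) []
    have h2 := foldl_length_le (m := n)
      (fun l (e : Fin n) => pushAll (fun ν : Fin n => (ν : ℕ) ≤ k) (fun ν => initFixed n k e ν) l)
      (fun l e => length_pushAll_le _ _ _)
      (pushAll (fun i : Fin n => (i : ℕ) + 1 ≤ k) (fun i => initGrow n k (i + 1)) [])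
    rw [List.length_cons]
    simp only [List.length_nil] at h1
    nlinarith
  · simp

/-- The search finds a large minimal feedback vertex set if there is one. -/
theorem exists_acc_init (hS : Forest G Sᶜ) (hex : ∃ H, MaxForest G H ∧ k ≤ #Hᶜ) :
    ∃ s ∈ init n k, Acc G k S s := by
  classical
  -- With `e` minimal, no maximal forest has a complement of size from `k` to `k + e - 1`.
  have hex' : ∃ e, ∃ H, MaxForest G H ∧ #Hᶜ = k + e := by
    obtain ⟨H, hH, hk⟩ := hex
    exact ⟨#Hᶜ - k, H, hH, by omega⟩
  obtain ⟨H, hH, hHc⟩ := Nat.find_spec hex'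
  have hmin' := fun m => Nat.find_min hex' (m := m)
  set e := Nat.find hex'
  have hmin : ∀ H', MaxForest G H' → #H'ᶜ < k + e → #H'ᶜ < k := fun H' hH' hlt => by
    by_contra hn
    exact hmin' (#H'ᶜ - k) (by omega) ⟨H', hH', by omega⟩
  have hn : k + e ≤ n := by
    rw [← hHc]
    simpa using card_le_univ Hᶜ
  have hin : #(S \ H) ≤ n := by simpa using card_le_univ (S \ H)
  -- The decisions after the first phase. The budgets in `s₁` are irrelevant, as `Needs` quantifies
  -- over all states with the same decisions.
  let s₁ : State n := { initGrow n k 0 with F := S ∩ H, D := S \ H }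
  have hneeds := needs_of_earInv hS hH hHc hmin #(S ∩ H) _ s₁ 0 0 rfl inter_subset_right
    sdiff_disjoint (disjoint_empty_left _) (disjoint_empty_right _) card_empty
    (by
      ext v
      simp only [s₁, mem_inter, mem_U, mem_sdiff, initGrow]
      simp only [notMem_empty, not_false_eq_true, and_true, iff_false]
      tauto)
    (earInv_init _ _) (fun p hp => absurd hp (notMem_empty p))
  have hU : ∀ s : State n, s.F = ∅ → s.D = ∅ → s.D₁ = ∅ → s.U ∩ S = S := fun s h1 h2 h3 => by
    rw [U, h1, h2, h3]; simp
  have hgrow : ∀ a, (∀ t, Same t s₁ → t.f = k - a + #(S ∩ H) → t.nu = n → t.a = a + #(S ∩ H) →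
      t.kap = 1 → Acc G k S t) → Acc G k S (initGrow n k a) := fun a h => by
    have hUS := hU (initGrow n k a) rfl rfl rfl
    refine acc_of_initial hH _ _ rfl (empty_subset _) (disjoint_empty_left _) (by simp [initGrow])
      rfl (fun h => by simp [initGrow] at h) fun t h1 h2 h3 h4 h5 h6 _ => ?_
    rw [hUS] at h4 h6
    exact h t ⟨h1, h2, h3⟩ h4 h5 (h6 rfl).1 (h6 rfl).2
  rcases hneeds with hall | ⟨d, f, ν, m, -, -, h3, h4, h5, h6, h7⟩
  · exact ⟨_, mem_init.2 ⟨by omega, .inl ⟨0, Nat.zero_le _, rfl⟩⟩,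
      hgrow 0 fun t hts _ _ _ _ => hall t hts⟩
  change #(S \ H) + d + ν = k + e at h5
  change m * (e + 1) ≤ 2 * #(S \ H) at h6
  by_cases hm : m ≤ 1
  -- Both budgets grow by `#(S ∩ H)` in the first phase. So the one for deletions reaches `d`, and
  -- the other one reaches `f` because `d + f ≤ #(S ∩ H) + k`.
  · refine ⟨_, mem_init.2 ⟨by omega, .inl ⟨d - #(S ∩ H), by omega, rfl⟩⟩,
      hgrow _ fun t hts e1 e2 e3 e4 => h7 t hts ?_ ?_ ?_ ?_⟩ <;> omega
  · have hei : e + 1 ≤ #(S \ H) := by nlinarith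
    obtain ⟨j, hj⟩ : ∃ j, #(S \ H) = e + j := ⟨#(S \ H) - e, by omega⟩
    have hmj : m ≤ 2 * j := by
      rw [hj] at h6
      have hj1 : 1 ≤ j := by omega
      by_contra hlt
      nlinarith
    -- Here `k - ν = d + j`. After `e` free deletions in `S`, the other `j` take one unit each from
    -- this budget and leave `d`, while they add `2 * j ≥ m` units for the last phase. The budget
    -- for kept valid vertices becomes `ν + #(S ∩ H) ≥ f`.
    refine ⟨_, mem_init.2 ⟨by omega, .inr ⟨e, by omega, ν, by omega, by omega, rfl⟩⟩, ?_⟩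
    have hUS := hU (initFixed n k e ν) rfl rfl rfl
    refine acc_of_initial hH _ _ rfl (empty_subset _) (disjoint_empty_left _)
      (by simp [initFixed]) rfl (fun _ => ?_) fun t t1 t2 t3 t4 t5 _ t6 => ?_
    · rw [hUS]
      change #(S \ H) - e ≤ k - ν
      omega
    · rw [hUS] at t4 t6
      obtain ⟨t6, t7⟩ := t6 rfl
      change t.f = ν + _ at t4
      change t.nu = ν at t5
      change t.a = k - ν - (_ - e) at t6
      change t.kap = 0 + 2 * (_ - e) at t7
      refine h7 t ⟨t1, t2, t3⟩ ?_ ?_ ?_ ?_ <;> omega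

/-- With `grow` the two budgets add up to `k` and the binomial coefficient is `n + 1`. Without it,
`(3 / 2) ^ ν * 2 ^ ν = 3 ^ ν` makes the bound independent of `ν`. -/
lemma pot_init_le (hS : #S ≤ k) (hs : s ∈ init n k) : s.pot S ≤ 10 ^ k * (n + 1 : ℕ) := by
  have hU : ∀ s : State n, s.F = ∅ → s.D = ∅ → s.D₁ = ∅ → s.U ∩ S = S := fun s h1 h2 h3 => by
    rw [U, h1, h2, h3]; simp
  obtain ⟨hk, ⟨a, ha, rfl⟩ | ⟨e, he, ν, hν, hνk, rfl⟩⟩ := mem_init.1 hs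
  · rw [pot_of_grow rfl, hU _ rfl rfl rfl]
    simp only [initGrow]
    rw [Nat.add_sub_cancel' ha, Nat.choose_one_right, add_comm 1 n]
    gcongr
    calc (5 : ℝ) ^ #S * 2 ^ k ≤ 5 ^ k * 2 ^ k := by gcongr; norm_num
      _ = 10 ^ k := by rw [← mul_pow]; norm_num
  · rw [pot_of_not_grow rfl, hU _ rfl rfl rfl]
    simp only [initFixed]
    calc ((17 : ℝ) / 6) ^ #S * 3 ^ (k - ν) * (3 / 2) ^ ν * 2 ^ (ν + 0)
        = (17 / 6) ^ #S * (3 ^ (k - ν) * 3 ^ ν) := by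
          rw [show (3 : ℝ) ^ ν = (3 / 2) ^ ν * 2 ^ ν by rw [← mul_pow]; norm_num, add_zero]; ring
      _ = (17 / 6) ^ #S * 3 ^ k := by rw [← pow_add, Nat.sub_add_cancel hνk]
      _ ≤ (17 / 6) ^ k * 3 ^ k := by gcongr; norm_num
      _ = (17 / 2) ^ k := by rw [← mul_pow]; norm_num
      _ ≤ 10 ^ k := by gcongr; norm_num
      _ = 10 ^ k * 1 := (mul_one _).symm
      _ ≤ 10 ^ k * (n + 1 : ℕ) := by gcongr; simp

/-- The complement of a maximal induced forest: the initial feedback vertex set. -/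
noncomputable def initSet (G : SimpleGraph (Fin n)) : Finset (Fin n) :=
  (greedy G (List.finRange n) ∅ univ)ᶜ

/-- The search decides the problem, and its tree is small. -/
theorem exists_run_init (G : SimpleGraph (Fin n)) (k : ℕ) : ∃ b N,
    Run (step G k (initSet G)) (init n k) b N ∧ N ≤ 10 ^ k * (n + 1) ^ 4 ∧
      (b = true ↔ ∃ H, MaxForest G H ∧ k ≤ #Hᶜ) := by
  have hmax : MaxForest G (greedy G (List.finRange n) ∅ univ) :=
    ⟨forest_greedy _ _ _ forest_empty, fun v hv =>
      greedy_maximal _ _ _ v (List.mem_finRange v) (mem_univ v) hv⟩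
  -- In this case the first state of the stack accepts at once; otherwise `#(initSet G) ≤ k`, as the
  -- bound on the potential requires.
  by_cases hk : k ≤ #(initSet G)
  · have hkn : k ≤ n := hk.trans (by simpa using card_le_univ (initSet G))
    refine ⟨true, 1, ?_, ?_, iff_of_true rfl ⟨_, hmax, hk⟩⟩
    · rw [init, if_pos hkn]
      refine .accept _ _ (step_eq_none forest_empty ?_)
      have h1 : (initGrow n k 0).H₁ G = greedy G (List.finRange n) ∅ univ := by
        rw [H₁, U]; simp [initGrow]
      have h2 : (initGrow n k 0).H₁ G = (initGrow n k 0).H₂ G := by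
        refine Subset.antisymm H₁_subset_H₂ fun v hv => ?_
        by_contra hn
        rw [h1] at hn
        refine hmax.2 v hn ((maxForest_H₂ (s := initGrow n k 0) forest_empty).1.anti ?_)
        exact insert_subset hv (h1 ▸ H₁_subset_H₂)
      rw [← h2, h1]
      exact hk
    · exact Nat.one_le_iff_ne_zero.2 (by positivity)
  · obtain ⟨b, N, hrun, hN, hb⟩ := exists_run_states G k (initSet G) (init n k)
    refine ⟨b, N, hrun, ?_, hb.trans ⟨fun ⟨s, _, hs⟩ => hs.sound, fun h => ?_⟩⟩
    · have hsum : ((init n k).map (pot (initSet G))).sum ≤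
          (init n k).length • ((10 : ℝ) ^ k * (n + 1 : ℕ)) := by
        rw [← List.length_map (pot (initSet G))]
        refine List.sum_le_card_nsmul _ _ fun x hx => ?_
        obtain ⟨s, hs, rfl⟩ := List.mem_map.1 hx
        exact pot_init_le (by omega) hs
      have hlen : ((init n k).length : ℝ) ≤ (n + 1 : ℕ) ^ 2 := by
        exact_mod_cast length_init_le n k
      have : (N : ℝ) ≤ 10 ^ k * (n + 1 : ℕ) ^ 4 :=
        calc (N : ℝ) ≤ (n + 1 : ℕ) * ((init n k).length • ((10 : ℝ) ^ k * (n + 1 : ℕ))) :=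
              hN.trans (by gcongr)
          _ = (n + 1 : ℕ) * ((init n k).length * ((10 : ℝ) ^ k * (n + 1 : ℕ))) := by
              rw [nsmul_eq_mul]
          _ ≤ (n + 1 : ℕ) * ((n + 1 : ℕ) ^ 2 * ((10 : ℝ) ^ k * (n + 1 : ℕ))) := by gcongr
          _ = 10 ^ k * (n + 1 : ℕ) ^ 4 := by ring
      exact_mod_cast this
    · exact exists_acc_init (by rw [initSet, compl_compl]; exact hmax.1) h

end State

/-! ### The search is computed by terms -/

section
variable {α : Type} {n : α → ℕ} {env : α → List Data}

lemma Comp.ite_enc {β : α → Type} (enc : ∀ a, β a → Data) {p : α → Prop} [∀ a, Decidable (p a)]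
    {f g : ∀ a, β a} (hp : CompP n env p) (hf : Comp n env fun a => enc a (f a))
    (hg : Comp n env fun a => enc a (g a)) :
    Comp n env fun a => enc a (if p a then f a else g a) :=
  (Comp.ite hp hf hg).congr fun a => by split_ifs <;> rfl

/-! #### Sets -/

variable {s t : ∀ a, Finset (Fin (n a))} {v w : ∀ a, Fin (n a)}

lemma CompS.union (hs : CompS n env s) (ht : CompS n env t) : CompS n env fun a => s a ∪ t a :=
  (CompS.filter (P := fun a i => i ∈ s a ∨ i ∈ t a)
    ((CompP.mem CompV.zero hs.wkV).or (CompP.mem CompV.zero ht.wkV))).congr fun a => by ext; simp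

lemma CompS.inter (hs : CompS n env s) (ht : CompS n env t) : CompS n env fun a => s a ∩ t a :=
  (CompS.filter (P := fun a i => i ∈ s a ∧ i ∈ t a)
    ((CompP.mem CompV.zero hs.wkV).and (CompP.mem CompV.zero ht.wkV))).congr fun a => by ext; simp

lemma CompS.compl (hs : CompS n env s) : CompS n env fun a => (s a)ᶜ :=
  (CompS.filter (P := fun a i => i ∉ s a) (CompP.mem CompV.zero hs.wkV).not).congr
    fun a => by ext; simp

lemma CompS.sdiff (hs : CompS n env s) (ht : CompS n env t) : CompS n env fun a => s a \ t a :=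
  (hs.inter ht.compl).congr fun a => by ext; simp

lemma CompS.singleton (hv : CompV n env v) : CompS n env fun a => {v a} :=
  (CompS.filter (P := fun a i => i = v a) (CompV.eq CompV.zero hv.wkV)).congr
    fun a => by ext; simp

lemma CompS.insert (hv : CompV n env v) (hs : CompS n env s) :
    CompS n env fun a => insert (v a) (s a) :=
  ((CompS.singleton hv).union hs).congr fun a => by ext; simp

lemma CompS.erase (hv : CompV n env v) (hs : CompS n env s) :
    CompS n env fun a => (s a).erase (v a) :=
  (hs.sdiff (CompS.singleton hv)).congr fun a => by ext; simp [and_comm]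

lemma CompP.true : CompP n env fun _ => True :=
  (Comp.nil.cons Comp.nil).congr fun _ => (Data.ofProp_true trivial).symm

lemma CompS.univ : CompS n env fun _ => Finset.univ :=
  (CompS.filter (P := fun _ _ => True) CompP.true).congr fun a => by ext; simp

lemma CompS.empty : CompS n env fun _ => ∅ := CompS.univ.compl.congr fun a => by simp

lemma CompS.nonempty (hs : CompS n env s) : CompP n env fun a => (s a).Nonempty :=
  CompP.exists (P := fun a i => i ∈ s a) (CompP.mem CompV.zero hs.wkV)

lemma CompS.pick (hs : CompS n env s) : CompS n env fun a => pick (s a) := by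
  classical
  refine (CompS.filter (P := fun a i => i ∈ s a ∧ ∀ w, w ∈ s a → i ≤ w)
    ((CompP.mem CompV.zero hs.wkV).and (CompP.forall (CompP.imp
      (CompP.mem (Comp.var 0 fun _ => rfl) hs.wkV.wkV)
      (CompV.le (Comp.var 1 fun _ => rfl) (Comp.var 0 fun _ => rfl)))))).congr fun a => ?_
  ext v
  simp [MaxMinFVS.pick]

/-! #### Forests and components -/

variable {G : ∀ a, SimpleGraph (Fin (n a))}

lemma CompP.edge (hG : Comp n env fun a => encodeGraph (G a)) (hs : CompS n env s)
    (ht : CompS n env t) (hv : CompV n env v) (hw : CompV n env w) :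
    CompP n env fun a => v a ∈ s a ∧ w a ∈ t a ∧ (G a).Adj (v a) (w a) :=
  (CompP.mem hv hs).and ((CompP.mem hw ht).and (CompP.adj hG hv hw))

lemma CompP.two_le_eC (hG : Comp n env fun a => encodeGraph (G a)) (hs : CompS n env s)
    (ht : CompS n env t) : CompP n env fun a => 2 ≤ eC (G a) (s a) (t a) := by
  refine CompP.congr ?_ fun a => eC_ge_two.symm
  refine CompP.exists (CompP.exists (CompP.exists (CompP.exists ?_)))
  have hG := hG.wkV.wkV.wkV.wkV
  have hs := hs.wkV.wkV.wkV.wkV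
  have ht := ht.wkV.wkV.wkV.wkV
  exact CompP.and (CompP.edge hG hs ht (Comp.var 3 fun _ => rfl) (Comp.var 2 fun _ => rfl))
    (CompP.and (CompP.edge hG hs ht (Comp.var 1 fun _ => rfl) (Comp.var 0 fun _ => rfl))
    (CompP.not (CompP.and (CompV.eq (Comp.var 3 fun _ => rfl) (Comp.var 1 fun _ => rfl))
      (CompV.eq (Comp.var 2 fun _ => rfl) (Comp.var 0 fun _ => rfl)))))

lemma CompP.three_le_eC (hG : Comp n env fun a => encodeGraph (G a)) (hs : CompS n env s)
    (ht : CompS n env t) : CompP n env fun a => 3 ≤ eC (G a) (s a) (t a) := by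
  refine CompP.congr ?_ fun a => eC_ge_three.symm
  refine CompP.exists (CompP.exists (CompP.exists (CompP.exists (CompP.exists (CompP.exists ?_)))))
  have hG := hG.wkV.wkV.wkV.wkV.wkV.wkV
  have hs := hs.wkV.wkV.wkV.wkV.wkV.wkV
  have ht := ht.wkV.wkV.wkV.wkV.wkV.wkV
  refine CompP.and (CompP.edge hG hs ht (Comp.var 5 fun _ => rfl) (Comp.var 4 fun _ => rfl))
    (CompP.and (CompP.edge hG hs ht (Comp.var 3 fun _ => rfl) (Comp.var 2 fun _ => rfl))
    (CompP.and (CompP.edge hG hs ht (Comp.var 1 fun _ => rfl) (Comp.var 0 fun _ => rfl))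
    (CompP.and (CompP.not (CompP.and ?_ ?_)) (CompP.and (CompP.not (CompP.and ?_ ?_))
      (CompP.not (CompP.and ?_ ?_))))))
  · exact CompV.eq (Comp.var 5 fun _ => rfl) (Comp.var 3 fun _ => rfl)
  · exact CompV.eq (Comp.var 4 fun _ => rfl) (Comp.var 2 fun _ => rfl)
  · exact CompV.eq (Comp.var 5 fun _ => rfl) (Comp.var 1 fun _ => rfl)
  · exact CompV.eq (Comp.var 4 fun _ => rfl) (Comp.var 0 fun _ => rfl)
  · exact CompV.eq (Comp.var 3 fun _ => rfl) (Comp.var 1 fun _ => rfl)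
  · exact CompV.eq (Comp.var 2 fun _ => rfl) (Comp.var 0 fun _ => rfl)

lemma CompS.peel (hG : Comp n env fun a => encodeGraph (G a)) (hs : CompS n env s) :
    CompS n env fun a => peel (G a) (s a) := by
  classical
  refine (CompS.filter (P := fun a i => i ∈ s a ∧ 2 ≤ eC (G a) {i} (s a))
    ((CompP.mem CompV.zero hs.wkV).and (CompP.two_le_eC hG.wkV (CompS.singleton CompV.zero)
      hs.wkV))).congr fun a => ?_
  ext v
  simp [MaxMinFVS.peel]

lemma CompP.forest (hG : Comp n env fun a => encodeGraph (G a)) (hs : CompS n env s) :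
    CompP n env fun a => Forest (G a) (s a) := by
  have h := Comp.iterate (n := n) (env := env) (β := fun a => Finset (Fin (n a)))
    (fun _ => Data.ofSet) (init := s) (F := fun a => MaxMinFVS.peel (G a)) hs
    (CompS.peel hG.wkS CompS.zero)
  refine (CompS.nonempty h).not.congr fun a => ?_
  rw [forest_iff_iterate_peel (N := n a) (by simpa using card_le_univ (s a)),
    not_nonempty_iff_eq_empty]

lemma CompS.comp (hG : Comp n env fun a => encodeGraph (G a)) (hs : CompS n env s)
    (hv : CompV n env v) : CompS n env fun a => comp (G a) (s a) (v a) := by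
  classical
  have h := Comp.iterate (n := n) (env := env) (β := fun a => Finset (Fin (n a)))
    (fun _ => Data.ofSet) (init := fun a => {v a}) (F := fun a => expand (G a) (s a))
    (CompS.singleton hv) (by
      refine (CompS.filter (α := Σ a, Finset (Fin (n a)))
        (P := fun x i => i ∈ s x.1 ∧ (i ∈ x.2 ∨ ∃ u, u ∈ x.2 ∧ (G x.1).Adj u i))
        (CompP.and (CompP.mem CompV.zero hs.wkS.wkV) (CompP.or (CompP.mem CompV.zero CompS.zero.wkV)
          (CompP.exists (CompP.and (CompP.mem (Comp.var 0 fun _ => rfl) CompS.zero.wkV.wkV)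
            (CompP.adj hG.wkS.wkV.wkV (Comp.var 0 fun _ => rfl)
              (Comp.var 1 fun _ => rfl))))))).congr fun x => ?_
      ext v
      simp [expand])
  refine (Comp.ite_enc (fun a => Data.ofSet) (CompP.mem hv hs) h CompS.empty).congr fun a => ?_
  dsimp only
  split_ifs with hv
  · rw [comp_eq_iterate hv (by simpa using card_le_univ (s a))]
  · congr 1
    refine (eq_empty_of_forall_notMem fun x hx => hv ?_).symm
    exact (mem_comp.1 hx).1

lemma CompS.greedy (hG : Comp n env fun a => encodeGraph (G a)) (hs : CompS n env s)
    (ht : CompS n env t) :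
    CompS n env fun a => greedy (G a) (List.finRange (n a)) (s a) (t a) := by
  classical
  have hi : CompS (α := Σ a, Fin (n a) × Finset (Fin (n a))) (fun x => n x.1)
      (fun x => Data.ofNat x.2.1 :: Data.ofSet x.2.2 :: env x.1) fun x => Insert.insert x.2.1 x.2.2 :=
    CompS.insert (Comp.var 0 fun _ => rfl) (Comp.var 1 fun _ => rfl)
  refine (Comp.fold (n := n) (env := env) (β := fun a => Finset (Fin (n a)))
    (fun _ => Data.ofSet) (init := s)
    (F := fun a v H => if v ∈ t a ∧ Forest (G a) (Insert.insert v H) then Insert.insert v H else H) hs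
    (Comp.ite_enc (fun x => Data.ofSet)
      (CompP.and (CompP.mem (Comp.var 0 fun _ => rfl) ht.wkVS) (CompP.forest hG.wkVS hi)) hi
      (Comp.var 1 fun _ => rfl))).congr fun a => ?_
  simp only [MaxMinFVS.greedy]

lemma CompP.forced (hG : Comp n env fun a => encodeGraph (G a)) (hs : CompS n env s)
    (hv : CompV n env v) : CompP n env fun a => Forced (G a) (s a) (v a) := by
  refine (CompP.exists (P := fun a x => ∃ y, x ≠ y ∧ (G a).Adj (v a) x ∧ (G a).Adj (v a) y ∧
    y ∈ MaxMinFVS.comp (G a) (s a) x) (CompP.exists (CompP.and (CompP.not (CompV.eq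
      (Comp.var 1 fun _ => rfl) (Comp.var 0 fun _ => rfl)))
    (CompP.and (CompP.adj hG.wkV.wkV hv.wkV.wkV (Comp.var 1 fun _ => rfl))
    (CompP.and (CompP.adj hG.wkV.wkV hv.wkV.wkV (Comp.var 0 fun _ => rfl))
    (CompP.mem (Comp.var 0 fun _ => rfl) (CompS.comp hG.wkV.wkV hs.wkV.wkV
      (Comp.var 1 fun _ => rfl)))))))).congr fun a => ?_
  simp only [Forced, mem_comp]

lemma CompS.branchSet (hG : Comp n env fun a => encodeGraph (G a)) (hs : CompS n env s)
    (hv : CompV n env v) (hw : CompV n env w) :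
    CompS n env fun a => branchSet (G a) (s a) (v a) (w a) := by
  classical
  refine (Comp.ite_enc (fun a => Data.ofSet) (CompP.adj hG hv hw)
    (CompS.comp hG (CompS.erase hv hs) hw) CompS.empty).congr fun a => ?_
  simp only [MaxMinFVS.branchSet]

lemma CompP.validAt (hG : Comp n env fun a => encodeGraph (G a)) (hs : CompS n env s)
    (ht : CompS n env t) (hv : CompV n env v) (hw : CompV n env w) :
    CompP n env fun a => ValidAt (G a) (s a) (t a) (v a) (w a) := by
  refine CompP.and (CompP.mem hv ht) (CompP.and (CompP.three_le_eC hG (CompS.comp hG ht hv) hs)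
    (CompP.and (CompP.two_le_eC hG (CompS.sdiff (CompS.comp hG ht hv)
      (CompS.branchSet hG ht hv hw)) hs) (CompP.forall (CompP.imp (CompP.mem CompV.zero ht.wkV)
    (CompP.imp (CompP.adj hG.wkV hv.wkV CompV.zero) (CompP.imp (CompP.not (CompP.mem CompV.zero
      (CompS.branchSet hG.wkV ht.wkV hv.wkV hw.wkV))) ?_))))))
  exact (CompP.two_le_eC hG.wkV (CompS.comp hG.wkV (CompS.erase hv.wkV ht.wkV) CompV.zero)
    hs.wkV).not.congr fun a => by omega

end

/-! #### States -/

/-- The encoding of states as data. -/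
noncomputable def State.enc {n : ℕ} (s : State n) : Data :=
  .cons (Data.ofBool s.grow) (.cons (Data.ofSet s.F) (.cons (Data.ofSet s.D)
    (.cons (Data.ofSet s.D₁) (.cons (Data.ofNat s.eps) (.cons (Data.ofNat s.a)
      (.cons (Data.ofNat s.f) (.cons (Data.ofNat s.kap) (Data.ofNat s.nu))))))))

/-- The state-valued function `s` is computed by a term. -/
abbrev CompT {α : Type} (n : α → ℕ) (env : α → List Data) (s : ∀ a, State (n a)) : Prop :=
  Comp n env fun a => (s a).enc

/-- The function `l`, whose values are lists of states, is computed by a term. -/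
abbrev CompL {α : Type} (n : α → ℕ) (env : α → List Data) (l : ∀ a, List (State (n a))) : Prop :=
  Comp n env fun a => Data.ofList ((l a).map State.enc)

section
variable {α : Type} {n : α → ℕ} {env : α → List Data} {s : ∀ a, State (n a)}
  {l : ∀ a, List (State (n a))} {p : α → Prop} [∀ a, Decidable (p a)]
  {G : ∀ a, SimpleGraph (Fin (n a))} {X : ∀ a, Finset (Fin (n a))}

lemma CompT.grow (h : CompT n env s) : Comp n env fun a => Data.ofBool (s a).grow := Comp.hd h
lemma CompT.F (h : CompT n env s) : CompS n env fun a => (s a).F := (Comp.tl h).hd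
lemma CompT.D (h : CompT n env s) : CompS n env fun a => (s a).D := (Comp.tl h).tl.hd
lemma CompT.D₁ (h : CompT n env s) : CompS n env fun a => (s a).D₁ := (Comp.tl h).tl.tl.hd
lemma CompT.eps (h : CompT n env s) : CompN n env fun a => (s a).eps := (Comp.tl h).tl.tl.tl.hd
lemma CompT.a (h : CompT n env s) : CompN n env fun a => (s a).a := (Comp.tl h).tl.tl.tl.tl.hd
lemma CompT.f (h : CompT n env s) : CompN n env fun a => (s a).f := (Comp.tl h).tl.tl.tl.tl.tl.hd
lemma CompT.kap (h : CompT n env s) : CompN n env fun a => (s a).kap :=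
  (Comp.tl h).tl.tl.tl.tl.tl.tl.hd
lemma CompT.nu (h : CompT n env s) : CompN n env fun a => (s a).nu :=
  (Comp.tl h).tl.tl.tl.tl.tl.tl.tl

lemma CompT.isGrow (h : CompT n env s) : CompP n env fun a => (s a).grow = true :=
  (CompT.grow h).congr fun a => by simp [Data.ofProp]

lemma CompT.mk {g : α → Bool} {F D D₁ : ∀ a, Finset (Fin (n a))} {e a f κ ν : α → ℕ}
    (hg : Comp n env fun a => Data.ofBool (g a)) (hF : CompS n env F) (hD : CompS n env D)
    (hD₁ : CompS n env D₁) (he : CompN n env e) (ha : CompN n env a) (hf : CompN n env f)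
    (hκ : CompN n env κ) (hν : CompN n env ν) :
    CompT n env fun x => ⟨g x, F x, D x, D₁ x, e x, a x, f x, κ x, ν x⟩ :=
  hg.cons (hF.cons (hD.cons (hD₁.cons (he.cons (ha.cons (hf.cons (hκ.cons hν)))))))

lemma CompT.keep (h : CompT n env s) (hX : CompS n env X) :
    CompT n env fun a => (s a).keep (X a) :=
  CompT.mk (CompT.grow h) (CompS.union (CompT.F h) hX) (CompT.D h) (CompT.D₁ h) (CompT.eps h)
    (CompT.a h) (CompT.f h) (CompT.kap h) (CompT.nu h)

lemma CompT.del (h : CompT n env s) (hX : CompS n env X) : CompT n env fun a => (s a).del (X a) :=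
  CompT.mk (CompT.grow h) (CompT.F h) (CompS.union (CompT.D h) hX) (CompT.D₁ h) (CompT.eps h)
    (CompT.a h) (CompT.f h) (CompT.kap h) (CompT.nu h)

lemma CompT.del₁ (h : CompT n env s) (hX : CompS n env X) :
    CompT n env fun a => (s a).del₁ (X a) :=
  CompT.mk (CompT.grow h) (CompT.F h) (CompT.D h) (CompS.union (CompT.D₁ h) hX) (CompT.eps h)
    (CompT.a h) (CompT.f h) (CompT.kap h) (CompT.nu h)

lemma CompT.U (h : CompT n env s) : CompS n env fun a => (s a).U :=
  CompS.compl (CompS.union (CompS.union (CompT.F h) (CompT.D h)) (CompT.D₁ h))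

lemma CompT.H₁ (hG : Comp n env fun a => encodeGraph (G a)) (h : CompT n env s) :
    CompS n env fun a => (s a).H₁ (G a) :=
  CompS.greedy hG (CompT.F h) (CompT.U h)

lemma CompT.H₂ (hG : Comp n env fun a => encodeGraph (G a)) (h : CompT n env s) :
    CompS n env fun a => (s a).H₂ (G a) :=
  CompS.greedy hG (CompT.H₁ hG h) CompS.univ

lemma CompT.valid (hG : Comp n env fun a => encodeGraph (G a)) (h : CompT n env s) :
    CompS n env fun a => (s a).valid (G a) := by
  classical
  refine (CompS.filter (P := fun a p => ∃ q, ValidAt (G a) (s a).F (s a).U p q)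
    (CompP.exists (CompP.validAt hG.wkV.wkV (CompT.F h).wkV.wkV (CompT.U h).wkV.wkV
      (Comp.var 1 fun _ => rfl) (Comp.var 0 fun _ => rfl)))).congr fun a => ?_
  ext v
  simp [State.valid]

lemma CompT.needed (hG : Comp n env fun a => encodeGraph (G a)) (h : CompT n env s) :
    CompS n env fun a => (s a).needed (G a) := by
  classical
  have h1 := CompT.H₁ hG h
  refine (CompS.filter (P := fun a v => (v ∈ (s a).U ∧ v ∉ (s a).H₁ (G a)) ∧ ∃ p, p ∈ (s a).D₁ ∧
    ¬Forced (G a) ((s a).H₁ (G a)) p ∧ Forced (G a) (insert v ((s a).H₁ (G a))) p)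
    (CompP.and (CompP.and (CompP.mem CompV.zero (CompT.U h).wkV)
      (CompP.not (CompP.mem CompV.zero h1.wkV)))
    (CompP.exists (CompP.and (CompP.mem (Comp.var 0 fun _ => rfl) (CompT.D₁ h).wkV.wkV)
    (CompP.and (CompP.not (CompP.forced hG.wkV.wkV h1.wkV.wkV (Comp.var 0 fun _ => rfl)))
      (CompP.forced hG.wkV.wkV (CompS.insert (Comp.var 1 fun _ => rfl) h1.wkV.wkV)
        (Comp.var 0 fun _ => rfl))))))).congr fun a => ?_
  ext v
  simp [State.needed]

/-! #### Branching -/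

lemma CompL.nil : CompL n env fun _ => [] := Comp.nil

lemma CompL.cons (h : CompT n env s) (hl : CompL n env l) : CompL n env fun a => s a :: l a :=
  Comp.cons h hl

lemma CompL.ite {l' : ∀ a, List (State (n a))} (hp : CompP n env p) (hl : CompL n env l)
    (hl' : CompL n env l') : CompL n env fun a => if p a then l a else l' a :=
  Comp.ite_enc (β := fun a => List (State (n a))) (fun _ l => Data.ofList (l.map State.enc)) hp hl
    hl'

lemma CompL.ite_append {l' : ∀ a, List (State (n a))} (hp : CompP n env p) (h : CompT n env s)
    (hl' : CompL n env l') :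
    CompL n env fun a => (if p a then [s a] else []) ++ l' a :=
  (CompL.ite hp (CompL.cons h hl') hl').congr fun a => by
    by_cases hp : p a <;> simp [hp]

lemma CompL.branchInit (h : CompT n env s) (hX : CompS n env X) :
    CompL n env fun a => (s a).branchInit (X a) := by
  have hk := CompT.keep h hX
  have hd := CompT.del h hX
  refine CompL.cons (CompT.mk (CompT.grow hk) (CompT.F hk) (CompT.D hk) (CompT.D₁ hk) (CompT.eps hk)
    (Comp.ite_enc (fun _ => Data.ofNat) (CompT.isGrow h) (CompN.succ (CompT.a h)) (CompT.a h))
    (CompN.succ (CompT.f h)) (CompT.kap hk) (CompT.nu hk)) ?_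
  refine CompL.ite (CompP.or (CompT.isGrow h) (CompN.pos (CompT.eps h))) (CompL.cons ?_ CompL.nil)
    (CompL.ite (CompN.pos (CompT.a h)) (CompL.cons ?_ CompL.nil) CompL.nil)
  · exact CompT.mk (CompT.grow hd) (CompT.F hd) (CompT.D hd) (CompT.D₁ hd)
      (CompN.pred (CompT.eps h)) (CompT.a hd) (CompT.f hd) (CompT.kap hd) (CompT.nu hd)
  · exact CompT.mk (CompT.grow hd) (CompT.F hd) (CompT.D hd) (CompT.D₁ hd)
      (CompT.eps hd) (CompN.pred (CompT.a h)) (CompT.f hd) (CompN.succ (CompN.succ (CompT.kap h)))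
      (CompT.nu hd)

lemma CompL.branchValid (h : CompT n env s) (hX : CompS n env X) :
    CompL n env fun a => (s a).branchValid (X a) := by
  have hk := CompT.keep h hX
  have hd := CompT.del₁ h hX
  refine CompL.ite_append (CompN.pos (CompT.a h)) ?_
    (CompL.ite (CompN.pos (CompT.f h)) (CompL.cons ?_ CompL.nil) CompL.nil)
  · exact CompT.mk (CompT.grow hd) (CompT.F hd) (CompT.D hd) (CompT.D₁ hd) (CompT.eps hd)
      (CompN.pred (CompT.a h)) (CompT.f hd) (CompT.kap hd) (CompT.nu hd)
  · exact CompT.mk (CompT.grow hk) (CompT.F hk) (CompT.D hk) (CompT.D₁ hk) (CompT.eps hk)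
      (CompT.a hk) (CompN.pred (CompT.f h)) (CompT.kap hk) (CompT.nu hk)

lemma CompL.branchLast (h : CompT n env s) (hX : CompS n env X) :
    CompL n env fun a => (s a).branchLast (X a) := by
  have hk := CompT.keep h hX
  have hd := CompT.del h hX
  refine CompL.ite_append (CompN.pos (CompT.kap h)) ?_
    (CompL.ite (CompN.pos (CompT.nu h)) (CompL.cons ?_ CompL.nil) CompL.nil)
  · exact CompT.mk (CompT.grow hk) (CompT.F hk) (CompT.D hk) (CompT.D₁ hk) (CompT.eps hk)
      (CompT.a hk) (CompT.f hk) (CompN.pred (CompT.kap h)) (CompT.nu hk)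
  · exact CompT.mk (CompT.grow hd) (CompT.F hd) (CompT.D hd) (CompT.D₁ hd) (CompT.eps hd)
      (CompT.a hd) (CompT.f hd) (CompT.kap hd) (CompN.pred (CompT.nu h))

lemma Comp.some (hl : CompL n env l) : Comp n env fun a => encStep State.enc (some (l a)) :=
  Comp.nil.cons hl

lemma Comp.step {k : α → ℕ} (hG : Comp n env fun a => encodeGraph (G a)) (hk : CompN n env k)
    (hX : CompS n env X) (h : CompT n env s) :
    Comp n env fun a => encStep State.enc ((s a).step (G a) (k a) (X a)) := by
  classical
  have hUX := CompS.inter (CompT.U h) hX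
  have hv := CompT.valid hG h
  have hn := CompT.needed hG h
  have hl := CompS.sdiff (CompT.U h) (CompT.H₁ hG h)
  refine (Comp.ite_enc (fun _ => encStep State.enc)
    (CompP.not (CompP.forest hG (CompT.F h))) (Comp.some CompL.nil)
    (Comp.ite_enc (fun _ => encStep State.enc) (f := fun _ => none)
      (CompN.le hk (CompN.card (CompS.compl (CompT.H₂ hG h)))
        fun a => by simpa using card_le_univ ((s a).H₂ (G a))ᶜ)
      ((Comp.nil.cons Comp.nil).cons Comp.nil)
    (Comp.ite_enc (fun _ => encStep State.enc) (CompS.nonempty hUX)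
      (Comp.some (CompL.branchInit h (CompS.pick hUX)))
    (Comp.ite_enc (fun _ => encStep State.enc) (CompS.nonempty hv)
      (Comp.some (CompL.branchValid h (CompS.pick hv)))
    (Comp.ite_enc (fun _ => encStep State.enc) (CompS.nonempty hn)
      (Comp.some (CompL.cons (CompT.keep h (CompS.pick hn)) CompL.nil))
    (Comp.ite_enc (fun _ => encStep State.enc) (CompS.nonempty hl)
      (Comp.some (CompL.branchLast h (CompS.pick hl)))
      (Comp.some CompL.nil))))))).congr fun a => ?_
  simp only [State.step]

/-! #### Initial states -/

lemma CompL.pushAll {c : ∀ a, Fin (n a) → Prop} [∀ a, DecidablePred (c a)]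
    {f : ∀ a, Fin (n a) → State (n a)}
    (hc : CompP (α := Σ a, Fin (n a)) (fun x => n x.1) (fun x => Data.ofNat x.2 :: env x.1)
      fun x => c x.1 x.2)
    (hf : CompT (α := Σ a, Fin (n a)) (fun x => n x.1) (fun x => Data.ofNat x.2 :: env x.1)
      fun x => f x.1 x.2) (hl : CompL n env l) :
    CompL n env fun a => pushAll (c a) (f a) (l a) := by
  have v : CompL (α := Σ a, Fin (n a) × List (State (n a))) (fun x => n x.1)
      (fun x => Data.ofNat x.2.1 :: Data.ofList (x.2.2.map State.enc) :: env x.1) fun x => x.2.2 :=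
    Comp.var 1 fun _ => rfl
  have hc' := (hc.comap fun x : Σ a, Fin (n a) × List (State (n a)) => ⟨x.1, x.2.1⟩).wkOne
    (fun x => Data.ofList (x.2.2.map State.enc))
  have hf' := (hf.comap fun x : Σ a, Fin (n a) × List (State (n a)) => ⟨x.1, x.2.1⟩).wkOne
    (fun x => Data.ofList (x.2.2.map State.enc))
  exact Comp.fold (n := n) (env := env) (β := fun a => List (State (n a)))
    (fun _ l => Data.ofList (l.map State.enc)) (init := l)
    (F := fun a i l => if c a i then f a i :: l else l) hl
    (CompL.ite hc' (CompL.cons hf' v) v)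

lemma CompN.zero : CompN n env fun _ => 0 := Comp.nil

lemma CompN.size : CompN n env n :=
  (CompN.card (n := n) (env := env) CompS.univ).congr fun a => by simp

lemma CompT.initGrow {k m : α → ℕ} (hk : CompN n env k) (hm : CompN n env m)
    (hmn : ∀ a, m a ≤ n a) : CompT n env fun a => State.initGrow (n a) (k a) (m a) :=
  CompT.mk (Comp.nil.cons Comp.nil) CompS.empty CompS.empty CompS.empty CompN.zero hm
    (CompN.sub hk hm hmn) (CompN.succ CompN.zero) CompN.size

lemma CompT.initFixed {k e ν : α → ℕ} (hk : CompN n env k) (he : CompN n env e)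
    (hν : CompN n env ν) (hνn : ∀ a, ν a ≤ n a) :
    CompT n env fun a => State.initFixed (n a) (k a) (e a) (ν a) :=
  CompT.mk Comp.nil CompS.empty CompS.empty CompS.empty he (CompN.sub hk hν hνn) hν CompN.zero hν

lemma CompL.init {k : α → ℕ} (hk : CompN n env k) : CompL n env fun a => State.init (n a) (k a) := by
  have hkV := hk.wkV
  have hgrow : CompL n env fun a => MaxMinFVS.pushAll (fun i : Fin (n a) => (i : ℕ) + 1 ≤ k a)
      (fun i => State.initGrow (n a) (k a) (i + 1)) [] :=
    CompL.pushAll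
      ((CompN.pos (CompN.sub (k := fun x : Σ a, Fin (n a) => k x.1) (m := fun x => x.2) hkV
        CompV.zero fun x => x.2.2.le)).congr fun x => by
          rw [Nat.sub_pos_iff_lt]; rfl)
      (CompT.initGrow hkV (CompN.succ (k := fun x : Σ a, Fin (n a) => x.2) CompV.zero)
        fun x => x.2.2) CompL.nil
  refine CompL.ite (CompN.le hk CompN.size fun _ => le_rfl) (CompL.cons
    (CompT.initGrow hk CompN.zero fun _ => Nat.zero_le _) ?_) CompL.nil
  refine Comp.fold (n := n) (env := env) (β := fun a => List (State (n a)))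
    (fun _ l => Data.ofList (l.map State.enc)) (F := fun a e l =>
      MaxMinFVS.pushAll (fun ν : Fin (n a) => (ν : ℕ) ≤ k a)
        (fun ν => State.initFixed (n a) (k a) e ν) l) hgrow ?_
  have hk2 := (((hk.comap (Sigma.fst (β := fun a => Fin (n a) × List (State (n a))))).wk
    fun x => Data.ofList (x.2.2.map State.enc)).wk fun x => Data.ofNat x.2.1).wkV
  refine CompL.pushAll ?_ ?_ (Comp.var 1 fun _ => rfl)
  · refine (CompN.pos (CompN.sub (CompN.succ hk2) (Comp.var 0 fun _ => rfl)
      fun x => x.2.2.le)).congr fun x => ?_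
    rw [Nat.sub_pos_iff_lt, Nat.lt_succ_iff]
  · exact CompT.initFixed hk2 (Comp.var 1 fun _ => rfl) (Comp.var 0 fun _ => rfl) fun x => x.2.2.le

end

/-! ### Assembly of the decision procedure. -/

lemma Instance.isYes_iff (I : Instance) :
    I.IsYes ↔ ∃ H, MaxForest I.graph H ∧ I.k ≤ #Hᶜ := by
  constructor
  · rintro ⟨S, hS, hk⟩
    exact ⟨Sᶜ, isMinimalFVS_iff.1 hS, by rwa [compl_compl]⟩
  · rintro ⟨H, hH, hk⟩
    exact ⟨Hᶜ, isMinimalFVS_iff.2 (by rwa [compl_compl]), hk⟩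

theorem exists_program_decidesInTime : ∃ (P : Program) (C c : ℕ),
    P.DecidesInTime Instance.encode Instance.IsYes fun I => C * 10 ^ I.k * (I.n + 1) ^ c := by
  obtain ⟨initT, hinit⟩ : CompL (α := Instance) Instance.n
      (fun I => [encodeGraph I.graph, Data.ofNat I.k]) fun I => State.init I.n I.k :=
    CompL.init (Comp.var 1 fun _ => rfl)
  obtain ⟨stepT, hstep⟩ : Comp (α := Σ I : Instance, State I.n) (fun x => x.1.n)
      (fun x => [x.2.enc, encodeGraph x.1.graph, Data.ofNat x.1.k])
      fun x => encStep State.enc (x.2.step x.1.graph x.1.k (State.initSet x.1.graph)) := by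
    have hG : Comp (α := Σ I : Instance, State I.n) (fun x => x.1.n)
      (fun x => [x.2.enc, encodeGraph x.1.graph, Data.ofNat x.1.k])
      fun x => encodeGraph x.1.graph := Comp.var 1 fun _ => rfl
    exact Comp.step hG (Comp.var 2 fun _ => rfl)
      (CompS.compl (CompS.greedy hG CompS.empty CompS.univ)) (Comp.var 0 fun _ => rfl)
  obtain ⟨P, p, hP⟩ := exists_search_program initT stepT
  obtain ⟨K, d, hK⟩ := Polynomial_eval_le_mul_pow p
  refine ⟨P, 2 * K, d + 4, fun I => ?_⟩
  obtain ⟨b, N, hrun, hN, hb⟩ := State.exists_run_init I.graph I.k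
  obtain ⟨rows, hrows, hlen⟩ : ∃ rows, encodeGraph I.graph = Data.ofList rows ∧
      rows.length = I.n := ⟨_, encodeGraph_eq I.graph, List.length_ofFn⟩
  obtain ⟨t, ht, hout⟩ := hP (State I.n) rows (Data.ofNat I.k) State.enc (State.init I.n I.k)
    (State.step I.graph I.k (State.initSet I.graph))
    (by rw [hlen, ← hrows]; exact hinit I) (fun s => by rw [hlen, ← hrows]; exact hstep ⟨I, s⟩)
    (fun s ch h => State.step_length_le h) b N hrun
  refine ⟨b, t, ?_, ?_, hb.trans I.isYes_iff.symm⟩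
  · rw [Instance.encode, hrows]
    exact hout
  · rw [hlen] at ht
    -- Allows `N + 1` to be bounded by twice the bound for `N`, hence the constant `2 * K`.
    have h1 : 1 ≤ 10 ^ I.k * (I.n + 1) ^ 4 := Nat.one_le_iff_ne_zero.2 (by positivity)
    calc t ≤ p.eval I.n * (N + 1) := ht
      _ ≤ K * (I.n + 1) ^ d * (2 * (10 ^ I.k * (I.n + 1) ^ 4)) := by
        gcongr
        · exact hK I.n
        · omega
      _ = 2 * K * 10 ^ I.k * (I.n + 1) ^ (d + 4) := by ring

end MaxMinFVS

theorem theorem1 :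
    ∃ (P : MaxMinFVS.Program) (C c : ℕ),
      P.DecidesInTime MaxMinFVS.Instance.encode MaxMinFVS.Instance.IsYes
        (fun I => C * 10 ^ I.k * (I.n + 1) ^ c) :=
  MaxMinFVS.exists_program_decidesInTime
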